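/- Let $K\subset\mathbb{R}^3$ be a convex body, i.e. a compact convex set with non-empty interior. A lattice $\Lambda\subset\mathbb{R}^3$ is a set $\Lambda=A\mathbb{Z}^3$ with $A\in GL(3,\mathbb{R})$, and $d(\Lambda):=|\det A|$. The lattice of translates $\Lambda+K=\{x+y : x\in\Lambda,\ y\in K\}$ has density $D(\Lambda,K):=\mathrm{Vol}(K)/d(\Lambda)$, and it is called non-separable if every affine plane (2-dimensional affine subspace) in $\mathbb{R}^3$ meets $x+K$ for some $x\in\Lambda$. Define $$d_{3,2}(K):=\min\{D(\Lambda,K) : \Lambda\subset\mathbb{R}^3 \text{ is a lattice and } \Lambda+K \text{ is non-separable}\}$$ (the minimum exists). Then $$d_{3,2}(K)\ \ge\ \frac{1}{12}.$$ In addition, if $K$ is a simplex (the convex hull of four affinely independent points), then $d_{3,2}(K)=\frac{1}{12}$. -/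

import Mathlib

open MeasureTheory
open scoped Pointwise

/-- The lattice of translates `Λ + K` is non-separable: each affine `(n-1)`-dimensional subspace
of `ℝⁿ` meets `x + K` for some `x ∈ Λ`. -/
def NonSeparable {n : ℕ} (L : Submodule ℤ (EuclideanSpace ℝ (Fin n)))
    (K : Set (EuclideanSpace ℝ (Fin n))) : Prop :=
  ∀ H : AffineSubspace ℝ (EuclideanSpace ℝ (Fin n)),
    (H : Set (EuclideanSpace ℝ (Fin n))).Nonempty → Module.finrank ℝ H.direction + 1 = n →
      ∃ x ∈ L, ((H : Set (EuclideanSpace ℝ (Fin n))) ∩ (x +ᵥ K)).Nonempty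

/-- The density `Vol(K) / d(Λ)` of the lattice of translates `Λ + K`. The covolume of
`Λ = A ℤⁿ` with respect to Lebesgue measure is `|det A|`. -/
noncomputable def latticeDensity {n : ℕ} (L : Submodule ℤ (EuclideanSpace ℝ (Fin n)))
    (K : Set (EuclideanSpace ℝ (Fin n))) : ℝ :=
  volume.real K / ZLattice.covolume L volume

/-- The set of the densities of all non-separable lattices of translates of `K`, where a lattice
is a full-rank discrete subgroup of `ℝⁿ`. -/
def nonSeparableDensities {n : ℕ} (K : Set (EuclideanSpace ℝ (Fin n))) : Set ℝ :=
  {δ | ∃ (L : Submodule ℤ (EuclideanSpace ℝ (Fin n))) (_ : DiscreteTopology L)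
      (_ : IsZLattice ℝ L), NonSeparable L K ∧ δ = latticeDensity L K}

/-- The quantity `d_{n,n-1}(K)`, the minimal density of a non-separable lattice of translates
of `K`. It is written as an infimum; that it is attained is to be stated separately. -/
noncomputable def minNonSeparableDensity {n : ℕ} (K : Set (EuclideanSpace ℝ (Fin n))) : ℝ :=
  sInf (nonSeparableDensities K)

/-! Duality turns the problem into one about minimal lattices. Let `A ℤ³` be the dual of the
lattice. Its translates of `K` are non-separable exactly when `K` has width at least 1 in every
direction `A z`, `z ≠ 0` integral, i.e. when the support function of `K - K` is at least 1 there
(`Admissible`), and the density is Vol(K)·|det A|. Compactness on reduced bases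
(`exists_admissible_abs_det_le`) gives an `A` with |det A| least. A convex body whose difference
body contains x, y, z has volume at least |det(x, y, z)|/6 (`abs_det_le_six_mul_volume`). After the
change of coordinates making `A` the identity it therefore suffices to find three points of D = Aᵀ(K
- K) with determinant at least 1/2 (`IsSmoothWide.exists_half_le_abs_det`). Adding a small ball to
`K` makes D smooth, hence its support function a strictly convex norm; the general case is a limit
(`one_div_twelve_le_volume_mul`).

The argument looks at the minimal vectors `unitVectors D`. Strict convexity makes minimal vectors
congruent mod 2 equal up to sign, and makes three independent ones generate ℤ³ unless their sum is
even.

If no independent triple has even sum, minimal vectors whose classes form a line of the Fano plane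
are dependent. The Fano plane is not representable in characteristic zero (`false_of_fano`), so one
of its seven points carries no minimal vector. Stationarity of the minimum writes the identity as Σ
α p ⊗ u, with u minimal, p in D touching u, α ≥ 0 and Σ α = 3. By Cauchy–Binet 6 = Σ ααα det(p)
det(u) over ordered triples. Here |det u| ≤ 1, with 0 on lines, and the Fano plane without a point
is the cycle matroid of K₄; so Σ ααα |det u| is at most 6 times the largest Kirchhoff polynomial of
K₄ at total weight 3, which is 6·2 = 12. Hence some |det p| is at least 1/2.

If an independent triple has even sum, there are four integral vectors with sum zero whose pairwise
sums are minimal up to sign. Points of D where one of these four functionals is 1 define a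
four-state Markov chain, and the determinants of three such points are weights of spanning trees
directed to a root. Either one of them is at least 1/2, or the heaviest pair of disjoint two-cycles
dominates so strongly that two such points, and a point where a pairwise sum is 1, have determinant
at least 1/2 (`exists_half_le_abs_det_of_frame`).

For a simplex, a dual lattice on whose vectors the vertices take half-integral values with minimal
width 1 attains 1/12 (`admissible_simplex`). -/

/-! ### Spanning tree weights of a four-state Markov chain -/

/-- The real inequality behind the alternative between weights of rooted trees. -/
lemma rooted_tree_core {a a' b b' P Q : ℝ} (ha' : 0 ≤ a') (hb : 0 ≤ b)
    (hb' : 0 ≤ b') (ha : 0 ≤ a) (hP : 0 ≤ P) (hQ : 0 ≤ Q) (hPb : P ≤ b) (hQa : Q ≤ a)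
    (h : a * P + b * Q - P * Q + (a' + b' + a' * P + b' * Q) / 2 ≤ a * b - a' * b')
    (hs : a * b - a' * b' ≤ 1) :
    (P * (1 + a + a') - 1) * (Q * (1 + b + b') - 1) ≤ 2 - (a * b - a' * b') + a' + b' := by
  have h1 : P * Q ≤ b * Q := mul_le_mul_of_nonneg_right hPb hQ
  have h2 : P * Q ≤ a * P := by rw [mul_comm a]; exact mul_le_mul_of_nonneg_left hQa hP
  have n1 : 0 ≤ a' * P := by positivity
  have n2 : 0 ≤ b' * Q := by positivity
  -- Both `a * P` and `b * Q` are at least `P * Q`, so `h` and `hs` bound `P * Q`; in particular `P`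
  -- and `Q` cannot both exceed 1.
  have hPQ : P * Q ≤ 1 := by linarith
  have hPQ0 : 0 ≤ P * Q := by positivity
  set X := P * (1 + a + a') - 1 with hX
  set Y := Q * (1 + b + b') - 1 with hY
  have hX1 : -1 ≤ X := by have : 0 ≤ P * (1 + a + a') := by positivity
                          linarith
  have hY1 : -1 ≤ Y := by have : 0 ≤ Q * (1 + b + b') := by positivity
                          linarith
  -- Dropping `b * Q - P * Q` and the terms in `b'` from `h` leaves `a * P + a' * (1 + P) / 2 ≤ 1`.
  have hXu : X ≤ P + a' * (P - 1) / 2 := by rw [hX]; nlinarith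
  have hYu : Y ≤ Q + b' * (Q - 1) / 2 := by rw [hY]; nlinarith
  by_cases hXp : X ≤ 0
  · nlinarith
  by_cases hYp : Y ≤ 0
  · nlinarith
  push Not at hXp hYp
  by_cases hP1 : P ≤ 1
  · have e1 : X ≤ P := by nlinarith
    by_cases hQ1 : Q ≤ 1
    · have e2 : Y ≤ Q := by nlinarith
      have : X * Y ≤ P * Q := mul_le_mul e1 e2 hYp.le hP
      linarith
    · have e2 : Y ≤ Q * (1 + b' / 2) := by nlinarith
      have : X * Y ≤ P * (Q * (1 + b' / 2)) := mul_le_mul e1 e2 hYp.le hP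
      nlinarith
  · have hQ1 : Q ≤ 1 := by nlinarith
    have e2 : Y ≤ Q := by nlinarith
    have e1 : X ≤ P * (1 + a' / 2) := by nlinarith
    have : X * Y ≤ (P * (1 + a' / 2)) * Q := mul_le_mul e1 e2 hYp.le (by positivity)
    nlinarith

lemma le_add_of_mul_self_le_mul {x y e : ℝ} (hx : 0 ≤ x) (hy : 0 ≤ y) (h : e * e ≤ x * y) :
    e ≤ x + y := by
  by_contra! hlt
  have := mul_lt_mul'' hlt hlt (by positivity) (by positivity)
  nlinarith

/-- `hN` is T0 + T1 + T2 + T3 < 2, expanded by means of the row sums. If `t01 * t23 ≤ t03 * t21`,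
the maximality of the matching (`hB`, `hC`) lets the positive terms of the expansion absorb the
negative ones. -/
lemma pos_of_treeWeight_lt {t01 t02 t03 t10 t12 t13 t20 t21 t23 t30 t31 t32 : ℝ}
    (h01 : 0 ≤ t01) (h02 : 0 ≤ t02) (h03 : 0 ≤ t03) (h10 : 0 ≤ t10) (h12 : 0 ≤ t12)
    (h13 : 0 ≤ t13) (h20 : 0 ≤ t20) (h21 : 0 ≤ t21) (h23 : 0 ≤ t23) (h30 : 0 ≤ t30)
    (h31 : 0 ≤ t31) (h32 : 0 ≤ t32)
    (hB : t02 * t20 * (t13 * t31) ≤ t01 * t23 * (t10 * t32))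
    (hC : t03 * t21 * (t12 * t30) ≤ t01 * t23 * (t10 * t32))
    (hN : (t01 * t12 * t20 + t02 * t21 * t10 + t02 * t23 * t30 + t03 * t32 * t20)
      + (t13 * t30 * t01 + t10 * t03 * t31 + t13 * t32 * t21 + t12 * t23 * t31)
      + 2 * (t01 * t13 * t32 * t20 + t02 * t23 * t31 * t10 + t02 * t21 * t13 * t30
      + t03 * t31 * t12 * t20) - 2 * (t02 * t20 * (t13 * t31))
      - 2 * (t01 * t23 - t03 * t21) * (t10 * t32 - t12 * t30) < 0) :
    0 < t01 * t23 - t03 * t21 := by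
  have hX0 : 0 ≤ t10 * t32 := by positivity
  have hZ0 : 0 ≤ t12 * t30 := by positivity
  have hu0 : 0 ≤ t01 * t23 := by positivity
  have hw0 : 0 ≤ t03 * t21 := by positivity
  have he0 : 0 ≤ t02 * t20 := by positivity
  have hY0 : 0 ≤ t13 * t31 := by positivity
  obtain ⟨U, hU⟩ : ∃ U, U = (t01 * t12 * t20 + t02 * t21 * t10 + t02 * t23 * t30 + t03 * t32 * t20) := ⟨_, rfl⟩
  obtain ⟨V, hV⟩ : ∃ V, V = (t13 * t30 * t01 + t10 * t03 * t31 + t13 * t32 * t21 + t12 * t23 * t31) := ⟨_, rfl⟩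
  obtain ⟨W, hW⟩ : ∃ W, W = (t01 * t13 * t32 * t20 + t02 * t23 * t31 * t10 + t02 * t21 * t13 * t30
      + t03 * t31 * t12 * t20) := ⟨_, rfl⟩
  obtain ⟨s, hs⟩ : ∃ s, s = t01 * t23 - t03 * t21 := ⟨_, rfl⟩
  rw [← hU, ← hV, ← hW, ← hs] at hN
  rw [← hs]
  have hU0 : 0 ≤ U := by rw [hU]; positivity
  have hV0 : 0 ≤ V := by rw [hV]; positivity
  have hW0 : 0 ≤ W := by rw [hW]; positivity
  by_contra! hs0
  rcases le_or_gt (t12 * t30) (t10 * t32) with hr | hr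
  · have : s * (t10 * t32 - t12 * t30) ≤ 0 := mul_nonpos_of_nonpos_of_nonneg hs0 (by linarith)
    -- The first two summands of `W` have a product at least the square of `t02 * t20 * (t13 *
    -- t31)`, by `hB`, so their sum is at least that number.
    have hWW : t02 * t20 * (t13 * t31) ≤ W := by
      have e3 : 0 ≤ t02 * t21 * t13 * t30 + t03 * t31 * t12 * t20 := by positivity
      have e4 : (t01 * t13 * t32 * t20) * (t02 * t23 * t31 * t10) =
        (t02 * t20 * (t13 * t31)) * (t01 * t23 * (t10 * t32)) := by ring
      have e5 := mul_le_mul_of_nonneg_left hB (mul_nonneg he0 hY0)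
      rw [← e4] at e5
      have e6 := le_add_of_mul_self_le_mul (by positivity) (by positivity) e5
      rw [hW]; linarith
    linarith
  -- Now `hC` is only possible if `t03 * t21`, and with it `t01 * t23`, vanishes; then no negative
  -- term is left in `hN`.
  · have h1 : t01 * t23 ≤ t03 * t21 := by linarith
    have h2 : 0 < t12 * t30 := by linarith
    have h3 : t03 * t21 * (t12 * t30) ≤ t03 * t21 * (t10 * t32) :=
      hC.trans (mul_le_mul_of_nonneg_right h1 hX0)
    have h4 : t03 * t21 ≤ 0 := by
      by_contra! h5
      have := lt_of_lt_of_le (mul_lt_mul_of_pos_left hr h5) h3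
      exact lt_irrefl _ this
    have h5 : s = 0 := by
      have : t01 * t23 = 0 := by linarith
      have : t03 * t21 = 0 := by linarith
      linarith
    have h6 : t01 * t23 = 0 := by linarith
    rw [h6] at hB
    have : t02 * t20 * (t13 * t31) ≤ 0 := by linarith
    rw [h5] at hN
    linarith

/-- The terms ±2 of `hN` in `t01 t23 t10 t32`, `t02 t20 t13 t31`, `t01 t13 t32 t20` and `t02 t23 t31
t10` factor as the product on the right; the other terms either stay on the left or are nonnegative
and dropped. -/
lemma product_bound_of_treeWeight_lt {t01 t02 t03 t10 t12 t13 t20 t21 t23 t30 t31 t32 : ℝ}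
    (h01 : 0 ≤ t01) (h02 : 0 ≤ t02) (h03 : 0 ≤ t03) (h12 : 0 ≤ t12)
    (h13 : 0 ≤ t13) (h20 : 0 ≤ t20) (h21 : 0 ≤ t21) (h23 : 0 ≤ t23) (h30 : 0 ≤ t30)
    (h31 : 0 ≤ t31)
    (hs : 0 ≤ t01 * t23 - t03 * t21)
    (hN : (t01 * t12 * t20 + t02 * t21 * t10 + t02 * t23 * t30 + t03 * t32 * t20)
      + (t13 * t30 * t01 + t10 * t03 * t31 + t13 * t32 * t21 + t12 * t23 * t31)
      + 2 * (t01 * t13 * t32 * t20 + t02 * t23 * t31 * t10 + t02 * t21 * t13 * t30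
      + t03 * t31 * t12 * t20) - 2 * (t02 * t20 * (t13 * t31))
      - 2 * (t01 * t23 - t03 * t21) * (t10 * t32 - t12 * t30) < 0) :
    2 * t03 * t21 * (t10 * t32) + t10 * t03 * t31 + t13 * t32 * t21 + t02 * t21 * t10
      + t03 * t32 * t20 < 2 * (t01 * t32 - t02 * t31) * (t23 * t10 - t20 * t13) := by
  have k1 : 0 ≤ t13 * t30 * t01 + t12 * t23 * t31 := by positivity
  have k2 : 0 ≤ t01 * t12 * t20 + t02 * t23 * t30 := by positivity
  have k3 : 0 ≤ t02 * t21 * t13 * t30 + t03 * t31 * t12 * t20 := by positivity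
  have k4 : 0 ≤ (t01 * t23 - t03 * t21) * (t12 * t30) := mul_nonneg hs (by positivity)
  linarith

lemma mul_le_of_product_bound {t01 t02 t03 t10 t12 t13 t20 t21 t23 t30 t31 t32 : ℝ}
    (h01 : 0 ≤ t01) (h03 : 0 ≤ t03) (h12 : 0 ≤ t12)
    (h13 : 0 ≤ t13) (h21 : 0 ≤ t21) (h23 : 0 ≤ t23) (h30 : 0 ≤ t30)
    (h31 : 0 ≤ t31) (r0 : t01 + t02 + t03 = 1) (r1 : t10 + t12 + t13 = 1)
    (r2 : t20 + t21 + t23 = 1) (r3 : t30 + t31 + t32 = 1)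
    (p02 : 0 < t02) (p20 : 0 < t20) (p10 : 0 < t10) (p32 : 0 < t32)
    (hbad : t01 * t23 ≤ t02 * t20 + t03 * t21)
    (hB : t02 * t20 * (t13 * t31) ≤ t01 * t23 * (t10 * t32))
    (hN0 : 2 * t03 * t21 * (t10 * t32) + t10 * t03 * t31 + t13 * t32 * t21 + t02 * t21 * t10
      + t03 * t32 * t20 < 2 * (t01 * t32 - t02 * t31) * (t23 * t10 - t20 * t13)) :
    t13 * t31 ≤ t02 * t10 * t31 + t20 * t13 * t32 + (1 - t01 - t23) * (t10 * t32) := by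
  have hpos : 0 < (t01 * t32 - t02 * t31) * (t23 * t10 - t20 * t13) := by
    have : 0 ≤ 2 * t03 * t21 * (t10 * t32) + t10 * t03 * t31 + t13 * t32 * t21 + t02 * t21 * t10
      + t03 * t32 * t20 := by positivity
    linarith
  -- Two negative factors would give `t01 t32 t23 t10 < t02 t31 t20 t13`, against `hB`.
  have hboth : 0 < t01 * t32 - t02 * t31 ∧ 0 < t23 * t10 - t20 * t13 := by
    rcases mul_pos_iff.1 hpos with h | ⟨h1, h2⟩
    · exact h
    · exfalso
      have : (t01 * t32) * (t23 * t10) < (t02 * t31) * (t20 * t13) :=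
        mul_lt_mul'' (by linarith) (by linarith) (by positivity) (by positivity)
      linarith
  obtain ⟨hb1, hb2⟩ := hboth
  -- With these ratios the row sums turn `1 + a + a'` and `1 + b + b'` into `1 / t02` and `1 / t20`.
  -- The two positive factors say `P ≤ b` and `Q ≤ a`, and `hbad` says `a * b - a' * b' ≤ 1`.
  have hfin := rooted_tree_core (a := t01 / t02) (a' := t03 / t02) (b := t23 / t20)
    (b' := t21 / t20) (P := t13 / t10) (Q := t31 / t32) (by positivity) (by positivity)
    (by positivity) (by positivity) (by positivity) (by positivity)
    (by rw [div_le_div_iff₀ p10 p20]; linarith) (by rw [div_le_div_iff₀ p32 p02]; linarith)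
    (by
      rw [← sub_nonneg]
      have : t01 / t02 * (t23 / t20) - t03 / t02 * (t21 / t20) - (t01 / t02 * (t13 / t10) +
        t23 / t20 * (t31 / t32) - t13 / t10 * (t31 / t32) + (t03 / t02 + t21 / t20 +
        t03 / t02 * (t13 / t10) + t21 / t20 * (t31 / t32)) / 2) =
        ((t01 * t32 - t02 * t31) * (t23 * t10 - t20 * t13) - t03 * t21 * (t10 * t32)
         - (t03 * t20 * t32 * (t10 + t13) + t21 * t02 * t10 * (t32 + t31)) / 2)
         / (t02 * t20 * t10 * t32) := by field_simp; ring
      rw [this]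
      apply div_nonneg _ (by positivity)
      have e1 : t10 + t13 ≤ 1 := by linarith
      have e2 : t32 + t31 ≤ 1 := by linarith
      have e3 : t03 * t20 * t32 * (t10 + t13) ≤ t03 * t20 * t32 :=
        mul_le_of_le_one_right (by positivity) e1
      have e4 : t21 * t02 * t10 * (t32 + t31) ≤ t21 * t02 * t10 :=
        mul_le_of_le_one_right (by positivity) e2
      have e5 : 0 ≤ t10 * t03 * t31 := by positivity
      have e6 : 0 ≤ t13 * t32 * t21 := by positivity
      nlinarith)
    (by
      have : t01 / t02 * (t23 / t20) - t03 / t02 * (t21 / t20) = (t01 * t23 - t03 * t21) / (t02 * t20) := by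
        field_simp
      rw [this, div_le_one (by positivity)]; linarith)
  have e0 : 1 + t01 / t02 + t03 / t02 = 1 / t02 := by field_simp; linarith
  have e1 : 1 + t23 / t20 + t21 / t20 = 1 / t20 := by field_simp; linarith
  rw [e0, e1] at hfin
  have e2 : 2 - (t01 / t02 * (t23 / t20) - t03 / t02 * (t21 / t20)) + t03 / t02 + t21 / t20
      = (1 - t01 - t23 + t02 * t20) / (t02 * t20) := by
    have : t03 = 1 - t01 - t02 := by linarith
    have : t21 = 1 - t20 - t23 := by linarith
    subst t03 t21
    field_simp; ring
  have e3 : (t13 / t10 * (1 / t02) - 1) * (t31 / t32 * (1 / t20) - 1) =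
      ((t13 - t02 * t10) * (t31 - t20 * t32) / (t10 * t32)) / (t02 * t20) := by
    field_simp
  rw [e2, e3, div_le_div_iff_of_pos_right (by positivity), div_le_iff₀ (by positivity)] at hfin
  nlinarith

/-- In a four-state Markov chain without loops whose strongest pair of disjoint two-cycles is
`{0, 1}`, `{2, 3}`, some vertex has large weight unless the transitions `0 → 1`, `2 → 3` dominate.
The numbers `T_r` are the weights of the spanning trees directed to `r`. -/
lemma one_le_treeWeight_add {t01 t02 t03 t10 t12 t13 t20 t21 t23 t30 t31 t32 : ℝ}
    (h01 : 0 ≤ t01) (h02 : 0 ≤ t02) (h03 : 0 ≤ t03) (h10 : 0 ≤ t10) (h12 : 0 ≤ t12)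
    (h13 : 0 ≤ t13) (h20 : 0 ≤ t20) (h21 : 0 ≤ t21) (h23 : 0 ≤ t23) (h30 : 0 ≤ t30)
    (h31 : 0 ≤ t31) (h32 : 0 ≤ t32) (r0 : t01 + t02 + t03 = 1) (r1 : t10 + t12 + t13 = 1)
    (r2 : t20 + t21 + t23 = 1) (r3 : t30 + t31 + t32 = 1)
    (hbad : t01 * t23 ≤ t02 * t20 + t03 * t21)
    (hB : t02 * t20 * (t13 * t31) ≤ t01 * t23 * (t10 * t32))
    (hC : t03 * t21 * (t12 * t30) ≤ t01 * t23 * (t10 * t32)) {T0 T1 T2 T3 : ℝ}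
    (hT0 : T0 = t10 * (1 - t23 * t32) + t13 * (t30 + t32 * t20) + t12 * (t20 + t23 * t30))
    (hT2 : T2 = t32 * (1 - t01 * t10) + t31 * (t12 + t10 * t02) + t30 * (t02 + t01 * t12))
    (hT1 : T1 = t01 * (1 - t23 * t32) + t03 * (t31 + t32 * t21) + t02 * (t21 + t23 * t31))
    (hT3 : T3 = t13 * (1 - t20 * t02) + t10 * (t03 + t02 * t23) + t12 * (t23 + t20 * t03)) :
    1 ≤ T0 + T2 ∨ 2 ≤ T0 + T1 + T2 + T3 := by
  by_contra! hcon
  obtain ⟨hM, hN⟩ := hcon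
  have hNe : T0 + T1 + T2 + T3 - 2 = (t01 * t12 * t20 + t02 * t21 * t10 + t02 * t23 * t30 + t03 * t32 * t20)
      + (t13 * t30 * t01 + t10 * t03 * t31 + t13 * t32 * t21 + t12 * t23 * t31)
      + 2 * (t01 * t13 * t32 * t20 + t02 * t23 * t31 * t10 + t02 * t21 * t13 * t30
      + t03 * t31 * t12 * t20) - 2 * (t02 * t20 * (t13 * t31))
      - 2 * (t01 * t23 - t03 * t21) * (t10 * t32 - t12 * t30) := by
    obtain rfl : t03 = 1 - t01 - t02 := by linarith
    obtain rfl : t12 = 1 - t10 - t13 := by linarith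
    obtain rfl : t21 = 1 - t20 - t23 := by linarith
    obtain rfl : t30 = 1 - t31 - t32 := by linarith
    rw [hT0, hT1, hT2, hT3]; ring
  have hMe : T0 + T2 - 1 = t02 * t20 - t13 * t31
      + (t01 * t12 * t20 + t02 * t21 * t10 + t02 * t23 * t30 + t03 * t32 * t20)
      + (t01 * t13 * t32 * t20 + t02 * t23 * t31 * t10 + t02 * t21 * t13 * t30
      + t03 * t31 * t12 * t20) - t02 * t20 * (t13 * t31)
      - (t01 * t23 - t03 * t21) * (t10 * t32 - t12 * t30) := by
    obtain rfl : t03 = 1 - t01 - t02 := by linarith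
    obtain rfl : t12 = 1 - t10 - t13 := by linarith
    obtain rfl : t21 = 1 - t20 - t23 := by linarith
    obtain rfl : t30 = 1 - t31 - t32 := by linarith
    rw [hT0, hT2]; ring
  -- A second expansion, for the final contradiction: `mul_le_of_product_bound` says that three of
  -- the terms here outweigh `t13 * t31`. The expansion `hMe` only serves to exclude `t13 * t31 =
  -- 0`.
  have hMe2 : T0 + T2 - 1 = t02 * (t10 * t30 + t10 * t31 + t13 * t30)
      + t20 * (t12 * t31 + t12 * t32 + t13 * t32) + (1 - t01 - t23) * (t10 * t32)
      + (1 - t21 - t03) * (t12 * t30) - t13 * t31 := by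
    obtain rfl : t03 = 1 - t01 - t02 := by linarith
    obtain rfl : t12 = 1 - t10 - t13 := by linarith
    obtain rfl : t21 = 1 - t20 - t23 := by linarith
    obtain rfl : t30 = 1 - t31 - t32 := by linarith
    rw [hT0, hT2]; ring
  clear hT0 hT1 hT2 hT3
  have hN' := hN
  rw [← sub_neg, hNe] at hN'
  have hspos := pos_of_treeWeight_lt h01 h02 h03 h10 h12 h13 h20 h21 h23 h30 h31 h32
    hB hC hN'
  have hN0 := product_bound_of_treeWeight_lt h01 h02 h03 h12 h13 h20 h21 h23 h30 h31
    hspos.le hN'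
  clear hN' hNe hN
  have hX1 : t10 * t32 ≤ 1 := mul_le_one₀ (by linarith) h32 (by linarith)
  have hX0 : 0 ≤ t10 * t32 := by positivity
  have hZ0 : 0 ≤ t12 * t30 := by positivity
  have hw0 : 0 ≤ t03 * t21 := by positivity
  have hY0 : 0 ≤ t13 * t31 := by positivity
  have hU0 : 0 ≤ (t01 * t12 * t20 + t02 * t21 * t10 + t02 * t23 * t30 + t03 * t32 * t20) := by positivity
  have hW0 : 0 ≤ (t01 * t13 * t32 * t20 + t02 * t23 * t31 * t10 + t02 * t21 * t13 * t30
      + t03 * t31 * t12 * t20) := by positivity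
  have hε : 0 < t02 * t20 := by linarith
  -- With s = `t01 * t23 - t03 * t21`, if `t13 * t31` vanished `hMe` would give T0 + T2 - 1 ≥ `t02 *
  -- t20` - s · `t10 * t32` ≥ `t02 * t20` - s, which is nonnegative by `hbad`.
  have hYpos : 0 < t13 * t31 := by
    rcases hY0.eq_or_lt with hY | hY
    · exfalso
      rw [← hY] at hMe
      have : (t01 * t23 - t03 * t21) * (t10 * t32) ≤ (t01 * t23 - t03 * t21) * 1 :=
        mul_le_mul_of_nonneg_left hX1 hspos.le
      have := mul_nonneg hspos.le hZ0
      linarith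
    · exact hY
  have p02 : 0 < t02 := lt_of_le_of_ne h02 (by rintro rfl; simp at hε)
  have p20 : 0 < t20 := lt_of_le_of_ne h20 (by rintro rfl; simp at hε)
  have p13 : 0 < t13 := lt_of_le_of_ne h13 (by rintro rfl; simp at hYpos)
  have p31 : 0 < t31 := lt_of_le_of_ne h31 (by rintro rfl; simp at hYpos)
  have hXpos : 0 < t01 * t23 * (t10 * t32) := lt_of_lt_of_le (mul_pos hε hYpos) hB
  have p10 : 0 < t10 := lt_of_le_of_ne h10 (by rintro rfl; simp at hXpos)
  have p32 : 0 < t32 := lt_of_le_of_ne h32 (by rintro rfl; simp at hXpos)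
  clear hMe hU0 hW0
  have hfin2 := mul_le_of_product_bound h01 h03 h12 h13 h21 h23 h30 h31 r0 r1 r2 r3
    p02 p20 p10 p32 hbad hB hN0
  have k1 : 0 ≤ t02 * (t10 * t30 + t13 * t30) := by positivity
  have k2 : 0 ≤ t20 * (t12 * t31 + t12 * t32) := by positivity
  have k3 : 0 ≤ (1 - t21 - t03) * (t12 * t30) := by
    apply mul_nonneg _ hZ0
    -- The left side is 1 - t21 - t03; it is nonnegative because (1 - t21)(1 - t03) ≥ t23 t01 > t21
    -- t03.
    have : (1 - t21) * (1 - t03) - t21 * t03 ≥ 0 := by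
      have : t21 * t03 < t23 * t01 := by linarith
      have e1 : t23 ≤ 1 - t21 := by linarith
      have e2 : t01 ≤ 1 - t03 := by linarith
      have := mul_le_mul e1 e2 h01 (by linarith)
      linarith
    linarith
  linarith

/-! ### Three points of large determinant from a frame -/

/-- The principal `3 × 3` minor of the Laplacian-like matrix with unit diagonal and off-diagonal
entries `-t a b`. -/
def treeMinor (t : Fin 4 → Fin 4 → ℝ) (i j k : Fin 4) : ℝ :=
  1 - t i j * t j i - t i k * t k i - t j k * t k j - t i j * t j k * t k i - t i k * t k j * t j i

/-- As the rows sum to one, the matrix-tree theorem identifies `treeMinor t j k l` with the weight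
of the trees directed to `i`. Either two of the four weights sum to at least 1 or all four to at
least 2. -/
lemma half_le_treeMinor_of_bad {t : Fin 4 → Fin 4 → ℝ} (h : ∀ a b, 0 ≤ t a b) {i j k l : Fin 4}
    (ri : t i j + t i k + t i l = 1) (rj : t j i + t j k + t j l = 1)
    (rk : t k i + t k j + t k l = 1) (rl : t l i + t l j + t l k = 1)
    (hbad : t i j * t k l ≤ t i k * t k i + t i l * t k j)
    (hB : t i k * t k i * (t j l * t l j) ≤ t i j * t j i * (t k l * t l k))
    (hC : t i l * t l i * (t j k * t k j) ≤ t i j * t j i * (t k l * t l k)) :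
    1 / 2 ≤ treeMinor t j k l ∨ 1 / 2 ≤ treeMinor t i k l ∨ 1 / 2 ≤ treeMinor t i j l ∨
      1 / 2 ≤ treeMinor t i j k := by
  have key := one_le_treeWeight_add (h i j) (h i k) (h i l) (h j i) (h j k) (h j l) (h k i) (h k j)
    (h k l) (h l i) (h l j) (h l k) ri (by linarith) rk (by linarith) hbad
    (by linarith) (by linarith) (T0 := treeMinor t j k l) (T1 := treeMinor t i k l)
    (T2 := treeMinor t i j l) (T3 := treeMinor t i j k)
    (by
      have e1 : t j i = 1 - t j k - t j l := by linarith
      have e2 : t k i = 1 - t k j - t k l := by linarith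
      have e3 : t l i = 1 - t l j - t l k := by linarith
      rw [treeMinor, e1, e2, e3]; ring)
    (by
      have e1 : t i k = 1 - t i j - t i l := by linarith
      have e2 : t j k = 1 - t j i - t j l := by linarith
      have e3 : t l k = 1 - t l j - t l i := by linarith
      rw [treeMinor, e1, e2, e3]; ring)
    (by
      have e1 : t i j = 1 - t i k - t i l := by linarith
      have e2 : t k j = 1 - t k i - t k l := by linarith
      have e3 : t l j = 1 - t l i - t l k := by linarith
      rw [treeMinor, e1, e2, e3]; ring)
    (by
      have e1 : t i l = 1 - t i k - t i j := by linarith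
      have e2 : t j l = 1 - t j i - t j k := by linarith
      have e3 : t k l = 1 - t k j - t k i := by linarith
      rw [treeMinor, e1, e2, e3]; ring)
  by_contra! hcon
  obtain ⟨h1, h2, h3, h4⟩ := hcon
  rcases key with key | key <;> linarith

/-- The two-cycles `{i, k}`, and the transitions `i → l`, `k → j`, do not outweigh `i → j`,
`k → l`. -/
def DominatingPair (t : Fin 4 → Fin 4 → ℝ) (i j k l : Fin 4) : Prop :=
  t i k * t k i + t i l * t k j ≤ t i j * t k l

/-- Maximality of the matching {i, j}, {k, l} is unaffected by exchanging i with j or k with l, so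
the previous lemma applies to any of the four orientations that fails to dominate. -/
lemma half_le_treeMinor_or_dominatingPair {t : Fin 4 → Fin 4 → ℝ} (h : ∀ a b, 0 ≤ t a b)
    {i j k l : Fin 4}
    (ri : t i j + t i k + t i l = 1) (rj : t j i + t j k + t j l = 1)
    (rk : t k i + t k j + t k l = 1) (rl : t l i + t l j + t l k = 1)
    (hB : t i k * t k i * (t j l * t l j) ≤ t i j * t j i * (t k l * t l k))
    (hC : t i l * t l i * (t j k * t k j) ≤ t i j * t j i * (t k l * t l k)) :
    (1 / 2 ≤ treeMinor t j k l ∨ 1 / 2 ≤ treeMinor t i k l ∨ 1 / 2 ≤ treeMinor t i j l ∨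
      1 / 2 ≤ treeMinor t i j k) ∨
    (DominatingPair t i j k l ∧ DominatingPair t i j l k ∧ DominatingPair t j i k l ∧
      DominatingPair t j i l k) := by
  by_contra! hcon
  obtain ⟨⟨h1, h2, h3, h4⟩, hcon⟩ := hcon
  have d1 : DominatingPair t i j k l := by
    by_contra hb
    rw [DominatingPair, not_le] at hb
    have := half_le_treeMinor_of_bad h ri rj rk rl hb.le hB hC
    grind
  have d2 : DominatingPair t i j l k := by
    by_contra hb
    rw [DominatingPair, not_le] at hb
    have := half_le_treeMinor_of_bad h (i := i) (j := j) (k := l) (l := k) (by linarith)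
      (by linarith) (by linarith) (by linarith) hb.le (by linarith) (by linarith)
    have e1 : treeMinor t j l k = treeMinor t j k l := by unfold treeMinor; ring
    have e2 : treeMinor t i l k = treeMinor t i k l := by unfold treeMinor; ring
    grind
  have d3 : DominatingPair t j i k l := by
    by_contra hb
    rw [DominatingPair, not_le] at hb
    have := half_le_treeMinor_of_bad h (i := j) (j := i) (k := k) (l := l) (by linarith)
      (by linarith) (by linarith) (by linarith) hb.le (by linarith) (by linarith)
    have e1 : treeMinor t j i k = treeMinor t i j k := by unfold treeMinor; ring
    have e2 : treeMinor t j i l = treeMinor t i j l := by unfold treeMinor; ring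
    grind
  have d4 : DominatingPair t j i l k := by
    by_contra hb
    rw [DominatingPair, not_le] at hb
    have := half_le_treeMinor_of_bad h (i := j) (j := i) (k := l) (l := k) (by linarith)
      (by linarith) (by linarith) (by linarith) hb.le (by linarith) (by linarith)
    have e1 : treeMinor t j i k = treeMinor t i j k := by unfold treeMinor; ring
    have e2 : treeMinor t j i l = treeMinor t i j l := by unfold treeMinor; ring
    have e3 : treeMinor t i l k = treeMinor t i k l := by unfold treeMinor; ring
    have e4 : treeMinor t j l k = treeMinor t j k l := by unfold treeMinor; ring
    grind
  exact hcon d1 d2 d3 d4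

/-- The right side is, up to sign, the determinant of q_i, q_k and a point where the functionals i,
j, k, l equal 1/2 + m, 1/2 - m, -1/2 + n, -1/2 - n. The part free of m and n exceeds 1/2 by half the
slack in `DominatingPair`. -/
lemma half_le_of_dominatingPair {t : Fin 4 → Fin 4 → ℝ} (h : ∀ a b, 0 ≤ t a b) {i j k l : Fin 4}
    (ri : t i j + t i k + t i l = 1) (rk : t k i + t k j + t k l = 1)
    (hg : DominatingPair t i j k l) {m n : ℝ} (hm : m ≤ 0) (hn : 0 ≤ n) :
    1 / 2 ≤ 1 / 2 * (t i j + t k l + t i k * t k j + t k i * t i l)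
      - m * (t i l + t i k * t k l) + n * (t k j + t k i * t i j) := by
  have h1 : 0 ≤ (-m) * (t i l + t i k * t k l) := by
    have := h i l; have := h i k; have := h k l
    have : 0 ≤ -m := by linarith
    positivity
  have h2 : 0 ≤ n * (t k j + t k i * t i j) := by
    have := h k j; have := h k i; have := h i j
    positivity
  have h3 : t i j + t k l + t i k * t k j + t k i * t i l - 1
      = t i j * t k l - t i k * t k i - t i l * t k j := by
    have e1 : t i l = 1 - t i j - t i k := by linarith
    have e2 : t k j = 1 - t k i - t k l := by linarith
    rw [e1, e2]; ring
  rw [DominatingPair] at hg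
  linarith

set_option maxHeartbeats 1000000 in
/-- Four functionals summing to zero, all of whose pairwise sums are bounded by `1` on a set `D`,
while each single functional and each pairwise sum takes the value `1`: three points of `D` have
determinant at least `1 / 2`. The functionals are `x 0`, `x 1`, `x 2` and minus their sum. -/
theorem exists_half_le_abs_det_of_frame {D : Set (Fin 3 → ℝ)}
    (h01 : ∀ x ∈ D, |x 0 + x 1| ≤ 1) (h02 : ∀ x ∈ D, |x 0 + x 2| ≤ 1)
    (h12 : ∀ x ∈ D, |x 1 + x 2| ≤ 1) (q0 : ∃ x ∈ D, x 0 + x 1 + x 2 = -1)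
    (q1 : ∃ x ∈ D, x 0 = 1) (q2 : ∃ x ∈ D, x 1 = 1) (q3 : ∃ x ∈ D, x 2 = 1)
    (p1 : ∃ x ∈ D, x 1 + x 2 = -1) (p2 : ∃ x ∈ D, x 0 + x 2 = -1)
    (p3 : ∃ x ∈ D, x 0 + x 1 = -1) :
    ∃ x ∈ D, ∃ y ∈ D, ∃ z ∈ D, 1 / 2 ≤ |(Matrix.of ![x, y, z]).det| := by
  obtain ⟨q0, m0, e0⟩ := q0
  obtain ⟨q1, m1, e1⟩ := q1
  obtain ⟨q2, m2, e2⟩ := q2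
  obtain ⟨q3, m3, e3⟩ := q3
  obtain ⟨p1, n1, g1⟩ := p1
  obtain ⟨p2, n2, g2⟩ := p2
  obtain ⟨p3, n3, g3⟩ := p3
  have a0 := abs_le.1 (h01 _ m0); have b0 := abs_le.1 (h02 _ m0); have c0 := abs_le.1 (h12 _ m0)
  have a1 := abs_le.1 (h01 _ m1); have b1 := abs_le.1 (h02 _ m1); have c1 := abs_le.1 (h12 _ m1)
  have a2 := abs_le.1 (h01 _ m2); have b2 := abs_le.1 (h02 _ m2); have c2 := abs_le.1 (h12 _ m2)
  have a3 := abs_le.1 (h01 _ m3); have b3 := abs_le.1 (h02 _ m3); have c3 := abs_le.1 (h12 _ m3)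
  clear h01 h02 h12
  -- Functional 0 is minus the sum, functionals 1, 2, 3 are the coordinates, and `t a b` is minus
  -- the value of functional b at q_a. Functional a is 1 there, so the bounds on pairwise sums give
  -- `t a b ≥ 0`, and the vanishing total gives row sums 1.
  obtain ⟨t, ht⟩ : ∃ t : Fin 4 → Fin 4 → ℝ, t = ![![0, -q0 0, -q0 1, -q0 2],
    ![q1 0 + q1 1 + q1 2, 0, -q1 1, -q1 2], ![q2 0 + q2 1 + q2 2, -q2 0, 0, -q2 2],
    ![q3 0 + q3 1 + q3 2, -q3 0, -q3 1, 0]] := ⟨_, rfl⟩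
  have t01 : t 0 1 = -q0 0 := by rw [ht]; rfl
  have t02 : t 0 2 = -q0 1 := by rw [ht]; rfl
  have t03 : t 0 3 = -q0 2 := by rw [ht]; rfl
  have t10 : t 1 0 = q1 0 + q1 1 + q1 2 := by rw [ht]; rfl
  have t12 : t 1 2 = -q1 1 := by rw [ht]; rfl
  have t13 : t 1 3 = -q1 2 := by rw [ht]; rfl
  have t20 : t 2 0 = q2 0 + q2 1 + q2 2 := by rw [ht]; rfl
  have t21 : t 2 1 = -q2 0 := by rw [ht]; rfl
  have t23 : t 2 3 = -q2 2 := by rw [ht]; rfl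
  have t30 : t 3 0 = q3 0 + q3 1 + q3 2 := by rw [ht]; rfl
  have t31 : t 3 1 = -q3 0 := by rw [ht]; rfl
  have t32 : t 3 2 = -q3 1 := by rw [ht]; rfl
  have hnn : ∀ a b, 0 ≤ t a b := by
    intro a b
    rw [ht]
    fin_cases a <;> fin_cases b <;> simp <;> linarith
  clear ht
  have r0 : t 0 1 + t 0 2 + t 0 3 = 1 := by linarith
  have r1 : t 1 0 + t 1 2 + t 1 3 = 1 := by linarith
  have r2 : t 2 0 + t 2 1 + t 2 3 = 1 := by linarith
  have r3 : t 3 0 + t 3 1 + t 3 2 = 1 := by linarith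
  have Q0 : q0 = ![-t 0 1, -t 0 2, -t 0 3] := by
    ext i; fin_cases i <;> simp [t01, t02, t03]
  have Q1 : q1 = ![1, -t 1 2, -t 1 3] := by
    ext i; fin_cases i <;> simp [e1, t12, t13]
  have Q2 : q2 = ![-t 2 1, 1, -t 2 3] := by
    ext i; fin_cases i <;> simp [e2, t21, t23]
  have Q3 : q3 = ![-t 3 1, -t 3 2, 1] := by
    ext i; fin_cases i <;> simp [e3, t31, t32]
  clear t01 t02 t03 t10 t12 t13 t20 t21 t23 t30 t31 t32 a0 b0 c0 a1 b1 c1 a2 b2 c2 a3 b3 c3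
    e0 e1 e2 e3
  have hminor : (1 / 2 ≤ treeMinor t 1 2 3 ∨ 1 / 2 ≤ treeMinor t 0 2 3 ∨ 1 / 2 ≤ treeMinor t 0 1 3 ∨
      1 / 2 ≤ treeMinor t 0 1 2) →
      ∃ x ∈ D, ∃ y ∈ D, ∃ z ∈ D, 1 / 2 ≤ |(Matrix.of ![x, y, z]).det| := by
    rintro (h | h | h | h)
    · refine ⟨q1, m1, q2, m2, q3, m3, le_abs.2 (Or.inl ?_)⟩
      rw [Q1, Q2, Q3, Matrix.det_fin_three]
      simp [treeMinor] at h ⊢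
      linarith
    · refine ⟨q0, m0, q2, m2, q3, m3, le_abs.2 (Or.inr ?_)⟩
      rw [Q0, Q2, Q3, Matrix.det_fin_three]
      have f1 : t 0 1 = 1 - t 0 2 - t 0 3 := by linarith
      have f2 : t 2 1 = 1 - t 2 0 - t 2 3 := by linarith
      have f3 : t 3 1 = 1 - t 3 0 - t 3 2 := by linarith
      simp [treeMinor, f1, f2, f3] at h ⊢
      linarith
    · refine ⟨q0, m0, q1, m1, q3, m3, le_abs.2 (Or.inl ?_)⟩
      rw [Q0, Q1, Q3, Matrix.det_fin_three]
      have f1 : t 0 2 = 1 - t 0 1 - t 0 3 := by linarith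
      have f2 : t 1 2 = 1 - t 1 0 - t 1 3 := by linarith
      have f3 : t 3 2 = 1 - t 3 0 - t 3 1 := by linarith
      simp [treeMinor, f1, f2, f3] at h ⊢
      linarith
    · refine ⟨q0, m0, q1, m1, q2, m2, le_abs.2 (Or.inr ?_)⟩
      rw [Q0, Q1, Q2, Matrix.det_fin_three]
      have f1 : t 0 3 = 1 - t 0 1 - t 0 2 := by linarith
      have f2 : t 1 3 = 1 - t 1 0 - t 1 2 := by linarith
      have f3 : t 2 3 = 1 - t 2 0 - t 2 1 := by linarith
      simp [treeMinor, f1, f2, f3] at h ⊢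
      linarith
  -- Choose the heaviest of the three perfect matchings of the four states, weighted by the product
  -- of its two two-cycles.
  rcases (by grind : (t 0 2 * t 2 0 * (t 1 3 * t 3 1) ≤ t 0 1 * t 1 0 * (t 2 3 * t 3 2) ∧
        t 0 3 * t 3 0 * (t 1 2 * t 2 1) ≤ t 0 1 * t 1 0 * (t 2 3 * t 3 2)) ∨
      (t 0 1 * t 1 0 * (t 2 3 * t 3 2) ≤ t 0 2 * t 2 0 * (t 1 3 * t 3 1) ∧
        t 0 3 * t 3 0 * (t 1 2 * t 2 1) ≤ t 0 2 * t 2 0 * (t 1 3 * t 3 1)) ∨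
      (t 0 1 * t 1 0 * (t 2 3 * t 3 2) ≤ t 0 3 * t 3 0 * (t 1 2 * t 2 1) ∧
        t 0 2 * t 2 0 * (t 1 3 * t 3 1) ≤ t 0 3 * t 3 0 * (t 1 2 * t 2 1))) with ⟨A1, A2⟩ | ⟨A1, A2⟩ | ⟨A1, A2⟩
  · rcases half_le_treeMinor_or_dominatingPair hnn (i := 0) (j := 1) (k := 2) (l := 3)
        (by linarith) (by linarith) (by linarith) (by linarith) (by linarith) (by linarith)
      with h | ⟨d1, d2, d3, d4⟩
    · apply hminor
      exact h
    -- At `p1` functionals 0 and 1 sum to 1, and 2 and 3 to -1; `m` and `n` measure the deviation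
    -- from an equal split. The sign of `m` selects `q0` or `q1`, that of `n` selects `q2` or `q3`.
    · obtain ⟨m, hm⟩ : ∃ m, m = 1 / 2 - p1 0 := ⟨_, rfl⟩
      obtain ⟨n, hn⟩ : ∃ n, n = p1 1 + 1 / 2 := ⟨_, rfl⟩
      have hP : p1 = ![1 / 2 - m, -1 / 2 + n, -1 / 2 - n] := by
        ext i; fin_cases i <;> simp <;> linarith
      rcases le_total m 0 with hm0 | hm0 <;> rcases le_total n 0 with hn0 | hn0
      · have key := half_le_of_dominatingPair hnn (i := 0) (j := 1) (k := 3) (l := 2)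
          (by linarith) (by linarith) d2 hm0 (neg_nonneg.2 hn0)
        have f1 : t 0 2 = 1 - t 0 1 - t 0 3 := by linarith
        have f2 : t 3 1 = 1 - t 3 0 - t 3 2 := by linarith
        refine ⟨p1, n1, q0, m0, q3, m3, le_abs.2 ?_⟩
        rw [hP, Q0, Q3, Matrix.det_fin_three]
        simp [f1, f2] at key ⊢
        exact Or.inr (by linarith)
      · have key := half_le_of_dominatingPair hnn (i := 0) (j := 1) (k := 2) (l := 3)
          (by linarith) (by linarith) d1 hm0 hn0
        have f1 : t 0 3 = 1 - t 0 1 - t 0 2 := by linarith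
        have f2 : t 2 1 = 1 - t 2 0 - t 2 3 := by linarith
        refine ⟨p1, n1, q0, m0, q2, m2, le_abs.2 ?_⟩
        rw [hP, Q0, Q2, Matrix.det_fin_three]
        simp [f1, f2] at key ⊢
        exact Or.inl (by linarith)
      · have key := half_le_of_dominatingPair hnn (i := 1) (j := 0) (k := 3) (l := 2)
          (by linarith) (by linarith) d4 (neg_nonpos.2 hm0) (neg_nonneg.2 hn0)
        have f1 : t 1 2 = 1 - t 1 0 - t 1 3 := by linarith
        have f2 : t 3 0 = 1 - t 3 1 - t 3 2 := by linarith
        refine ⟨p1, n1, q1, m1, q3, m3, le_abs.2 ?_⟩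
        rw [hP, Q1, Q3, Matrix.det_fin_three]
        simp [f1, f2] at key ⊢
        exact Or.inl (by linarith)
      · have key := half_le_of_dominatingPair hnn (i := 1) (j := 0) (k := 2) (l := 3)
          (by linarith) (by linarith) d3 (neg_nonpos.2 hm0) hn0
        have f1 : t 1 3 = 1 - t 1 0 - t 1 2 := by linarith
        have f2 : t 2 0 = 1 - t 2 1 - t 2 3 := by linarith
        refine ⟨p1, n1, q1, m1, q2, m2, le_abs.2 ?_⟩
        rw [hP, Q1, Q2, Matrix.det_fin_three]
        simp [f1, f2] at key ⊢
        exact Or.inr (by linarith)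
  · rcases half_le_treeMinor_or_dominatingPair hnn (i := 0) (j := 2) (k := 1) (l := 3)
        (by linarith) (by linarith) (by linarith) (by linarith) (by linarith) (by linarith)
      with h | ⟨d1, d2, d3, d4⟩
    · apply hminor
      have s0 : treeMinor t 2 1 3 = treeMinor t 1 2 3 := by unfold treeMinor; ring
      have s1 : treeMinor t 0 2 3 = treeMinor t 0 2 3 := by unfold treeMinor; ring
      have s2 : treeMinor t 0 2 1 = treeMinor t 0 1 2 := by unfold treeMinor; ring
      grind
    · obtain ⟨m, hm⟩ : ∃ m, m = 1 / 2 - p2 1 := ⟨_, rfl⟩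
      obtain ⟨n, hn⟩ : ∃ n, n = p2 0 + 1 / 2 := ⟨_, rfl⟩
      have hP : p2 = ![-1 / 2 + n, 1 / 2 - m, -1 / 2 - n] := by
        ext i; fin_cases i <;> simp <;> linarith
      rcases le_total m 0 with hm0 | hm0 <;> rcases le_total n 0 with hn0 | hn0
      · have key := half_le_of_dominatingPair hnn (i := 0) (j := 2) (k := 3) (l := 1)
          (by linarith) (by linarith) d2 hm0 (neg_nonneg.2 hn0)
        have f1 : t 0 1 = 1 - t 0 2 - t 0 3 := by linarith
        have f2 : t 3 2 = 1 - t 3 0 - t 3 1 := by linarith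
        refine ⟨p2, n2, q0, m0, q3, m3, le_abs.2 ?_⟩
        rw [hP, Q0, Q3, Matrix.det_fin_three]
        simp [f1, f2] at key ⊢
        exact Or.inl (by linarith)
      · have key := half_le_of_dominatingPair hnn (i := 0) (j := 2) (k := 1) (l := 3)
          (by linarith) (by linarith) d1 hm0 hn0
        have f1 : t 0 3 = 1 - t 0 2 - t 0 1 := by linarith
        have f2 : t 1 2 = 1 - t 1 0 - t 1 3 := by linarith
        refine ⟨p2, n2, q0, m0, q1, m1, le_abs.2 ?_⟩
        rw [hP, Q0, Q1, Matrix.det_fin_three]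
        simp [f1, f2] at key ⊢
        exact Or.inr (by linarith)
      · have key := half_le_of_dominatingPair hnn (i := 2) (j := 0) (k := 3) (l := 1)
          (by linarith) (by linarith) d4 (neg_nonpos.2 hm0) (neg_nonneg.2 hn0)
        have f1 : t 2 1 = 1 - t 2 0 - t 2 3 := by linarith
        have f2 : t 3 0 = 1 - t 3 2 - t 3 1 := by linarith
        refine ⟨p2, n2, q2, m2, q3, m3, le_abs.2 ?_⟩
        rw [hP, Q2, Q3, Matrix.det_fin_three]
        simp [f1, f2] at key ⊢
        exact Or.inr (by linarith)
      · have key := half_le_of_dominatingPair hnn (i := 2) (j := 0) (k := 1) (l := 3)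
          (by linarith) (by linarith) d3 (neg_nonpos.2 hm0) hn0
        have f1 : t 2 3 = 1 - t 2 0 - t 2 1 := by linarith
        have f2 : t 1 0 = 1 - t 1 2 - t 1 3 := by linarith
        refine ⟨p2, n2, q2, m2, q1, m1, le_abs.2 ?_⟩
        rw [hP, Q2, Q1, Matrix.det_fin_three]
        simp [f1, f2] at key ⊢
        exact Or.inl (by linarith)
  · rcases half_le_treeMinor_or_dominatingPair hnn (i := 0) (j := 3) (k := 1) (l := 2)
        (by linarith) (by linarith) (by linarith) (by linarith) (by linarith) (by linarith)
      with h | ⟨d1, d2, d3, d4⟩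
    · apply hminor
      have s0 : treeMinor t 3 1 2 = treeMinor t 1 2 3 := by unfold treeMinor; ring
      have s1 : treeMinor t 0 3 2 = treeMinor t 0 2 3 := by unfold treeMinor; ring
      have s2 : treeMinor t 0 3 1 = treeMinor t 0 1 3 := by unfold treeMinor; ring
      grind
    · obtain ⟨m, hm⟩ : ∃ m, m = 1 / 2 - p3 2 := ⟨_, rfl⟩
      obtain ⟨n, hn⟩ : ∃ n, n = p3 0 + 1 / 2 := ⟨_, rfl⟩
      have hP : p3 = ![-1 / 2 + n, -1 / 2 - n, 1 / 2 - m] := by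
        ext i; fin_cases i <;> simp <;> linarith
      rcases le_total m 0 with hm0 | hm0 <;> rcases le_total n 0 with hn0 | hn0
      · have key := half_le_of_dominatingPair hnn (i := 0) (j := 3) (k := 2) (l := 1)
          (by linarith) (by linarith) d2 hm0 (neg_nonneg.2 hn0)
        have f1 : t 0 1 = 1 - t 0 3 - t 0 2 := by linarith
        have f2 : t 2 3 = 1 - t 2 0 - t 2 1 := by linarith
        refine ⟨p3, n3, q0, m0, q2, m2, le_abs.2 ?_⟩
        rw [hP, Q0, Q2, Matrix.det_fin_three]
        simp [f1, f2] at key ⊢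
        exact Or.inr (by linarith)
      · have key := half_le_of_dominatingPair hnn (i := 0) (j := 3) (k := 1) (l := 2)
          (by linarith) (by linarith) d1 hm0 hn0
        have f1 : t 0 2 = 1 - t 0 3 - t 0 1 := by linarith
        have f2 : t 1 3 = 1 - t 1 0 - t 1 2 := by linarith
        refine ⟨p3, n3, q0, m0, q1, m1, le_abs.2 ?_⟩
        rw [hP, Q0, Q1, Matrix.det_fin_three]
        simp [f1, f2] at key ⊢
        exact Or.inl (by linarith)
      · have key := half_le_of_dominatingPair hnn (i := 3) (j := 0) (k := 2) (l := 1)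
          (by linarith) (by linarith) d4 (neg_nonpos.2 hm0) (neg_nonneg.2 hn0)
        have f1 : t 3 1 = 1 - t 3 0 - t 3 2 := by linarith
        have f2 : t 2 0 = 1 - t 2 3 - t 2 1 := by linarith
        refine ⟨p3, n3, q3, m3, q2, m2, le_abs.2 ?_⟩
        rw [hP, Q3, Q2, Matrix.det_fin_three]
        simp [f1, f2] at key ⊢
        exact Or.inl (by linarith)
      · have key := half_le_of_dominatingPair hnn (i := 3) (j := 0) (k := 1) (l := 2)
          (by linarith) (by linarith) d3 (neg_nonpos.2 hm0) hn0
        have f1 : t 3 2 = 1 - t 3 0 - t 3 1 := by linarith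
        have f2 : t 1 0 = 1 - t 1 3 - t 1 2 := by linarith
        refine ⟨p3, n3, q3, m3, q1, m1, le_abs.2 ?_⟩
        rw [hP, Q3, Q1, Matrix.det_fin_three]
        simp [f1, f2] at key ⊢
        exact Or.inr (by linarith)

/-! ### Spanning trees of K₄ and the Fano plane without a point -/

lemma schur_inequality_of_le {x y z : ℝ} (hz : 0 ≤ z) (hzy : z ≤ y) (hyx : y ≤ x) :
    0 ≤ x * (x - y) * (x - z) + y * (y - x) * (y - z) + z * (z - x) * (z - y) := by
  have h1 : 0 ≤ (x - y) ^ 2 * (x + y - z) := mul_nonneg (sq_nonneg _) (by linarith)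
  have h2 : 0 ≤ z * ((x - z) * (y - z)) :=
    mul_nonneg hz (mul_nonneg (by linarith) (by linarith))
  linarith

lemma schur_inequality {x y z : ℝ} (hx : 0 ≤ x) (hy : 0 ≤ y) (hz : 0 ≤ z) :
    0 ≤ x * (x - y) * (x - z) + y * (y - x) * (y - z) + z * (z - x) * (z - y) := by
  rcases le_total x y with h1 | h1 <;> rcases le_total y z with h2 | h2 <;>
    rcases le_total x z with h3 | h3
  · linarith [schur_inequality_of_le hx h1 h2]
  · linarith [schur_inequality_of_le hx h1 h2]
  · linarith [schur_inequality_of_le hx h3 h2]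
  · linarith [schur_inequality_of_le hz h3 h1]
  · linarith [schur_inequality_of_le hy h1 h3]
  · linarith [schur_inequality_of_le hy h2 h3]
  · linarith [schur_inequality_of_le hz h2 h1]
  · linarith [schur_inequality_of_le hz h2 h1]

/-- Twice Kirchhoff's polynomial of the complete graph on four vertices is at most `4` when the
weights of the edges sum to `3`. The three pairs of opposite edges are `(a, a')`, `(b, b')`,
`(c, c')`, and `abc`, `ab'c'`, `a'bc'`, `a'b'c` are the triangles. -/
lemma kirchhoff_complete_four_le {a a' b b' c c' : ℝ} (ha : 0 ≤ a) (ha' : 0 ≤ a') (hb : 0 ≤ b)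
    (hb' : 0 ≤ b') (hc : 0 ≤ c) (hc' : 0 ≤ c') (h : a + a' + b + b' + c + c' = 3) :
    a * a' * (3 - a - a') + b * b' * (3 - b - b') + c * c' * (3 - c - c')
      + (a * b + a * c + b * c) * (3 - a - b - c)
      + (a * b' + a * c' + b' * c') * (3 - a - b' - c')
      + (a' * b + a' * c' + b * c') * (3 - a' - b - c')
      + (a' * b' + a' * c + b' * c) * (3 - a' - b' - c) ≤ 6 := by
  -- The left side counts every spanning tree once for each pair of its edges, so it is three times
  -- Kirchhoff's polynomial. In the sums x, y, z and differences p, q, r of opposite edges, the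
  -- terms in p, q, r only lower the value (`hpqr`); Schur's inequality bounds the rest, with
  -- equality at x = y = z = 1.
  obtain ⟨x, hx⟩ : ∃ x, x = a + a' := ⟨_, rfl⟩
  obtain ⟨y, hy⟩ : ∃ y, y = b + b' := ⟨_, rfl⟩
  obtain ⟨z, hz⟩ : ∃ z, z = c + c' := ⟨_, rfl⟩
  obtain ⟨p, hp⟩ : ∃ p, p = a - a' := ⟨_, rfl⟩
  obtain ⟨q, hq⟩ : ∃ q, q = b - b' := ⟨_, rfl⟩
  obtain ⟨r, hr⟩ : ∃ r, r = c - c' := ⟨_, rfl⟩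
  have hx0 : 0 ≤ x := by linarith
  have hy0 : 0 ≤ y := by linarith
  have hz0 : 0 ≤ z := by linarith
  have hs : x + y + z = 3 := by linarith
  have e1 : a = (x + p) / 2 := by linarith
  have e2 : a' = (x - p) / 2 := by linarith
  have e3 : b = (y + q) / 2 := by linarith
  have e4 : b' = (y - q) / 2 := by linarith
  have e5 : c = (z + r) / 2 := by linarith
  have e6 : c' = (z - r) / 2 := by linarith
  have hpx : |p| ≤ x := abs_le.2 ⟨by linarith, by linarith⟩
  have hqy : |q| ≤ y := abs_le.2 ⟨by linarith, by linarith⟩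
  have hrz : |r| ≤ z := abs_le.2 ⟨by linarith, by linarith⟩
  have hpqr : -(p * q * r) ≤ (p ^ 2 * (y + z) + q ^ 2 * (x + z) + r ^ 2 * (x + y)) / 2 := by
    have k1 : -(p * q * r) ≤ |p| * |q| * |r| := by
      rw [← abs_mul, ← abs_mul]; exact neg_le_abs _
    have h1 : |p| * |q| * |r| ≤ |p| * |q| * z := mul_le_mul_of_nonneg_left hrz (by positivity)
    have h2 : 2 * (|p| * |q|) ≤ p ^ 2 + q ^ 2 := by
      rw [← sq_abs p, ← sq_abs q]; linarith [sq_nonneg (|p| - |q|)]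
    have h3 : 2 * (|p| * |q|) * z ≤ (p ^ 2 + q ^ 2) * z := mul_le_mul_of_nonneg_right h2 hz0
    have h4 : 0 ≤ p ^ 2 * y := by positivity
    have h5 : 0 ≤ q ^ 2 * x := by positivity
    have h6 : 0 ≤ r ^ 2 * (x + y) := by positivity
    linarith
  have hpoly : 3 * (x * y * z / 2 + (x ^ 2 * (y + z) + y ^ 2 * (x + z) + z ^ 2 * (x + y)) / 4)
      ≤ 6 := by
    have schur := schur_inequality hx0 hy0 hz0
    have f1 : x ^ 2 * (y + z) + y ^ 2 * (x + z) + z ^ 2 * (x + y)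
        = (x + y + z) * (x * y + y * z + z * x) - 3 * (x * y * z) := by ring
    have f2 : x * (x - y) * (x - z) + y * (y - x) * (y - z) + z * (z - x) * (z - y)
        = (x + y + z) ^ 3 - 4 * (x + y + z) * (x * y + y * z + z * x) + 9 * (x * y * z) := by ring
    have f3 : 3 * (x * y + y * z + z * x) ≤ (x + y + z) ^ 2 := by
      linarith [sq_nonneg (x - y), sq_nonneg (y - z), sq_nonneg (x - z)]
    rw [f2] at schur
    rw [f1]
    rw [hs] at schur f3 ⊢
    linarith
  have key : a * a' * (3 - a - a') + b * b' * (3 - b - b') + c * c' * (3 - c - c')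
      + (a * b + a * c + b * c) * (3 - a - b - c)
      + (a * b' + a * c' + b' * c') * (3 - a - b' - c')
      + (a' * b + a' * c' + b * c') * (3 - a' - b - c')
      + (a' * b' + a' * c + b' * c) * (3 - a' - b' - c)
      = 3 * (x * y * z / 2 + (x ^ 2 * (y + z) + y ^ 2 * (x + z) + z ^ 2 * (x + y)) / 4)
        + 3 * (-(p * q * r) - (p ^ 2 * (y + z) + q ^ 2 * (x + z) + r ^ 2 * (x + y)) / 2) / 2 := by
    have hz' : z = 3 - x - y := by linarith
    rw [e1, e2, e3, e4, e5, e6, hz']; ring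
  rw [key]
  linarith

lemma sum_univ_zmod_two_cube (g : (Fin 3 → ZMod 2) → ℝ) :
    ∑ x, g x = g ![0, 0, 0] + g ![1, 0, 0] + g ![0, 1, 0] + g ![1, 1, 0] + g ![0, 0, 1] + g ![1, 0, 1] + g ![0, 1, 1] + g ![1, 1, 1] := by
  have : (Finset.univ : Finset (Fin 3 → ZMod 2)) = {![0, 0, 0], ![1, 0, 0], ![0, 1, 0], ![1, 1, 0], ![0, 0, 1], ![1, 0, 1], ![0, 1, 1], ![1, 1, 1]} := by
    decide
  rw [this]
  repeat rw [Finset.sum_insert (by decide)]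
  rw [Finset.sum_singleton]
  ring

/-- Without the point k, the Fano plane is the cycle matroid of K₄: the pairs {x, x + k} are the
opposite edges and the four lines avoiding k the triangles. Pairs (x, y) are ordered here, hence
twice the bound of `kirchhoff_complete_four_le`. -/
lemma sum_independent_le {α : (Fin 3 → ZMod 2) → ℝ} (h : ∀ x, 0 ≤ α x) (hs : ∑ x, α x = 3)
    (h0 : α 0 = 0) {k : Fin 3 → ZMod 2} (hk : k ≠ 0) (hαk : α k = 0) :
    ∑ x, ∑ y, (if x = 0 ∨ y = 0 ∨ x = y then 0 else α x * α y * (3 - α x - α y - α (x + y)))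
      ≤ 12 := by
  simp only [sum_univ_zmod_two_cube] at hs ⊢
  have hz : α ![0, 0, 0] = 0 := by rw [← h0]; congr 1; decide
  have h11 : (1 + 1 : ZMod 2) = 0 := by decide
  simp +decide only [if_true, if_false, Matrix.cons_add_cons, Matrix.empty_add_empty, h11,
    zero_add, add_zero, hz] at hs ⊢
  have hcases : k = ![1, 0, 0] ∨ k = ![0, 1, 0] ∨ k = ![1, 1, 0] ∨ k = ![0, 0, 1] ∨ k = ![1, 0, 1] ∨ k = ![0, 1, 1] ∨ k = ![1, 1, 1] := by
    clear hαk; revert k; decide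
  rcases hcases with rfl | rfl | rfl | rfl | rfl | rfl | rfl
  · have := kirchhoff_complete_four_le (h ![0, 1, 0]) (h ![1, 1, 0]) (h ![0, 0, 1])
      (h ![1, 0, 1]) (h ![0, 1, 1]) (h ![1, 1, 1]) (by linarith)
    rw [hαk] at hs ⊢
    linarith
  · have := kirchhoff_complete_four_le (h ![1, 0, 0]) (h ![1, 1, 0]) (h ![0, 0, 1])
      (h ![0, 1, 1]) (h ![1, 0, 1]) (h ![1, 1, 1]) (by linarith)
    rw [hαk] at hs ⊢
    linarith
  · have := kirchhoff_complete_four_le (h ![1, 0, 0]) (h ![0, 1, 0]) (h ![0, 0, 1])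
      (h ![1, 1, 1]) (h ![1, 0, 1]) (h ![0, 1, 1]) (by linarith)
    rw [hαk] at hs ⊢
    linarith
  · have := kirchhoff_complete_four_le (h ![1, 0, 0]) (h ![1, 0, 1]) (h ![0, 1, 0])
      (h ![0, 1, 1]) (h ![1, 1, 0]) (h ![1, 1, 1]) (by linarith)
    rw [hαk] at hs ⊢
    linarith
  · have := kirchhoff_complete_four_le (h ![1, 0, 0]) (h ![0, 0, 1]) (h ![0, 1, 0])
      (h ![1, 1, 1]) (h ![1, 1, 0]) (h ![0, 1, 1]) (by linarith)
    rw [hαk] at hs ⊢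
    linarith
  · have := kirchhoff_complete_four_le (h ![1, 0, 0]) (h ![1, 1, 1]) (h ![0, 1, 0])
      (h ![0, 0, 1]) (h ![1, 1, 0]) (h ![1, 0, 1]) (by linarith)
    rw [hαk] at hs ⊢
    linarith
  · have := kirchhoff_complete_four_le (h ![1, 0, 0]) (h ![0, 1, 1]) (h ![0, 1, 0])
      (h ![1, 0, 1]) (h ![1, 1, 0]) (h ![0, 0, 1]) (by linarith)
    rw [hαk] at hs ⊢
    linarith

/-! ### Cauchy–Binet, and the Fano plane in characteristic zero -/

/-- The Cauchy–Binet formula for `3 × 3` determinants, summed over all triples of indices. -/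
lemma sum_det_mul_det {κ : Type*} [Fintype κ] (p u : κ → Fin 3 → ℝ) :
    ∑ f : Fin 3 → κ, (Matrix.of fun i => p (f i)).det * (Matrix.of fun i => u (f i)).det
      = 6 * (Matrix.of fun i j => ∑ x, p x i * u x j).det := by
  classical
  have h1 : (Matrix.of fun i j => ∑ x, p x i * u x j).det
      = ∑ f : Fin 3 → κ, (∏ i, p (f i) i) * (Matrix.of fun i => u (f i)).det := by
    have e : (fun i => ∑ x, p x i • u x) = (Matrix.of fun i j => ∑ x, p x i * u x j) := by
      ext i j; simp
    have := (Matrix.detRowAlternating (R := ℝ) (n := Fin 3)).toMultilinearMap.map_sum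
      (fun i (x : κ) => p x i • u x)
    rw [e] at this
    refine this.trans (Finset.sum_congr rfl fun f _ => ?_)
    rw [MultilinearMap.map_smul_univ]
    rfl
  have h2 : ∀ f : Fin 3 → κ, (Matrix.of fun i => p (f i)).det =
      ∑ σ : Equiv.Perm (Fin 3), (Equiv.Perm.sign σ : ℝ) * ∏ i, p (f (σ i)) i := by
    intro f
    rw [Matrix.det_apply']
    simp
  simp_rw [h2, Finset.sum_mul]
  rw [Finset.sum_comm]
  -- Reindexing the triples by σ absorbs its sign, so all 3! = 6 permutations contribute equally.
  have h3 : ∀ σ : Equiv.Perm (Fin 3), ∑ f : Fin 3 → κ,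
      (Equiv.Perm.sign σ : ℝ) * (∏ i, p (f (σ i)) i) * (Matrix.of fun i => u (f i)).det
      = (Matrix.of fun i j => ∑ x, p x i * u x j).det := by
    intro σ
    rw [h1, ← (Equiv.arrowCongr σ (Equiv.refl κ)).sum_comp]
    refine Finset.sum_congr rfl fun f _ => ?_
    have e1 : (Matrix.of fun i => u (f i)).det
        = (Equiv.Perm.sign σ : ℝ) * (Matrix.of fun i => u (f (σ.symm i))).det := by
      have := Matrix.det_permute σ (Matrix.of fun i => u (f (σ.symm i)))
      rw [← this]
      congr 1
      ext i j
      simp [Matrix.submatrix]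
    have e2 : (Equiv.Perm.sign σ : ℝ) * (Equiv.Perm.sign σ : ℝ) = 1 := by
      rcases Int.units_eq_one_or (Equiv.Perm.sign σ) with h | h <;> simp [h]
    simp only [Equiv.arrowCongr_apply, Function.comp_apply, Equiv.coe_refl, id]
    rw [e1]
    simp only [Equiv.symm_apply_apply]
    ring
  rw [Finset.sum_congr rfl fun σ _ => h3 σ]
  simp [Fintype.card_perm, Nat.factorial]

/-- By Cramer's rule the entries on the right are the coordinates of x, y, z in the basis a, b, c,
multiplied by det(a, b, c); this avoids division. -/
lemma det_cramer_coordinates (a b c x y z : Fin 3 → ℤ) :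
    (Matrix.of ![x, y, z]).det * (Matrix.of ![a, b, c]).det ^ 2 = (Matrix.of
      ![![(Matrix.of ![x, b, c]).det, (Matrix.of ![a, x, c]).det, (Matrix.of ![a, b, x]).det],
        ![(Matrix.of ![y, b, c]).det, (Matrix.of ![a, y, c]).det, (Matrix.of ![a, b, y]).det],
        ![(Matrix.of ![z, b, c]).det, (Matrix.of ![a, z, c]).det,
          (Matrix.of ![a, b, z]).det]]).det := by
  simp only [Matrix.det_fin_three, Matrix.of_apply, Matrix.cons_val]
  ring

/-- The Fano plane cannot be represented over the integers by lifting its points. -/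
lemma false_of_fano {u : (Fin 3 → ZMod 2) → Fin 3 → ℤ} (hu : ∀ x ≠ 0, ∀ i, (u x i : ZMod 2) = x i)
    (hl : ∀ x y, x ≠ 0 → y ≠ 0 → x ≠ y → (Matrix.of ![u x, u y, u (x + y)]).det = 0) : False := by
  -- A triple independent mod 2 has odd, hence nonzero, determinant.
  have hodd : ∀ x y z : Fin 3 → ZMod 2, x ≠ 0 → y ≠ 0 → z ≠ 0 →
      (Matrix.of ![x, y, z]).det ≠ 0 → (Matrix.of ![u x, u y, u z]).det ≠ 0 := by
    intro x y z hx hy hz h h0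
    apply h
    have := congrArg (Int.cast : ℤ → ZMod 2) h0
    simp only [Matrix.det_fin_three, Matrix.of_apply, Matrix.cons_val] at this ⊢
    push_cast [hu x hx, hu y hy, hu z hz] at this
    exact this
  set a := u ![1, 0, 0] with ha
  set b := u ![0, 1, 0] with hb
  set c := u ![0, 0, 1] with hc
  set d := u ![1, 1, 0] with hd
  set e := u ![1, 0, 1] with he
  set f := u ![0, 1, 1] with hf
  set g := u ![1, 1, 1] with hg
  have hline : ∀ x y z : Fin 3 → ZMod 2, x ≠ 0 → y ≠ 0 → x ≠ y → x + y = z →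
      (Matrix.of ![u x, u y, u z]).det = 0 := by
    rintro x y _ hx hy hxy rfl; exact hl x y hx hy hxy
  have l1 : (Matrix.of ![a, b, d]).det = 0 :=
    hline _ _ _ (by decide) (by decide) (by decide) (by decide)
  have l2 : (Matrix.of ![a, c, e]).det = 0 :=
    hline _ _ _ (by decide) (by decide) (by decide) (by decide)
  have l3 : (Matrix.of ![b, c, f]).det = 0 :=
    hline _ _ _ (by decide) (by decide) (by decide) (by decide)
  have l4 : (Matrix.of ![a, f, g]).det = 0 :=
    hline _ _ _ (by decide) (by decide) (by decide) (by decide)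
  have l5 : (Matrix.of ![b, e, g]).det = 0 :=
    hline _ _ _ (by decide) (by decide) (by decide) (by decide)
  have l6 : (Matrix.of ![c, d, g]).det = 0 :=
    hline _ _ _ (by decide) (by decide) (by decide) (by decide)
  have l7 : (Matrix.of ![d, e, f]).det = 0 :=
    hline _ _ _ (by decide) (by decide) (by decide) (by decide)
  have n0 : (Matrix.of ![a, b, c]).det ≠ 0 :=
    hodd _ _ _ (by decide) (by decide) (by decide) (by decide)
  have d1 : (Matrix.of ![d, b, c]).det ≠ 0 :=
    hodd _ _ _ (by decide) (by decide) (by decide) (by decide)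
  have d2 : (Matrix.of ![a, d, c]).det ≠ 0 :=
    hodd _ _ _ (by decide) (by decide) (by decide) (by decide)
  have f1 : (Matrix.of ![e, b, c]).det ≠ 0 :=
    hodd _ _ _ (by decide) (by decide) (by decide) (by decide)
  have f3 : (Matrix.of ![a, b, e]).det ≠ 0 :=
    hodd _ _ _ (by decide) (by decide) (by decide) (by decide)
  have g2 : (Matrix.of ![a, f, c]).det ≠ 0 :=
    hodd _ _ _ (by decide) (by decide) (by decide) (by decide)
  have g3 : (Matrix.of ![a, b, f]).det ≠ 0 :=
    hodd _ _ _ (by decide) (by decide) (by decide) (by decide)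
  have k1 : (Matrix.of ![g, b, c]).det ≠ 0 :=
    hodd _ _ _ (by decide) (by decide) (by decide) (by decide)
  have k2 : (Matrix.of ![a, g, c]).det ≠ 0 :=
    hodd _ _ _ (by decide) (by decide) (by decide) (by decide)
  have k3 : (Matrix.of ![a, b, g]).det ≠ 0 :=
    hodd _ _ _ (by decide) (by decide) (by decide) (by decide)
  have c7 := det_cramer_coordinates a b c d e f
  have c4 := det_cramer_coordinates a b c a f g
  have c5 := det_cramer_coordinates a b c b e g
  have c6 := det_cramer_coordinates a b c c d g
  have e2 : (Matrix.of ![a, e, c]).det = 0 := by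
    rw [← neg_eq_zero, ← l2]
    simp only [Matrix.det_fin_three, Matrix.of_apply, Matrix.cons_val]; ring
  have f1' : (Matrix.of ![f, b, c]).det = 0 := by
    rw [← l3]; simp only [Matrix.det_fin_three, Matrix.of_apply, Matrix.cons_val]; ring
  have z1 : ∀ x y : Fin 3 → ℤ, (Matrix.of ![x, x, y]).det = 0 := by
    intro x y; simp only [Matrix.det_fin_three, Matrix.of_apply, Matrix.cons_val]; ring
  have z2 : ∀ x y : Fin 3 → ℤ, (Matrix.of ![x, y, x]).det = 0 := by
    intro x y; simp only [Matrix.det_fin_three, Matrix.of_apply, Matrix.cons_val]; ring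
  have z3 : ∀ x y : Fin 3 → ℤ, (Matrix.of ![y, x, x]).det = 0 := by
    intro x y; simp only [Matrix.det_fin_three, Matrix.of_apply, Matrix.cons_val]; ring
  rw [l7, l1, e2, f1'] at c7
  rw [l4, f1', z1, z2] at c4
  rw [l5, e2, z1, z3] at c5
  rw [l6, l1, z2, z3] at c6
  clear_value a b c d e f g
  generalize (Matrix.of ![a, b, c]).det = Δ at *
  generalize (Matrix.of ![d, b, c]).det = D1 at *
  generalize (Matrix.of ![a, d, c]).det = D2 at *
  generalize (Matrix.of ![e, b, c]).det = E1 at *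
  generalize (Matrix.of ![a, b, e]).det = E3 at *
  generalize (Matrix.of ![a, f, c]).det = F2 at *
  generalize (Matrix.of ![a, b, f]).det = F3 at *
  generalize (Matrix.of ![g, b, c]).det = G1 at *
  generalize (Matrix.of ![a, g, c]).det = G2 at *
  generalize (Matrix.of ![a, b, g]).det = G3 at *
  simp only [Matrix.det_fin_three, Matrix.of_apply, Matrix.cons_val] at c4 c5 c6 c7
  -- The lines through g prescribe ratios of the coordinates of d, e, f in terms of those of g. The
  -- two terms of `m7`, the condition of the line {d, e, f}, then agree, so twice a nonzero product
  -- would vanish.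
  have m4 : F2 * G3 = F3 * G2 := mul_left_cancel₀ n0 (by linarith)
  have m5 : E1 * G3 = E3 * G1 := mul_left_cancel₀ n0 (by linarith)
  have m6 : D1 * G2 = D2 * G1 := mul_left_cancel₀ n0 (by linarith)
  have m7 : D1 * E3 * F2 + D2 * E1 * F3 = 0 := by linarith
  have : 2 * (D2 * E1 * F3 * (G1 * G2 * G3)) = 0 := by
    have h : D1 * E3 * F2 * (G1 * G2 * G3) = D2 * E1 * F3 * (G1 * G2 * G3) := by
      calc _ = (D1 * G2) * (E3 * G1) * (F2 * G3) := by ring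
        _ = (D2 * G1) * (E1 * G3) * (F3 * G2) := by rw [m6, m5, m4]
        _ = _ := by ring
    linear_combination (G1 * G2 * G3) * m7 - h
  exact mul_ne_zero two_ne_zero (mul_ne_zero (mul_ne_zero (mul_ne_zero d2 f1) g3)
    (mul_ne_zero (mul_ne_zero k1 k2) k3)) this

/-! ### Minimal vectors of a smooth symmetric body -/

/-- A compact convex symmetric set whose support function is at least `1` at the nonzero integer
vectors, and which has no two independent normals at a point. -/
structure IsSmoothWide (D : Set (Fin 3 → ℝ)) : Prop where
  compact : IsCompact D
  convex : Convex ℝ D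
  neg_mem : ∀ d ∈ D, -d ∈ D
  wide : ∀ z : Fin 3 → ℤ, z ≠ 0 → ∃ d ∈ D, 1 ≤ d ⬝ᵥ (fun i => (z i : ℝ))
  smooth : ∀ d ∈ D, ∀ x y : Fin 3 → ℝ, (∀ d' ∈ D, d' ⬝ᵥ x ≤ d ⬝ᵥ x) →
    (∀ d' ∈ D, d' ⬝ᵥ y ≤ d ⬝ᵥ y) → SameRay ℝ x y

/-- The nonzero integer vectors at which the support function of `D` is at most `1`. -/
def unitVectors (D : Set (Fin 3 → ℝ)) : Set (Fin 3 → ℤ) :=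
  {z | z ≠ 0 ∧ ∀ d ∈ D, d ⬝ᵥ (fun i => (z i : ℝ)) ≤ 1}

lemma sameRay_eq_of_dotProduct_eq_one {d x y : Fin 3 → ℝ} (h : SameRay ℝ x y)
    (hx : d ⬝ᵥ x = 1) (hy : d ⬝ᵥ y = 1) : x = y := by
  have hx0 : x ≠ 0 := by rintro rfl; simp at hx
  have hy0 : y ≠ 0 := by rintro rfl; simp at hy
  obtain ⟨r, s, hr, hs, hrs⟩ := h.exists_pos hx0 hy0
  have := congrArg (d ⬝ᵥ ·) hrs
  simp only [dotProduct_smul, hx, hy, smul_eq_mul, mul_one] at this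
  subst this
  exact smul_right_injective _ hr.ne' hrs

lemma intCast_injective {x y : Fin 3 → ℤ} (h : (fun i => (x i : ℝ)) = fun i => (y i : ℝ)) :
    x = y := by
  ext i
  exact_mod_cast congrFun h i


lemma IsSmoothWide.neg_mem_unitVectors {D : Set (Fin 3 → ℝ)} (hD : IsSmoothWide D)
    {z : Fin 3 → ℤ} (hz : z ∈ unitVectors D) : -z ∈ unitVectors D := by
  refine ⟨neg_ne_zero.2 hz.1, fun d hd => ?_⟩
  have := hz.2 (-d) (hD.neg_mem d hd)
  have e : (fun i => (((-z) i : ℤ) : ℝ)) = -fun i => (z i : ℝ) := by ext i; simp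
  rw [e, dotProduct_neg, ← neg_dotProduct]
  exact this

/-- The midpoint of z and z' is integral. If it is nonzero, a point of D with value at least 1 on it
has value exactly 1 on both z and z', and smoothness leaves room for one normal only. -/
lemma IsSmoothWide.eq_or_eq_neg {D : Set (Fin 3 → ℝ)} (hD : IsSmoothWide D)
    {z z' : Fin 3 → ℤ} (hz : z ∈ unitVectors D) (hz' : z' ∈ unitVectors D)
    (h : ∀ i, (2 : ℤ) ∣ z i + z' i) : z = z' ∨ z = -z' := by
  by_cases hne : z = -z'
  · exact Or.inr hne
  left
  choose w hw using h
  have hw0 : w ≠ 0 := by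
    rintro rfl
    apply hne
    ext i
    have := hw i
    simp at this ⊢
    linarith
  obtain ⟨d, hd, hdw⟩ := hD.wide w hw0
  have h1 := hz.2 d hd
  have h2 := hz'.2 d hd
  have h3 : d ⬝ᵥ (fun i => (z i : ℝ)) + d ⬝ᵥ (fun i => (z' i : ℝ))
      = 2 * (d ⬝ᵥ (fun i => (w i : ℝ))) := by
    rw [← dotProduct_add, ← smul_eq_mul, ← dotProduct_smul]
    congr 1
    ext i
    simp only [Pi.add_apply, Pi.smul_apply, smul_eq_mul]
    exact_mod_cast hw i
  have e1 : d ⬝ᵥ (fun i => (z i : ℝ)) = 1 := by linarith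
  have e2 : d ⬝ᵥ (fun i => (z' i : ℝ)) = 1 := by linarith
  exact intCast_injective (sameRay_eq_of_dotProduct_eq_one
    (hD.smooth d hd _ _ (by rw [e1]; exact hz.2) (by rw [e2]; exact hz'.2)) e1 e2)

lemma IsSmoothWide.not_forall_even {D : Set (Fin 3 → ℝ)} (hD : IsSmoothWide D)
    {z : Fin 3 → ℤ} (hz : z ∈ unitVectors D) (h : ∀ i, (2 : ℤ) ∣ z i) : False := by
  choose w hw using h
  have hw0 : w ≠ 0 := by
    rintro rfl
    exact hz.1 (by ext i; simpa using hw i)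
  obtain ⟨d, hd, hdw⟩ := hD.wide w hw0
  have h1 := hz.2 d hd
  have h3 : d ⬝ᵥ (fun i => (z i : ℝ)) = 2 * (d ⬝ᵥ (fun i => (w i : ℝ))) := by
    rw [← smul_eq_mul, ← dotProduct_smul]
    congr 1
    ext i
    simp only [Pi.smul_apply, smul_eq_mul]
    exact_mod_cast hw i
  linarith

/-- The support function at m is at most Σ |c i| ≤ 1. Value 1 would need one point touching ±u i for
each c i ≠ 0, so by smoothness at most one c i is nonzero, and then the value is at most 1/2. -/
lemma IsSmoothWide.eq_zero_of_sum_abs_le {D : Set (Fin 3 → ℝ)} (hD : IsSmoothWide D)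
    {u : Fin 3 → Fin 3 → ℤ} (hu : ∀ i, u i ∈ unitVectors D) (hdet : (Matrix.of u).det ≠ 0)
    {m : Fin 3 → ℤ} {c : Fin 3 → ℝ} (hm : ∀ j, (m j : ℝ) = ∑ i, c i * u i j)
    (hc : ∀ i, |c i| ≤ 1 / 2) (hs : ∑ i, |c i| ≤ 1) : m = 0 := by
  by_contra hm0
  obtain ⟨d, hd, hdm⟩ := hD.wide m hm0
  have e1 : d ⬝ᵥ (fun i => (m i : ℝ)) = ∑ i, c i * (d ⬝ᵥ fun j => (u i j : ℝ)) := by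
    have : (fun i => (m i : ℝ)) = ∑ i, c i • fun j => (u i j : ℝ) := by
      ext j; simp [hm j]
    rw [this, dotProduct_sum]
    simp [dotProduct_smul]
  have e2 : ∀ i, |d ⬝ᵥ fun j => (u i j : ℝ)| ≤ 1 := by
    intro i
    refine abs_le.2 ⟨?_, (hu i).2 d hd⟩
    have := (hu i).2 (-d) (hD.neg_mem d hd)
    rw [neg_dotProduct] at this
    linarith
  have e3 : ∀ i, c i * (d ⬝ᵥ fun j => (u i j : ℝ)) ≤ |c i| := by
    intro i
    calc _ ≤ |c i * (d ⬝ᵥ fun j => (u i j : ℝ))| := le_abs_self _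
      _ = |c i| * |d ⬝ᵥ fun j => (u i j : ℝ)| := abs_mul _ _
      _ ≤ |c i| * 1 := mul_le_mul_of_nonneg_left (e2 i) (abs_nonneg _)
      _ = _ := mul_one _
  have e4 : ∀ i, c i * (d ⬝ᵥ fun j => (u i j : ℝ)) = |c i| := by
    have h1 : ∑ i, (|c i| - c i * (d ⬝ᵥ fun j => (u i j : ℝ))) ≤ 0 := by
      rw [Finset.sum_sub_distrib, ← e1]; linarith
    have h2 := (Finset.sum_eq_zero_iff_of_nonneg (s := Finset.univ)
      (f := fun i => |c i| - c i * (d ⬝ᵥ fun j => (u i j : ℝ)))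
      (fun i _ => sub_nonneg.2 (e3 i))).1
      (le_antisymm h1 (Finset.sum_nonneg fun i _ => sub_nonneg.2 (e3 i)))
    intro i
    linarith [h2 i (Finset.mem_univ i)]
  -- two nonzero coefficients give two vectors with a common maximiser
  have e5 : ∀ i j, i ≠ j → c i = 0 ∨ c j = 0 := by
    intro i j hij
    by_contra! hcc
    have key : ∀ k, c k ≠ 0 → ∃ v : Fin 3 → ℤ, (v = u k ∨ v = -u k) ∧ v ∈ unitVectors D ∧
        d ⬝ᵥ (fun j => (v j : ℝ)) = 1 := by
      intro k hk
      have := e4 k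
      rcases lt_or_gt_of_ne hk with h | h
      · refine ⟨-u k, Or.inr rfl, hD.neg_mem_unitVectors (hu k), ?_⟩
        rw [abs_of_neg h] at this
        have e : (fun i => (((-u k) i : ℤ) : ℝ)) = -fun i => (u k i : ℝ) := by ext i; simp
        rw [e, dotProduct_neg]
        have h' : -c k ≠ 0 := by linarith
        exact mul_left_cancel₀ h.ne (by linarith)
      · refine ⟨u k, Or.inl rfl, hu k, ?_⟩
        rw [abs_of_pos h] at this
        exact mul_left_cancel₀ h.ne' (by linarith)
    obtain ⟨v, hv1, hv2, hv3⟩ := key i hcc.1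
    obtain ⟨w, hw1, hw2, hw3⟩ := key j hcc.2
    have hvw := intCast_injective (sameRay_eq_of_dotProduct_eq_one
      (hD.smooth d hd _ _ (by rw [hv3]; exact hv2.2) (by rw [hw3]; exact hw2.2)) hv3 hw3)
    have huu : u i = u j ∨ u i = -u j := by
      rcases hv1 with rfl | rfl <;> rcases hw1 with rfl | rfl
      · exact Or.inl hvw
      · exact Or.inr hvw
      · exact Or.inr (neg_eq_iff_eq_neg.1 hvw)
      · exact Or.inl (neg_injective hvw)
    apply hdet
    rcases huu with h | h
    · exact Matrix.det_zero_of_row_eq hij h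
    · have h2 : (Matrix.of u).updateRow i (-u j) = Matrix.of u := by
        rw [← h]; exact Matrix.updateRow_eq_self _ i
      have h3 : -u j = (-1 : ℤ) • u j := by simp
      rw [← h2, h3, Matrix.det_updateRow_smul]
      have : ((Matrix.of u).updateRow i (u j)).det = 0 :=
        Matrix.det_updateRow_eq_zero hij.symm
      simp [this]
  have h01 := e5 0 1 (by decide)
  have h02 := e5 0 2 (by decide)
  have h12 := e5 1 2 (by decide)
  have hle : ∑ i, |c i| ≤ 1 / 2 := by
    rw [Fin.sum_univ_three]
    have := hc 0; have := hc 1; have := hc 2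
    rcases h01 with h | h <;> rcases h12 with h' | h' <;> rcases h02 with h'' | h'' <;>
      simp_all
  have : (1 : ℝ) ≤ ∑ i, |c i| := by
    rw [e1] at hdm
    exact hdm.trans (Finset.sum_le_sum fun i _ => e3 i)
  linarith

lemma abs_two_mul_sub_round_le {x : ℝ} (hx : |x| ≤ 1 / 2) :
    |2 * x - round (2 * x)| ≤ 1 - 2 * |x| := by
  rcases le_total 0 x with h | h
  · have := round_le (2 * x) 1
    rw [abs_of_nonneg h] at hx ⊢
    refine this.trans ?_
    rw [abs_le]; push_cast; constructor <;> linarith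
  · have := round_le (2 * x) (-1)
    rw [abs_of_nonpos h] at hx ⊢
    refine this.trans ?_
    rw [abs_le]; push_cast; constructor <;> linarith

/-- Three independent minimal vectors span ℤ³ or a sublattice modulo which every remaining vector is
half the sum of the three. -/
lemma IsSmoothWide.span_or_odd {D : Set (Fin 3 → ℝ)} (hD : IsSmoothWide D)
    {u : Fin 3 → Fin 3 → ℤ} (hu : ∀ i, u i ∈ unitVectors D) (hdet : (Matrix.of u).det ≠ 0)
    (m : Fin 3 → ℤ) : ∃ n : Fin 3 → ℤ, (∀ j, m j = ∑ i, n i * u i j) ∨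
      ((∀ j, 2 * m j = ∑ i, n i * u i j) ∧ ∀ i, Odd (n i)) := by
  obtain ⟨c, hc⟩ : ∃ c : Fin 3 → ℝ, ∀ j, (m j : ℝ) = ∑ i, c i * u i j := by
    have hU : IsUnit ((Matrix.of u).map (Int.cast : ℤ → ℝ)).det := by
      have : ((Matrix.of u).map (Int.cast : ℤ → ℝ)).det = ((Matrix.of u).det : ℝ) :=
        (Int.cast_det _).symm
      rw [this]
      exact isUnit_iff_ne_zero.2 (by exact_mod_cast hdet)
    refine ⟨Matrix.vecMul (fun j => (m j : ℝ)) ((Matrix.of u).map (Int.cast : ℤ → ℝ))⁻¹, ?_⟩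
    intro j
    have : Matrix.vecMul (Matrix.vecMul (fun j => (m j : ℝ))
        ((Matrix.of u).map (Int.cast : ℤ → ℝ))⁻¹) ((Matrix.of u).map (Int.cast : ℤ → ℝ))
        = fun j => (m j : ℝ) := by
      rw [Matrix.vecMul_vecMul, Matrix.nonsing_inv_mul _ hU, Matrix.vecMul_one]
    have := congrFun this j
    simp only [Matrix.vecMul, dotProduct, Matrix.map_apply, Matrix.of_apply] at this ⊢
    exact this.symm
  obtain ⟨c', hc'⟩ : ∃ c' : Fin 3 → ℝ, ∀ i, c' i = c i - round (c i) := ⟨_, fun i => rfl⟩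
  have hc2 : ∀ i, |c' i| ≤ 1 / 2 := fun i => by rw [hc']; exact abs_sub_round _
  by_cases hs : ∑ i, |c' i| ≤ 1
  · refine ⟨fun i => round (c i), Or.inl fun j => ?_⟩
    have := hD.eq_zero_of_sum_abs_le hu hdet (m := fun j => m j - ∑ i, round (c i) * u i j)
      (c := c') (by
        intro j
        push_cast
        rw [hc j, ← Finset.sum_sub_distrib]
        exact Finset.sum_congr rfl fun i _ => by rw [hc']; ring) hc2 hs
    have := congrFun this j
    simp only [Pi.zero_apply] at this
    linarith
  push Not at hs
  -- The remainders of 2c' have absolute sum at most 3 - 2 Σ |c'| < 1, so the previous lemma puts 2m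
  -- in the span.
  have hN : ∃ N : Fin 3 → ℤ, ∀ j, 2 * m j = ∑ i, N i * u i j := by
    refine ⟨fun i => 2 * round (c i) + round (2 * c' i), fun j => ?_⟩
    have h1 : ∀ i, |2 * c' i - round (2 * c' i)| ≤ 1 - 2 * |c' i| :=
      fun i => abs_two_mul_sub_round_le (hc2 i)
    have := hD.eq_zero_of_sum_abs_le hu hdet
      (m := fun j => 2 * m j - ∑ i, (2 * round (c i) + round (2 * c' i)) * u i j)
      (c := fun i => 2 * c' i - round (2 * c' i)) (by
        intro j
        push_cast
        rw [hc j, Finset.mul_sum, ← Finset.sum_sub_distrib]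
        exact Finset.sum_congr rfl fun i _ => by rw [hc']; ring)
      (fun i => abs_sub_round _)
      (by
        refine (Finset.sum_le_sum fun i _ => h1 i).trans ?_
        rw [Finset.sum_sub_distrib, ← Finset.mul_sum]
        simp only [Finset.sum_const, Finset.card_univ, Fintype.card_fin]
        norm_num
        linarith)
    have := congrFun this j
    simp only [Pi.zero_apply] at this
    linarith
  obtain ⟨N, hN⟩ := hN
  have hpair : ∀ i k, i ≠ k → ¬ ∀ j, (2 : ℤ) ∣ u i j + u k j := by
    intro i k hik h
    apply hdet
    rcases hD.eq_or_eq_neg (hu i) (hu k) h with h | h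
    · exact Matrix.det_zero_of_row_eq hik h
    · have h2 : (Matrix.of u).updateRow i (-u k) = Matrix.of u := by
        rw [← h]; exact Matrix.updateRow_eq_self _ i
      have h3 : -u k = (-1 : ℤ) • u k := by simp
      rw [← h2, h3, Matrix.det_updateRow_smul]
      have : ((Matrix.of u).updateRow i (u k)).det = 0 :=
        Matrix.det_updateRow_eq_zero hik.symm
      simp [this]
  have hone : ∀ i, ¬ ∀ j, (2 : ℤ) ∣ u i j := fun i h => hD.not_forall_even (hu i) h
  simp only [Fin.sum_univ_three] at hN ⊢
  -- One odd coefficient would make a minimal vector even, and two would make two independent ones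
  -- congruent mod 2. So all are even, or all odd.
  rcases Int.even_or_odd' (N 0) with ⟨k0, h0 | h0⟩ <;>
    rcases Int.even_or_odd' (N 1) with ⟨k1, h1 | h1⟩ <;>
    rcases Int.even_or_odd' (N 2) with ⟨k2, h2 | h2⟩ <;> simp only [h0, h1, h2] at hN
  · refine ⟨![k0, k1, k2], Or.inl fun j => ?_⟩
    have := hN j
    simp only [Matrix.cons_val]
    linarith
  · exact absurd (fun j => ⟨m j - k0 * u 0 j - k1 * u 1 j - k2 * u 2 j, by linarith [hN j]⟩)
      (hone 2)
  · exact absurd (fun j => ⟨m j - k0 * u 0 j - k1 * u 1 j - k2 * u 2 j, by linarith [hN j]⟩)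
      (hone 1)
  · exact absurd (fun j => ⟨m j - k0 * u 0 j - k1 * u 1 j - k2 * u 2 j, by linarith [hN j]⟩)
      (hpair 1 2 (by decide))
  · exact absurd (fun j => ⟨m j - k0 * u 0 j - k1 * u 1 j - k2 * u 2 j, by linarith [hN j]⟩)
      (hone 0)
  · exact absurd (fun j => ⟨m j - k0 * u 0 j - k1 * u 1 j - k2 * u 2 j, by linarith [hN j]⟩)
      (hpair 0 2 (by decide))
  · exact absurd (fun j => ⟨m j - k0 * u 0 j - k1 * u 1 j - k2 * u 2 j, by linarith [hN j]⟩)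
      (hpair 0 1 (by decide))
  · refine ⟨N, Or.inr ⟨fun j => by rw [h0, h1, h2]; exact hN j, fun i => ?_⟩⟩
    fin_cases i
    · exact ⟨k0, h0⟩
    · exact ⟨k1, h1⟩
    · exact ⟨k2, h2⟩

lemma abs_det_eq_one_of_span {u : Fin 3 → Fin 3 → ℤ}
    (h : ∀ m : Fin 3 → ℤ, ∃ n : Fin 3 → ℤ, ∀ j, m j = ∑ i, n i * u i j) :
    |(Matrix.of u).det| = 1 := by
  choose n hn using fun k : Fin 3 => h (Pi.single k 1)
  have : Matrix.of n * Matrix.of u = 1 := by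
    ext k j
    rw [Matrix.mul_apply, Matrix.one_apply]
    have := hn k j
    simp only [Matrix.of_apply]
    rw [← this, Pi.single_apply]
    simp [eq_comm]
  have hdet := congrArg Matrix.det this
  rw [Matrix.det_mul, Matrix.det_one] at hdet
  exact Int.isUnit_iff_abs_eq.1 (IsUnit.of_mul_eq_one_right _ hdet)

/-- The odd alternative of `span_or_odd` would make the sum of the three vectors even. -/
lemma IsSmoothWide.abs_det_eq_one {D : Set (Fin 3 → ℝ)} (hD : IsSmoothWide D)
    {u : Fin 3 → Fin 3 → ℤ} (hu : ∀ i, u i ∈ unitVectors D) (hdet : (Matrix.of u).det ≠ 0)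
    (hodd : ¬ ∀ j, (2 : ℤ) ∣ ∑ i, u i j) : |(Matrix.of u).det| = 1 := by
  apply abs_det_eq_one_of_span
  intro m
  obtain ⟨n, h | ⟨h1, h2⟩⟩ := hD.span_or_odd hu hdet m
  · exact ⟨n, h⟩
  · exfalso
    apply hodd
    intro j
    choose k hk using h2
    refine ⟨m j - ∑ i, k i * u i j, ?_⟩
    have := h1 j
    simp only [hk, Fin.sum_univ_three] at this ⊢
    linarith

lemma IsSmoothWide.zero_mem {D : Set (Fin 3 → ℝ)} (hD : IsSmoothWide D) : (0 : Fin 3 → ℝ) ∈ D := by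
  obtain ⟨d, hd, -⟩ := hD.wide 1 one_ne_zero
  have := hD.convex hd (hD.neg_mem d hd) (a := 1 / 2) (b := 1 / 2) (by norm_num) (by norm_num)
    (by norm_num)
  simpa using this

lemma IsSmoothWide.exists_dotProduct_eq_one {D : Set (Fin 3 → ℝ)} (hD : IsSmoothWide D)
    {z : Fin 3 → ℤ} (hz : z ≠ 0) : ∃ d ∈ D, d ⬝ᵥ (fun i => (z i : ℝ)) = 1 := by
  obtain ⟨d, hd, h⟩ := hD.wide z hz
  refine ⟨(d ⬝ᵥ (fun i => (z i : ℝ)))⁻¹ • d, ?_, ?_⟩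
  · exact hD.convex.smul_mem_of_zero_mem hD.zero_mem hd
      ⟨by positivity, inv_le_one_of_one_le₀ h⟩
  · rw [smul_dotProduct, smul_eq_mul, inv_mul_cancel₀ (by linarith)]

lemma IsSmoothWide.exists_dotProduct_eq_neg_one {D : Set (Fin 3 → ℝ)} (hD : IsSmoothWide D)
    {z : Fin 3 → ℤ} (hz : z ≠ 0) : ∃ d ∈ D, d ⬝ᵥ (fun i => (z i : ℝ)) = -1 := by
  obtain ⟨d, hd, h⟩ := hD.exists_dotProduct_eq_one hz
  exact ⟨-d, hD.neg_mem d hd, by rw [neg_dotProduct, h]⟩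

lemma IsSmoothWide.abs_dotProduct_le {D : Set (Fin 3 → ℝ)} (hD : IsSmoothWide D)
    {z : Fin 3 → ℤ} (hz : z ∈ unitVectors D) {d : Fin 3 → ℝ} (hd : d ∈ D) :
    |d ⬝ᵥ (fun i => (z i : ℝ))| ≤ 1 := by
  refine abs_le.2 ⟨?_, hz.2 d hd⟩
  have := hz.2 (-d) (hD.neg_mem d hd)
  rw [neg_dotProduct] at this
  linarith

/-- With w half the sum and h i = w - u i, the vectors h 0, h 1, h 2, -w sum to zero and their
pairwise sums are ±u i. The h i form a basis of ℤ³, so using them as coordinates preserves |det| and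
gives the frame. -/
lemma IsSmoothWide.exists_half_le_abs_det_of_even {D : Set (Fin 3 → ℝ)} (hD : IsSmoothWide D)
    {u : Fin 3 → Fin 3 → ℤ} (hu : ∀ i, u i ∈ unitVectors D) (hdet : (Matrix.of u).det ≠ 0)
    (heven : ∀ j, (2 : ℤ) ∣ ∑ i, u i j) :
    ∃ x ∈ D, ∃ y ∈ D, ∃ z ∈ D, 1 / 2 ≤ |(Matrix.of ![x, y, z]).det| := by
  choose w hw using heven
  obtain ⟨h, hh⟩ : ∃ h : Fin 3 → Fin 3 → ℤ, ∀ i j, h i j = w j - u i j := ⟨_, fun _ _ => rfl⟩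
  have hw' : ∀ j, w j = h 0 j + h 1 j + h 2 j := by
    intro j
    have := hw j
    rw [Fin.sum_univ_three] at this
    simp only [hh]; linarith
  have hu0 : ∀ j, u 0 j = h 1 j + h 2 j := fun j => by linarith [hw' j, hh 0 j]
  have hu1 : ∀ j, u 1 j = h 0 j + h 2 j := fun j => by linarith [hw' j, hh 1 j]
  have hu2 : ∀ j, u 2 j = h 0 j + h 1 j := fun j => by linarith [hw' j, hh 2 j]
  have hdeth : |(Matrix.of h).det| = 1 := by
    apply abs_det_eq_one_of_span
    intro m
    obtain ⟨n, h1 | ⟨h1, h2⟩⟩ := hD.span_or_odd hu hdet m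
    · refine ⟨fun i => n 0 + n 1 + n 2 - n i, fun j => ?_⟩
      rw [h1 j, Fin.sum_univ_three, Fin.sum_univ_three, hu0, hu1, hu2]
      ring
    · choose k hk using h2
      refine ⟨fun i => k 0 + k 1 + k 2 + 1 - k i, fun j => ?_⟩
      have := h1 j
      rw [Fin.sum_univ_three, hu0, hu1, hu2, hk, hk, hk] at this
      rw [Fin.sum_univ_three]
      linarith
  have hne : (Matrix.of h).det ≠ 0 := by
    intro h0; rw [h0] at hdeth; simp at hdeth
  have hh0 : ∀ i, h i ≠ 0 := by
    intro i h0
    exact hne (Matrix.det_eq_zero_of_row_eq_zero i fun j => by simp [h0])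
  have hw0 : w ≠ 0 := by
    intro h0
    apply hne
    have e : ∀ j, h 0 j = - h 1 j - h 2 j := fun j => by
      have := hw' j; rw [h0] at this; simp at this; linarith
    rw [Matrix.det_fin_three]
    simp only [Matrix.of_apply, e]
    ring
  set φ : (Fin 3 → ℝ) → (Fin 3 → ℝ) := fun x i => x ⬝ᵥ fun j => (h i j : ℝ) with hφ
  have hφu : ∀ x, (φ x 0 + φ x 1 = x ⬝ᵥ fun j => (u 2 j : ℝ)) ∧
      (φ x 0 + φ x 2 = x ⬝ᵥ fun j => (u 1 j : ℝ)) ∧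
      (φ x 1 + φ x 2 = x ⬝ᵥ fun j => (u 0 j : ℝ)) ∧
      (φ x 0 + φ x 1 + φ x 2 = x ⬝ᵥ fun j => (w j : ℝ)) := by
    intro x
    simp only [hφ, dotProduct, Fin.sum_univ_three, hu0, hu1, hu2, hw']
    push_cast
    refine ⟨?_, ?_, ?_, ?_⟩ <;> ring
  have key := exists_half_le_abs_det_of_frame (D := φ '' D)
    (by rintro _ ⟨x, hx, rfl⟩; rw [(hφu x).1]; exact hD.abs_dotProduct_le (hu 2) hx)
    (by rintro _ ⟨x, hx, rfl⟩; rw [(hφu x).2.1]; exact hD.abs_dotProduct_le (hu 1) hx)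
    (by rintro _ ⟨x, hx, rfl⟩; rw [(hφu x).2.2.1]; exact hD.abs_dotProduct_le (hu 0) hx)
    (by
      obtain ⟨d, hd, e⟩ := hD.exists_dotProduct_eq_neg_one hw0
      exact ⟨_, ⟨d, hd, rfl⟩, by rw [(hφu d).2.2.2, e]⟩)
    (by
      obtain ⟨d, hd, e⟩ := hD.exists_dotProduct_eq_one (hh0 0)
      exact ⟨_, ⟨d, hd, rfl⟩, e⟩)
    (by
      obtain ⟨d, hd, e⟩ := hD.exists_dotProduct_eq_one (hh0 1)
      exact ⟨_, ⟨d, hd, rfl⟩, e⟩)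
    (by
      obtain ⟨d, hd, e⟩ := hD.exists_dotProduct_eq_one (hh0 2)
      exact ⟨_, ⟨d, hd, rfl⟩, e⟩)
    (by
      obtain ⟨d, hd, e⟩ := hD.exists_dotProduct_eq_neg_one (hu 0).1
      exact ⟨_, ⟨d, hd, rfl⟩, by rw [(hφu d).2.2.1, e]⟩)
    (by
      obtain ⟨d, hd, e⟩ := hD.exists_dotProduct_eq_neg_one (hu 1).1
      exact ⟨_, ⟨d, hd, rfl⟩, by rw [(hφu d).2.1, e]⟩)
    (by
      obtain ⟨d, hd, e⟩ := hD.exists_dotProduct_eq_neg_one (hu 2).1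
      exact ⟨_, ⟨d, hd, rfl⟩, by rw [(hφu d).1, e]⟩)
  obtain ⟨_, ⟨x, hx, rfl⟩, _, ⟨y, hy, rfl⟩, _, ⟨z, hz, rfl⟩, hdet⟩ := key
  refine ⟨x, hx, y, hy, z, hz, hdet.trans_eq ?_⟩
  have e : Matrix.of ![φ x, φ y, φ z]
      = Matrix.of ![x, y, z] * ((Matrix.of h).map (Int.cast : ℤ → ℝ)).transpose := by
    ext i j
    rw [Matrix.mul_apply]
    fin_cases i <;> simp [hφ, dotProduct]
  have e2 : ((Matrix.of h).map (Int.cast : ℤ → ℝ)).det = ((Matrix.of h).det : ℝ) :=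
    (Int.cast_det _).symm
  have e3 : |((Matrix.of h).det : ℝ)| = 1 := by exact_mod_cast hdeth
  rw [e, Matrix.det_mul, Matrix.det_transpose, e2, abs_mul, e3, mul_one]

/-! ### Stationarity of a minimal lattice -/

/-- First order optimality, in its strict form: a matrix of negative trace cannot increase the
support function at all integer vectors where it is `1`. -/
lemma false_of_trace_neg {D : Set (Fin 3 → ℝ)} {c : ℝ} (hc : 0 < c)
    (hball : ∀ x : Fin 3 → ℝ, (∀ i, |x i| ≤ c) → x ∈ D)
    (hmin : ∀ X : Matrix (Fin 3) (Fin 3) ℝ, X.det ≠ 0 →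
      (∀ z : Fin 3 → ℤ, z ≠ 0 → ∃ d ∈ D, 1 ≤ d ⬝ᵥ X.mulVec (fun i => (z i : ℝ))) → 1 ≤ |X.det|)
    {Y : Matrix (Fin 3) (Fin 3) ℝ} (htr : Y.trace < 0)
    (hY : ∀ z ∈ unitVectors D, ∃ d ∈ D, 1 ≤ d ⬝ᵥ (fun i => (z i : ℝ)) ∧
      0 < d ⬝ᵥ Y.mulVec (fun i => (z i : ℝ))) : False := by
  have hX : ∀ (t : ℝ) (v : Fin 3 → ℝ) (d : Fin 3 → ℝ),
      d ⬝ᵥ ((1 + t • Y).mulVec v) = d ⬝ᵥ v + t * (d ⬝ᵥ Y.mulVec v) := by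
    intro t v d
    rw [Matrix.add_mulVec, Matrix.one_mulVec, Matrix.smul_mulVec, dotProduct_add,
      dotProduct_smul, smul_eq_mul]
  have hdet : ∀ t : ℝ, (1 + t • Y).det = 1 + t * (Y.trace + t * (Y 0 0 * Y 1 1 + Y 0 0 * Y 2 2
      + Y 1 1 * Y 2 2 - Y 0 1 * Y 1 0 - Y 0 2 * Y 2 0 - Y 1 2 * Y 2 1 + t * Y.det)) := by
    intro t
    simp only [Matrix.det_fin_three, Matrix.trace_fin_three, Matrix.add_apply, Matrix.one_apply,
      Matrix.smul_apply, smul_eq_mul]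
    simp
    ring
  have ev1 : ∀ᶠ t in nhdsWithin (0 : ℝ) (Set.Ioi 0), 0 < (1 + t • Y).det := by
    apply Filter.Eventually.filter_mono nhdsWithin_le_nhds
    have : Continuous fun t : ℝ => (1 + t • Y).det := by simp_rw [hdet]; fun_prop
    exact this.continuousAt.eventually_const_lt (by simp)
  have ev2 : ∀ᶠ t in nhdsWithin (0 : ℝ) (Set.Ioi 0), (1 + t • Y).det < 1 := by
    have : Continuous fun t : ℝ => Y.trace + t * (Y 0 0 * Y 1 1 + Y 0 0 * Y 2 2
      + Y 1 1 * Y 2 2 - Y 0 1 * Y 1 0 - Y 0 2 * Y 2 0 - Y 1 2 * Y 2 1 + t * Y.det) := by fun_prop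
    have h := this.continuousAt (x := 0) |>.eventually_lt_const (u := 0) (by simpa using htr)
    filter_upwards [h.filter_mono nhdsWithin_le_nhds, self_mem_nhdsWithin] with t ht ht0
    rw [hdet]
    have := mul_neg_of_pos_of_neg (Set.mem_Ioi.1 ht0) ht
    linarith
  obtain ⟨M, hM0, hM⟩ : ∃ M : ℝ, 0 < M ∧ ∀ v : Fin 3 → ℝ, ‖Y.mulVec v‖ ≤ M * ‖v‖ := by
    obtain ⟨M, hM0, hM⟩ := (LinearMap.toContinuousLinearMap (Matrix.toLin' Y)).bound
    exact ⟨M, hM0, fun v => by simpa using hM v⟩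
  have hfar : ∀ w : Fin 3 → ℝ, ∃ d ∈ D, c * ‖w‖ ≤ d ⬝ᵥ w := by
    intro w
    obtain ⟨i, hi⟩ : ∃ i, ‖w‖ ≤ |w i| := by
      by_contra! hcon
      rcases eq_or_ne w 0 with rfl | hw
      · exact absurd (hcon 0) (by simp)
      · exact lt_irrefl _ ((pi_norm_lt_iff (norm_pos_iff.2 hw)).2 hcon)
    refine ⟨Pi.single i (if 0 ≤ w i then c else -c), hball _ fun j => ?_, ?_⟩
    · rcases eq_or_ne j i with rfl | hj
      · rw [Pi.single_eq_same]; split_ifs <;> simp [abs_of_pos hc]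
      · rw [Pi.single_eq_of_ne hj]; simp [hc.le]
    · rw [single_dotProduct]
      refine (mul_le_mul_of_nonneg_left hi hc.le).trans ?_
      split_ifs with h
      · rw [abs_of_nonneg h]
      · rw [abs_of_neg (not_le.1 h)]; linarith
  -- Only finitely many vectors need care. For `t * M ≤ 1 / 2` the image of a vector longer than 2/c
  -- has norm at least 1/c, where the box of half-width c in D already gives support at least 1.
  have hfin : {z : Fin 3 → ℤ | ‖fun i => (z i : ℝ)‖ ≤ 2 / c}.Finite := by
    refine (Set.finite_Icc (fun _ => -⌈2 / c⌉ : Fin 3 → ℤ) (fun _ => ⌈2 / c⌉)).subset ?_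
    intro z hz
    have h1 : ∀ i, |(z i : ℝ)| ≤ ⌈2 / c⌉ := fun i =>
      ((norm_le_pi_norm (fun i => (z i : ℝ)) i).trans hz).trans (Int.le_ceil _)
    constructor <;> intro i <;> have := abs_le.1 (h1 i)
    · exact_mod_cast this.1
    · exact_mod_cast this.2
  have ev3 : ∀ᶠ t in nhdsWithin (0 : ℝ) (Set.Ioi 0),
      ∀ z ∈ {z : Fin 3 → ℤ | ‖fun i => (z i : ℝ)‖ ≤ 2 / c}, z ≠ 0 →
        ∃ d ∈ D, 1 ≤ d ⬝ᵥ (1 + t • Y).mulVec (fun i => (z i : ℝ)) := by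
    rw [Filter.eventually_all_finite hfin]
    intro z _
    by_cases hz : z ∈ unitVectors D
    · obtain ⟨d, hd, h1, h2⟩ := hY z hz
      filter_upwards [self_mem_nhdsWithin] with t ht _
      refine ⟨d, hd, ?_⟩
      rw [hX]
      have := mul_pos (Set.mem_Ioi.1 ht) h2
      linarith
    · by_cases hz0 : z = 0
      · simp [hz0]
      · obtain ⟨d, hd, h1⟩ : ∃ d ∈ D, 1 < d ⬝ᵥ (fun i => (z i : ℝ)) := by
          by_contra! hcon
          exact hz ⟨hz0, hcon⟩
        have : Continuous fun t : ℝ => d ⬝ᵥ (1 + t • Y).mulVec (fun i => (z i : ℝ)) := by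
          simp_rw [hX]; fun_prop
        have h := this.continuousAt (x := 0) |>.eventually_const_lt (u := 1) (by simpa using h1)
        filter_upwards [h.filter_mono nhdsWithin_le_nhds] with t ht _
        exact ⟨d, hd, ht.le⟩
  have ev4 : ∀ᶠ t in nhdsWithin (0 : ℝ) (Set.Ioi 0), t * M ≤ 1 / 2 := by
    have : Continuous fun t : ℝ => t * M := by fun_prop
    exact (this.continuousAt (x := 0) |>.eventually_le_const (u := 1 / 2) (by simp)).filter_mono
      nhdsWithin_le_nhds
  obtain ⟨t, h1, h2, h3, h4, h5⟩ := (ev1.and (ev2.and (ev3.and (ev4.and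
    self_mem_nhdsWithin)))).exists
  have := hmin (1 + t • Y) h1.ne' (by
    intro z hz
    by_cases hz2 : ‖fun i => (z i : ℝ)‖ ≤ 2 / c
    · exact h3 z hz2 hz
    · obtain ⟨d, hd, hdw⟩ := hfar ((1 + t • Y).mulVec (fun i => (z i : ℝ)))
      refine ⟨d, hd, le_trans ?_ hdw⟩
      push Not at hz2
      have e : (1 + t • Y).mulVec (fun i => (z i : ℝ))
          = (fun i => (z i : ℝ)) + t • Y.mulVec (fun i => (z i : ℝ)) := by
        rw [Matrix.add_mulVec, Matrix.one_mulVec, Matrix.smul_mulVec]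
      rw [e]
      have k1 := norm_sub_le_norm_add (fun i => (z i : ℝ)) (t • Y.mulVec (fun i => (z i : ℝ)))
      rw [norm_smul, Real.norm_of_nonneg (Set.mem_Ioi.1 h5).le] at k1
      have k2 := mul_le_mul_of_nonneg_left (hM (fun i => (z i : ℝ))) (Set.mem_Ioi.1 h5).le
      have k3 := mul_le_mul_of_nonneg_right h4 (norm_nonneg (fun i => (z i : ℝ)))
      have k4 : 1 / c ≤ ‖(fun i => (z i : ℝ)) + t • Y.mulVec (fun i => (z i : ℝ))‖ := by
        have : 2 / c = 2 * (1 / c) := by ring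
        linarith
      calc (1 : ℝ) = c * (1 / c) := by field_simp
        _ ≤ _ := mul_le_mul_of_nonneg_left k4 hc.le)
  rw [abs_of_pos h1] at this
  linarith

lemma two_dvd_iff_intCast_eq_zero (n : ℤ) : (2 : ℤ) ∣ n ↔ (n : ZMod 2) = 0 := by
  exact_mod_cast (ZMod.intCast_zmod_eq_zero_iff_dvd n 2).symm

/-- Stationarity of the identity: nonnegative weights on parity classes of unit vectors such that
the weighted sum of the matrices `p ⊗ u` is the identity. -/
lemma exists_weights_sum_eq_one {D : Set (Fin 3 → ℝ)} (hD : IsSmoothWide D) {c : ℝ} (hc : 0 < c)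
    (hball : ∀ x : Fin 3 → ℝ, (∀ i, |x i| ≤ c) → x ∈ D)
    (hmin : ∀ X : Matrix (Fin 3) (Fin 3) ℝ, X.det ≠ 0 →
      (∀ z : Fin 3 → ℤ, z ≠ 0 → ∃ d ∈ D, 1 ≤ d ⬝ᵥ X.mulVec (fun i => (z i : ℝ))) → 1 ≤ |X.det|) :
    ∃ (α : (Fin 3 → ZMod 2) → ℝ) (u : (Fin 3 → ZMod 2) → Fin 3 → ℤ)
      (p : (Fin 3 → ZMod 2) → Fin 3 → ℝ), (∀ x, 0 ≤ α x) ∧ ∑ x, α x = 3 ∧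
      (∀ x, (∃ z ∈ unitVectors D, ∀ i, (z i : ZMod 2) = x i) → u x ∈ unitVectors D ∧
        (∀ i, (u x i : ZMod 2) = x i) ∧ p x ∈ D) ∧
      (∀ x, (¬ ∃ z ∈ unitVectors D, ∀ i, (z i : ZMod 2) = x i) → α x = 0) ∧
      ∀ i j, ∑ x, α x * (p x i * u x j) = (1 : Matrix (Fin 3) (Fin 3) ℝ) i j := by
  classical
  set P : (Fin 3 → ZMod 2) → Prop := fun x => ∃ z ∈ unitVectors D, ∀ i, (z i : ZMod 2) = x i with hP
  have hu : ∀ x, ∃ z : Fin 3 → ℤ, P x → z ∈ unitVectors D ∧ ∀ i, (z i : ZMod 2) = x i := by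
    intro x
    by_cases h : P x
    · obtain ⟨z, hz⟩ := h; exact ⟨z, fun _ => hz⟩
    · exact ⟨0, fun h' => absurd h' h⟩
  choose u hu using hu
  have hp : ∀ x, ∃ d : Fin 3 → ℝ, P x → d ∈ D ∧ d ⬝ᵥ (fun i => (u x i : ℝ)) = 1 := by
    intro x
    by_cases h : P x
    · obtain ⟨d, hd⟩ := hD.exists_dotProduct_eq_one (hu x h).1.1; exact ⟨d, fun _ => hd⟩
    · exact ⟨0, fun h' => absurd h' h⟩
  choose p hp using hp
  -- One representative of each parity class suffices: the class contains only ±u, and p ⊗ u does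
  -- not change when both signs do.
  set Δ : Set ((Fin 3 → ZMod 2) → ℝ) := stdSimplex ℝ _ ∩ {w | ∀ x, ¬ P x → w x = 0} with hΔ
  have hΔc : IsCompact Δ := by
    apply (isCompact_stdSimplex ℝ (Fin 3 → ZMod 2)).inter_right
    simp only [Set.ofPred_forall]
    exact isClosed_iInter fun x => isClosed_iInter fun _ =>
      isClosed_eq (continuous_apply x) continuous_const
  have hΔx : Convex ℝ Δ := by
    apply (convex_stdSimplex ℝ _).inter
    intro v hv w hw a b _ _ _ x hx
    simp [hv x hx, hw x hx]
  let L : ((Fin 3 → ZMod 2) → ℝ) →ₗ[ℝ] (Fin 3 → Fin 3 → ℝ) :=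
    { toFun := fun w i j => ∑ x, w x * (p x i * u x j)
      map_add' := fun v w => by
        ext i j; simp [add_mul, Finset.sum_add_distrib]
      map_smul' := fun a w => by
        ext i j; simp [Finset.mul_sum, mul_assoc] }
  have hLc : Continuous L := L.continuous_of_finiteDimensional
  -- Each p ⊗ u has trace p · u = 1 and the identity has trace 3, whence the factor 1/3.
  by_cases hmem : (fun i j => (1 / 3 : ℝ) * (1 : Matrix (Fin 3) (Fin 3) ℝ) i j) ∈ L '' Δ
  · obtain ⟨w, ⟨⟨hw1, hw2⟩, hw3⟩, hw⟩ := hmem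
    refine ⟨fun x => 3 * w x, u, p, fun x => by have := hw1 x; positivity,
      by rw [← Finset.mul_sum, hw2, mul_one],
      fun x hx => ⟨(hu x hx).1, (hu x hx).2, (hp x hx).1⟩,
      fun x hx => by simp only [hw3 x hx, mul_zero], fun i j => ?_⟩
    have := congrFun (congrFun hw i) j
    simp only [L, LinearMap.coe_mk, AddHom.coe_mk] at this
    simp_rw [mul_assoc]
    rw [← Finset.mul_sum, this]
    ring
  exfalso
  obtain ⟨f, s, hf1, hf2⟩ := geometric_hahn_banach_point_closed (hΔx.linear_image L)
    (hΔc.image hLc).isClosed hmem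
  obtain ⟨Y, hY⟩ : ∃ Y : Matrix (Fin 3) (Fin 3) ℝ,
      Y = Matrix.of fun i j => f (Pi.single i (Pi.single j 1)) := ⟨_, rfl⟩
  have hfY : ∀ M : Fin 3 → Fin 3 → ℝ, f M = ∑ i, ∑ j, M i j * Y i j := by
    intro M
    have : M = ∑ i, ∑ j, M i j • (Pi.single i (Pi.single j 1) : Fin 3 → Fin 3 → ℝ) := by
      ext a b
      simp [Finset.sum_apply, Pi.single_apply]
      fin_cases a <;> fin_cases b <;> simp [Fin.sum_univ_three]
    conv_lhs => rw [this]
    simp [map_sum, hY]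
  -- Since p · u = 1, subtracting s times the identity from the separating matrix makes every p · Y
  -- u positive and the trace negative.
  refine false_of_trace_neg hc hball hmin (Y := Y - s • (1 : Matrix (Fin 3) (Fin 3) ℝ)) ?_ ?_
  · rw [hfY] at hf1
    rw [Matrix.trace_fin_three]
    simp [Fin.sum_univ_three, Matrix.one_apply] at hf1 ⊢
    linarith
  · have hcls : ∀ x, P x → 0 < p x ⬝ᵥ (Y - s • (1 : Matrix (Fin 3) (Fin 3) ℝ)).mulVec
        (fun i => (u x i : ℝ)) := by
      intro x hx
      have hmem : Pi.single x 1 ∈ Δ := by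
        refine ⟨single_mem_stdSimplex ℝ x, fun y hy => ?_⟩
        rw [Pi.single_eq_of_ne]
        rintro rfl; exact hy hx
      have h1 := hf2 _ ⟨_, hmem, rfl⟩
      rw [hfY] at h1
      rw [Matrix.sub_mulVec, dotProduct_sub, Matrix.smul_mulVec, Matrix.one_mulVec,
        dotProduct_smul, (hp x hx).2, smul_eq_mul, mul_one]
      simp only [L, LinearMap.coe_mk, AddHom.coe_mk, Pi.single_apply, ite_mul, one_mul, zero_mul,
        Finset.sum_ite_eq', Finset.mem_univ, if_true, Fin.sum_univ_three] at h1
      simp only [dotProduct, Matrix.mulVec, Fin.sum_univ_three]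
      linarith
    intro z hz
    obtain ⟨x, hx⟩ : ∃ x : Fin 3 → ZMod 2, ∀ i, (z i : ZMod 2) = x i := ⟨_, fun i => rfl⟩
    have hPz : P x := ⟨z, hz, hx⟩
    have h1 := hu _ hPz
    have h2 := hp _ hPz
    have h3 := hcls _ hPz
    rcases hD.eq_or_eq_neg hz h1.1 (fun i => by
      rw [two_dvd_iff_intCast_eq_zero]
      push_cast
      rw [h1.2 i, hx i]
      exact CharTwo.add_self_eq_zero _) with h | h
    · rw [h]
      exact ⟨_, h2.1, h2.2.ge, h3⟩
    · have e : (fun i => (z i : ℝ)) = -fun i => (u x i : ℝ) := by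
        ext i
        have := congrFun h i
        simp only [Pi.neg_apply] at this ⊢
        exact_mod_cast this
      refine ⟨_, hD.neg_mem _ h2.1, ?_, ?_⟩
      · rw [e, neg_dotProduct_neg, h2.2]
      · rw [e, Matrix.mulVec_neg, neg_dotProduct_neg]
        exact h3

/-! ### Three points of determinant at least 1/2 -/

theorem IsSmoothWide.exists_half_le_abs_det {D : Set (Fin 3 → ℝ)} (hD : IsSmoothWide D)
    {c : ℝ} (hc : 0 < c) (hball : ∀ x : Fin 3 → ℝ, (∀ i, |x i| ≤ c) → x ∈ D)
    (hmin : ∀ X : Matrix (Fin 3) (Fin 3) ℝ, X.det ≠ 0 →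
      (∀ z : Fin 3 → ℤ, z ≠ 0 → ∃ d ∈ D, 1 ≤ d ⬝ᵥ X.mulVec (fun i => (z i : ℝ))) → 1 ≤ |X.det|) :
    ∃ x ∈ D, ∃ y ∈ D, ∃ z ∈ D, 1 / 2 ≤ |(Matrix.of ![x, y, z]).det| := by
  by_contra! hcon
  obtain ⟨α, u, p, hα, hsum, hup, hα0, hid⟩ := exists_weights_sum_eq_one hD hc hball hmin
  -- no frames
  have hnf : ∀ v : Fin 3 → Fin 3 → ℤ, (∀ i, v i ∈ unitVectors D) → (∀ j, (2 : ℤ) ∣ ∑ i, v i j) →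
      (Matrix.of v).det = 0 := by
    intro v hv he
    by_contra hdet
    obtain ⟨x, hx, y, hy, z, hz, h⟩ := hD.exists_half_le_abs_det_of_even hv hdet he
    exact absurd (hcon x hx y hy z hz) (not_lt.2 h)
  have hdet1 : ∀ v : Fin 3 → Fin 3 → ℤ, (∀ i, v i ∈ unitVectors D) →
      |(Matrix.of v).det| ≤ 1 := by
    intro v hv
    by_cases hdet : (Matrix.of v).det = 0
    · simp [hdet]
    · exact (hD.abs_det_eq_one hv hdet fun he => hdet (hnf v hv he)).le
  set P : (Fin 3 → ZMod 2) → Prop := fun x => ∃ z ∈ unitVectors D, ∀ i, (z i : ZMod 2) = x i with hP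
  have hPα : ∀ x, α x ≠ 0 → P x := fun x hx => by
    by_contra h; exact hx (hα0 x h)
  have hP0 : ¬ P 0 := by
    rintro ⟨z, hz, h⟩
    exact hD.not_forall_even hz fun i => (two_dvd_iff_intCast_eq_zero _).2 (h i)
  have hfam : ∀ x y z : Fin 3 → ZMod 2, P x → P y → P z →
      ∀ i, (![u x, u y, u z] : Fin 3 → Fin 3 → ℤ) i ∈ unitVectors D := by
    intro x y z hx hy hz i
    fin_cases i
    · exact (hup x hx).1
    · exact (hup y hy).1
    · exact (hup z hz).1
  have hline : ∀ x y, P x → P y → P (x + y) →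
      (Matrix.of ![u x, u y, u (x + y)]).det = 0 := by
    intro x y hx hy hxy
    refine hnf _ (hfam _ _ _ hx hy hxy) fun j => ?_
    rw [two_dvd_iff_intCast_eq_zero, Fin.sum_univ_three]
    simp only [Matrix.cons_val]
    push_cast
    rw [(hup x hx).2.1, (hup y hy).2.1, (hup _ hxy).2.1]
    exact CharTwo.add_self_eq_zero (x j + y j)
  -- If all seven classes occurred, the u x would represent the Fano plane over ℤ.
  obtain ⟨k, hk0, hk⟩ : ∃ k, k ≠ 0 ∧ ¬ P k := by
    by_contra! hall
    exact false_of_fano (u := u) (fun x hx => (hup x (hall x hx)).2.1) fun x y hx hy hxy =>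
      hline x y (hall x hx) (hall y hy) (hall _ fun h => hxy (by
        rw [← sub_eq_zero]
        ext i
        have := congrFun h i
        simpa [CharTwo.sub_eq_add] using this))
  have hbound := sum_independent_le hα hsum (hα0 0 hP0) hk0 (hα0 k hk)
  -- The determinant vanishes for z in {x, y, x + y} and is at most 1 in absolute value otherwise,
  -- leaving the weight 3 - α x - α y - α (x + y) for z.
  have hinner : ∀ x y, ∑ z, α x * α y * α z * |((Matrix.of ![u x, u y, u z]).det : ℝ)| ≤
      (if x = 0 ∨ y = 0 ∨ x = y then 0 else α x * α y * (3 - α x - α y - α (x + y))) := by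
    intro x y
    split_ifs with h
    · refine (Finset.sum_eq_zero fun z _ => ?_).le
      rcases h with rfl | rfl | rfl
      · rw [hα0 0 hP0]; ring
      · rw [hα0 0 hP0]; ring
      · have : (Matrix.of ![u x, u x, u z]).det = 0 :=
          Matrix.det_zero_of_row_eq (i := 0) (j := 1) (by decide) rfl
        rw [this]; simp
    · push Not at h
      by_cases hx : P x
      swap
      · rw [hα0 x hx]; simp
      by_cases hy : P y
      swap
      · rw [hα0 y hy]; simp
      have hterm : ∀ z, α z * |((Matrix.of ![u x, u y, u z]).det : ℝ)| ≤ α z -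
          ((if z = x then α x else 0) + (if z = y then α y else 0)
            + if z = x + y then α (x + y) else 0) := by
        intro z
        have hxy1 : x ≠ x + y := fun h' => h.2.1 (by simpa using h'.symm)
        have hxy2 : y ≠ x + y := fun h' => h.1 (by simpa using h'.symm)
        by_cases hz : P z
        swap
        · have := hα0 z hz
          rw [this, zero_mul]
          have e1 : (if z = x then α x else 0) = 0 := by
            split_ifs with h'
            · rw [← h', this]
            · rfl
          have e2 : (if z = y then α y else 0) = 0 := by
            split_ifs with h'
            · rw [← h', this]
            · rfl
          have e3 : (if z = x + y then α (x + y) else 0) = 0 := by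
            split_ifs with h'
            · rw [← h', this]
            · rfl
          rw [e1, e2, e3]; simp
        by_cases h1 : z = x
        · subst h1
          have : (Matrix.of ![u z, u y, u z]).det = 0 :=
            Matrix.det_zero_of_row_eq (i := 0) (j := 2) (by decide) rfl
          rw [this]
          simp [h.2.2, hxy1]
        by_cases h2 : z = y
        · subst h2
          have : (Matrix.of ![u x, u z, u z]).det = 0 :=
            Matrix.det_zero_of_row_eq (i := 1) (j := 2) (by decide) rfl
          rw [this]
          simp [h1, h.1]
        by_cases h3 : z = x + y
        · subst h3
          rw [hline x y hx hy hz]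
          simp [h.1, h.2.1]
        · simp only [h1, h2, h3, if_false, add_zero, sub_zero]
          refine mul_le_of_le_one_right (hα z) ?_
          have := hdet1 _ (hfam x y z hx hy hz)
          exact_mod_cast this
      calc _ = α x * α y * ∑ z, α z * |((Matrix.of ![u x, u y, u z]).det : ℝ)| := by
            rw [Finset.mul_sum]
            exact Finset.sum_congr rfl fun z _ => by ring
        _ ≤ α x * α y * ∑ z, (α z - ((if z = x then α x else 0) + (if z = y then α y else 0)
            + if z = x + y then α (x + y) else 0)) :=
          mul_le_mul_of_nonneg_left (Finset.sum_le_sum fun z _ => hterm z)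
            (mul_nonneg (hα x) (hα y))
        _ = _ := by
          rw [Finset.sum_sub_distrib, Finset.sum_add_distrib, Finset.sum_add_distrib, hsum]
          simp only [Finset.sum_ite_eq', Finset.mem_univ, if_true]
          ring
  have htriple : ∀ g : (Fin 3 → ZMod 2) → (Fin 3 → ZMod 2) → (Fin 3 → ZMod 2) → ℝ,
      ∑ f : Fin 3 → Fin 3 → ZMod 2, g (f 0) (f 1) (f 2) = ∑ x, ∑ y, ∑ z, g x y z := by
    intro g
    have hb : Function.Bijective
        (fun f : Fin 3 → Fin 3 → ZMod 2 => (f 0, f 1, f 2)) := by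
      refine ⟨fun f f' h => ?_, fun q => ⟨![q.1, q.2.1, q.2.2], rfl⟩⟩
      simp only [Prod.mk.injEq] at h
      ext i
      fin_cases i
      · exact congrFun h.1 _
      · exact congrFun h.2.1 _
      · exact congrFun h.2.2 _
    rw [Fintype.sum_bijective _ hb _ (fun q => g q.1 q.2.1 q.2.2) fun f => rfl,
      Fintype.sum_prod_type]
    simp_rw [Fintype.sum_prod_type]
  have hCB := sum_det_mul_det (fun x i => α x * p x i) (fun x j => (u x j : ℝ))
  have hone : (Matrix.of fun i j => ∑ x, α x * p x i * (u x j : ℝ)) = 1 := by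
    ext i j
    rw [← hid i j, Matrix.of_apply]
    exact Finset.sum_congr rfl fun x _ => mul_assoc _ _ _
  rw [hone, Matrix.det_one, mul_one] at hCB
  set W : (Fin 3 → Fin 3 → ZMod 2) → ℝ := fun f =>
    α (f 0) * α (f 1) * α (f 2) * |((Matrix.of ![u (f 0), u (f 1), u (f 2)]).det : ℝ)| with hW
  have hW0 : ∀ f, 0 ≤ W f := fun f =>
    mul_nonneg (mul_nonneg (mul_nonneg (hα _) (hα _)) (hα _)) (abs_nonneg _)
  have hWsum : ∑ f, W f ≤ 12 := by
    rw [hW, htriple (fun x y z => α x * α y * α z * |((Matrix.of ![u x, u y, u z]).det : ℝ)|)]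
    exact (Finset.sum_le_sum fun x _ => Finset.sum_le_sum fun y _ => hinner x y).trans hbound
  have hterm : ∀ f : Fin 3 → Fin 3 → ZMod 2,
      (Matrix.of fun i => fun j => α (f i) * p (f i) j).det * (Matrix.of fun i => fun j =>
        (u (f i) j : ℝ)).det ≤ W f * |(Matrix.of ![p (f 0), p (f 1), p (f 2)]).det| := by
    intro f
    have e1 : (Matrix.of fun i => fun j => α (f i) * p (f i) j).det
        = α (f 0) * α (f 1) * α (f 2) * (Matrix.of ![p (f 0), p (f 1), p (f 2)]).det := by
      simp only [Matrix.det_fin_three, Matrix.of_apply, Matrix.cons_val]; ring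
    have e2 : (Matrix.of fun i => fun j => (u (f i) j : ℝ)).det
        = ((Matrix.of ![u (f 0), u (f 1), u (f 2)]).det : ℝ) := by
      simp only [Matrix.det_fin_three, Matrix.of_apply, Matrix.cons_val]; push_cast; ring
    rw [e1, e2]
    refine (le_abs_self _).trans_eq ?_
    rw [abs_mul, abs_mul, abs_of_nonneg (mul_nonneg (mul_nonneg (hα _) (hα _)) (hα _))]
    ring
  have hlt : ∀ f, W f ≠ 0 → |(Matrix.of ![p (f 0), p (f 1), p (f 2)]).det| < 1 / 2 := by
    intro f hf
    have h0 : α (f 0) ≠ 0 := fun h => hf (by simp [hW, h])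
    have h1 : α (f 1) ≠ 0 := fun h => hf (by simp [hW, h])
    have h2 : α (f 2) ≠ 0 := fun h => hf (by simp [hW, h])
    exact hcon _ (hup _ (hPα _ h0)).2.2 _ (hup _ (hPα _ h1)).2.2 _ (hup _ (hPα _ h2)).2.2
  have hle : ∀ f, W f * |(Matrix.of ![p (f 0), p (f 1), p (f 2)]).det| ≤ W f * (1 / 2) := by
    intro f
    by_cases hf : W f = 0
    · simp [hf]
    · exact mul_le_mul_of_nonneg_left (hlt f hf).le (hW0 f)
  -- Cauchy–Binet for the identity matrix. As the weights W sum to at most 12, the determinants of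
  -- the p cannot all be below 1/2.
  have h6 : 6 ≤ ∑ f, W f * |(Matrix.of ![p (f 0), p (f 1), p (f 2)]).det| := by
    rw [← hCB]; exact Finset.sum_le_sum fun f _ => hterm f
  by_cases hall : ∀ f, W f = 0
  · simp [hall] at h6
    linarith
  · push Not at hall
    obtain ⟨f, hf⟩ := hall
    have : ∑ f, W f * |(Matrix.of ![p (f 0), p (f 1), p (f 2)]).det| < ∑ f, W f * (1 / 2) :=
      Finset.sum_lt_sum (fun f _ => hle f) ⟨f, Finset.mem_univ f,
        mul_lt_mul_of_pos_left (hlt f hf) (lt_of_le_of_ne (hW0 f) (Ne.symm hf))⟩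
    rw [← Finset.sum_mul] at this
    linarith

/-! ### Reduced bases and existence of a minimal lattice -/

/-- x, y, z are the squared lengths and f, g, h the inner products of a reduced basis. If fgh ≥ 0,
each of the three subtracted squares costs at most xyz/4. Otherwise the sign pattern and `s1`–`s4`
give |f| + |g| + |h| ≤ (x + y)/2, so the squares cost at most xyz/2 together and 2fgh at most xyz/4.
-/
lemma gram_det_ge_of_sorted {x y z f g h : ℝ} (hx : 0 ≤ x) (hxy : x ≤ y) (hyz : y ≤ z)
    (hf : 2 * |f| ≤ x) (hg : 2 * |g| ≤ x) (hh : 2 * |h| ≤ y)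
    (s1 : 0 ≤ x + y + 2 * (f + g + h)) (s2 : 0 ≤ x + y + 2 * (g - h - f))
    (s3 : 0 ≤ x + y + 2 * (h - g - f)) (s4 : 0 ≤ x + y + 2 * (f - g - h)) :
    x * y * z / 4 ≤ x * y * z + 2 * f * g * h - x * h ^ 2 - y * g ^ 2 - z * f ^ 2 := by
  have hy : 0 ≤ y := hx.trans hxy
  have hz : 0 ≤ z := hy.trans hyz
  by_cases hfgh : 0 ≤ f * g * h
  · have e1 : z * f ^ 2 ≤ z * (x * y / 4) := by
      apply mul_le_mul_of_nonneg_left _ hz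
      rw [← sq_abs]
      have := mul_le_mul hf (hf.trans hxy) (by positivity) hx
      linarith
    have e2 : y * g ^ 2 ≤ y * (x * z / 4) := by
      apply mul_le_mul_of_nonneg_left _ hy
      rw [← sq_abs]
      have := mul_le_mul hg (hg.trans (hxy.trans hyz)) (by positivity) hx
      linarith
    have e3 : x * h ^ 2 ≤ x * (y * z / 4) := by
      apply mul_le_mul_of_nonneg_left _ hx
      rw [← sq_abs]
      have := mul_le_mul hh (hh.trans hyz) (by positivity) hy
      linarith
    linarith
  · push Not at hfgh
    have hsum : |f| + |g| + |h| ≤ (x + y) / 2 := by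
      rcases le_total 0 f with a | a <;> rcases le_total 0 g with b | b <;>
        rcases le_total 0 h with c | c
      · exact absurd (mul_nonneg (mul_nonneg a b) c) (not_le.2 hfgh)
      · rw [abs_of_nonneg a, abs_of_nonneg b, abs_of_nonpos c]; linarith
      · rw [abs_of_nonneg a, abs_of_nonpos b, abs_of_nonneg c]; linarith
      · exact absurd (mul_nonneg_of_nonpos_of_nonpos (mul_nonpos_of_nonneg_of_nonpos a b) c)
          (not_le.2 hfgh)
      · rw [abs_of_nonpos a, abs_of_nonneg b, abs_of_nonneg c]; linarith
      · exact absurd (mul_nonneg_of_nonpos_of_nonpos (mul_nonpos_of_nonpos_of_nonneg a b) c)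
          (not_le.2 hfgh)
      · exact absurd (mul_nonneg (mul_nonneg_of_nonpos_of_nonpos a b) c) (not_le.2 hfgh)
      · rw [abs_of_nonpos a, abs_of_nonpos b, abs_of_nonpos c]; linarith
    have e0 : -(f * g * h) ≤ |f| * |g| * |h| := by
      rw [← abs_mul, ← abs_mul]; exact neg_le_abs _
    have e1 : f ^ 2 * z ≤ |f| * (x / 2) * z := by
      apply mul_le_mul_of_nonneg_right _ hz
      rw [← sq_abs, sq]
      exact mul_le_mul_of_nonneg_left (by linarith) (abs_nonneg f)
    have e2 : g ^ 2 * y ≤ |g| * (x / 2) * z := by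
      apply mul_le_mul _ hyz hy (by positivity)
      rw [← sq_abs, sq]
      exact mul_le_mul_of_nonneg_left (by linarith) (abs_nonneg g)
    have e3 : x * h ^ 2 ≤ x * (|h| * (z / 2)) := by
      apply mul_le_mul_of_nonneg_left _ hx
      rw [← sq_abs, sq]
      exact mul_le_mul_of_nonneg_left (by linarith) (abs_nonneg h)
    have e4 : x * z / 2 * (|f| + |g| + |h|) ≤ x * z / 2 * y :=
      mul_le_mul_of_nonneg_left (by linarith) (by positivity)
    have e5 : |f| * |g| * |h| ≤ x / 2 * (z / 2) * (y / 2) := by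
      apply mul_le_mul _ (by linarith) (abs_nonneg h) (by positivity)
      exact mul_le_mul (by linarith) (by linarith) (abs_nonneg g) (by positivity)
    linarith

/-- The squared length of a column. -/
def colSq (B : Matrix (Fin 3) (Fin 3) ℝ) (i : Fin 3) : ℝ := ∑ k, B k i ^ 2

lemma colSq_nonneg (B : Matrix (Fin 3) (Fin 3) ℝ) (i : Fin 3) : 0 ≤ colSq B i :=
  Finset.sum_nonneg fun _ _ => sq_nonneg _

/-- Only w with entries 0, ±1 are needed; the order of the three lengths is settled by cases. Any
positive constant in place of 1/4 would serve the compactness argument. -/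
lemma prod_colSq_le_of_reduced {B : Matrix (Fin 3) (Fin 3) ℝ}
    (h : ∀ i, ∀ w : Fin 3 → ℤ, w i = 1 → colSq B i ≤ ∑ k, (∑ j, B k j * w j) ^ 2) :
    colSq B 0 * colSq B 1 * colSq B 2 / 4 ≤ B.det ^ 2 := by
  obtain ⟨f, hf⟩ : ∃ f, f = B 0 0 * B 0 1 + B 1 0 * B 1 1 + B 2 0 * B 2 1 := ⟨_, rfl⟩
  obtain ⟨g, hg⟩ : ∃ g, g = B 0 0 * B 0 2 + B 1 0 * B 1 2 + B 2 0 * B 2 2 := ⟨_, rfl⟩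
  obtain ⟨e, he⟩ : ∃ e, e = B 0 1 * B 0 2 + B 1 1 * B 1 2 + B 2 1 * B 2 2 := ⟨_, rfl⟩
  have hdet : B.det ^ 2 = colSq B 0 * colSq B 1 * colSq B 2 + 2 * f * g * e - colSq B 0 * e ^ 2
      - colSq B 1 * g ^ 2 - colSq B 2 * f ^ 2 := by
    rw [hf, hg, he, Matrix.det_fin_three]
    simp only [colSq, Fin.sum_univ_three]
    ring
  have key : ∀ a b c : ℝ, ∑ k, (∑ j, B k j * (![a, b, c] j)) ^ 2 = a ^ 2 * colSq B 0
      + b ^ 2 * colSq B 1 + c ^ 2 * colSq B 2 + 2 * (a * b * f + a * c * g + b * c * e) := by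
    intro a b c
    rw [hf, hg, he]
    simp only [colSq, Fin.sum_univ_three, Matrix.cons_val]
    ring
  have key2 : ∀ i, ∀ a b c : ℤ, (![a, b, c] : Fin 3 → ℤ) i = 1 → colSq B i ≤
      (a : ℝ) ^ 2 * colSq B 0 + (b : ℝ) ^ 2 * colSq B 1 + (c : ℝ) ^ 2 * colSq B 2
      + 2 * (a * b * f + a * c * g + b * c * e) := by
    intro i a b c hi
    rw [← key]
    refine (h i _ hi).trans_eq ?_
    simp only [Fin.sum_univ_three, Matrix.cons_val]
  have p1 := key2 0 1 1 0 rfl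
  have p2 := key2 0 1 (-1) 0 rfl
  have p3 := key2 0 1 0 1 rfl
  have p4 := key2 0 1 0 (-1) rfl
  have p5 := key2 1 1 1 0 rfl
  have p6 := key2 1 (-1) 1 0 rfl
  have p7 := key2 1 0 1 1 rfl
  have p8 := key2 1 0 1 (-1) rfl
  have p9 := key2 2 1 0 1 rfl
  have p10 := key2 2 (-1) 0 1 rfl
  have p11 := key2 2 0 1 1 rfl
  have p12 := key2 2 0 (-1) 1 rfl
  have q1 := key2 0 1 1 1 rfl
  have q2 := key2 0 1 (-1) 1 rfl
  have q3 := key2 0 1 1 (-1) rfl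
  have q4 := key2 0 1 (-1) (-1) rfl
  have q5 := key2 1 1 1 1 rfl
  have q6 := key2 1 (-1) 1 1 rfl
  have q7 := key2 1 1 1 (-1) rfl
  have q8 := key2 1 (-1) 1 (-1) rfl
  have q9 := key2 2 1 1 1 rfl
  have q10 := key2 2 (-1) 1 1 rfl
  have q11 := key2 2 1 (-1) 1 rfl
  have q12 := key2 2 (-1) (-1) 1 rfl
  have n0 := colSq_nonneg B 0
  have n1 := colSq_nonneg B 1
  have n2 := colSq_nonneg B 2
  rw [hdet]
  clear hf hg he hdet key key2 h
  generalize colSq B 0 = x at *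
  generalize colSq B 1 = y at *
  generalize colSq B 2 = z at *
  push_cast at *
  have abs2 : ∀ {s r : ℝ}, -r ≤ 2 * s → 2 * s ≤ r → 2 * |s| ≤ r := by
    intro s r h1 h2
    rcases abs_cases s with ⟨h, _⟩ | ⟨h, _⟩ <;> rw [h] <;> linarith
  have f1 : 2 * |f| ≤ x := abs2 (by linarith) (by linarith)
  have f2 : 2 * |f| ≤ y := abs2 (by linarith) (by linarith)
  have g1 : 2 * |g| ≤ x := abs2 (by linarith) (by linarith)
  have g2 : 2 * |g| ≤ z := abs2 (by linarith) (by linarith)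
  have e1 : 2 * |e| ≤ y := abs2 (by linarith) (by linarith)
  have e2 : 2 * |e| ≤ z := abs2 (by linarith) (by linarith)
  clear p1 p2 p3 p4 p5 p6 p7 p8 p9 p10 p11 p12 abs2
  rcases le_total x y with h1 | h1 <;> rcases le_total y z with h2 | h2 <;>
    rcases le_total x z with h3 | h3
  · linarith [gram_det_ge_of_sorted n0 h1 h2 f1 g1 e1 (by linarith) (by linarith) (by linarith)
      (by linarith)]
  · linarith [gram_det_ge_of_sorted n0 h1 h2 f1 g1 e1 (by linarith) (by linarith) (by linarith)
      (by linarith)]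
  · linarith [gram_det_ge_of_sorted n0 h3 h2 g1 f1 e2 (by linarith) (by linarith) (by linarith)
      (by linarith)]
  · linarith [gram_det_ge_of_sorted n2 h3 h1 g2 e2 f1 (by linarith) (by linarith) (by linarith)
      (by linarith)]
  · linarith [gram_det_ge_of_sorted n1 h1 h3 f2 e1 g1 (by linarith) (by linarith) (by linarith)
      (by linarith)]
  · linarith [gram_det_ge_of_sorted n1 h2 h3 e1 f2 g2 (by linarith) (by linarith) (by linarith)
      (by linarith)]
  · linarith [gram_det_ge_of_sorted n2 h2 h1 e2 g2 f2 (by linarith) (by linarith) (by linarith)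
      (by linarith)]
  · linarith [gram_det_ge_of_sorted n2 h2 h1 e2 g2 f2 (by linarith) (by linarith) (by linarith)
      (by linarith)]

/-- Each lattice basis can be replaced by one that is nearly orthogonal. -/
lemma exists_unimodular_prod_colSq_le {A : Matrix (Fin 3) (Fin 3) ℝ} (hA : A.det ≠ 0) :
    ∃ U : Matrix (Fin 3) (Fin 3) ℤ, IsUnit U.det ∧
      colSq (A * U.map (Int.cast : ℤ → ℝ)) 0 * colSq (A * U.map (Int.cast : ℤ → ℝ)) 1 *
        colSq (A * U.map (Int.cast : ℤ → ℝ)) 2 / 4 ≤ (A * U.map (Int.cast : ℤ → ℝ)).det ^ 2 := by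
  have hAu : IsUnit A.det := isUnit_iff_ne_zero.2 hA
  -- A basis of least total squared length is reduced; only finitely many U compete with the
  -- identity.
  set Φ : Matrix (Fin 3) (Fin 3) ℤ → ℝ := fun U => ∑ i, colSq (A * U.map (Int.cast : ℤ → ℝ)) i
    with hΦ
  set T : Set (Matrix (Fin 3) (Fin 3) ℤ) := {U | IsUnit U.det ∧ Φ U ≤ Φ 1} with hT
  have hfin : T.Finite := by
    obtain ⟨N, hN⟩ : ∃ N : ℤ, ∀ i, (∑ k, |A⁻¹ i k|) * (1 + Φ 1) ≤ N := by
      obtain ⟨N, hN⟩ := exists_int_ge (∑ i, (∑ k, |A⁻¹ i k|) * (1 + Φ 1))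
      refine ⟨N, fun i => le_trans ?_ hN⟩
      have h0 : 0 ≤ Φ 1 := Finset.sum_nonneg fun i _ => colSq_nonneg _ i
      exact Finset.single_le_sum (f := fun i => (∑ k, |A⁻¹ i k|) * (1 + Φ 1))
        (fun i _ => mul_nonneg (Finset.sum_nonneg fun _ _ => abs_nonneg _) (by linarith))
        (Finset.mem_univ i)
    refine (Set.finite_Icc (fun _ _ => -N : Fin 3 → Fin 3 → ℤ) (fun _ _ => N)).subset ?_
    rintro (U : Matrix (Fin 3) (Fin 3) ℤ) hU
    have hbd : ∀ i j, |(U i j : ℝ)| ≤ N := by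
      intro i j
      have e : U.map (Int.cast : ℤ → ℝ) = A⁻¹ * (A * U.map (Int.cast : ℤ → ℝ)) := by
        rw [← Matrix.mul_assoc, Matrix.nonsing_inv_mul _ hAu, Matrix.one_mul]
      have e2 : (U i j : ℝ) = ∑ k, A⁻¹ i k * (A * U.map (Int.cast : ℤ → ℝ)) k j := by
        rw [← Matrix.mul_apply, ← e, Matrix.map_apply]
      rw [e2]
      refine ((Finset.abs_sum_le_sum_abs _ _).trans ?_).trans (hN i)
      rw [Finset.sum_mul]
      refine Finset.sum_le_sum fun k _ => ?_
      rw [abs_mul]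
      refine mul_le_mul_of_nonneg_left ?_ (abs_nonneg _)
      have h1 : (A * U.map (Int.cast : ℤ → ℝ)) k j ^ 2 ≤ colSq (A * U.map (Int.cast : ℤ → ℝ)) j :=
        Finset.single_le_sum (f := fun k => (A * U.map (Int.cast : ℤ → ℝ)) k j ^ 2)
          (fun _ _ => sq_nonneg _) (Finset.mem_univ k)
      have h2 : colSq (A * U.map (Int.cast : ℤ → ℝ)) j ≤ Φ U :=
        Finset.single_le_sum (f := colSq (A * U.map (Int.cast : ℤ → ℝ)))
          (fun _ _ => colSq_nonneg _ _) (Finset.mem_univ j)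
      have h3 := hU.2
      rw [← sq_abs] at h1
      nlinarith [sq_nonneg (|(A * U.map (Int.cast : ℤ → ℝ)) k j| - 1)]
    constructor <;> intro i j <;> have := abs_le.1 (hbd i j)
    · exact_mod_cast this.1
    · exact_mod_cast this.2
  obtain ⟨U, hU, hmin⟩ := Set.exists_min_image T Φ hfin ⟨1, by simp, le_rfl⟩
  refine ⟨U, hU.1, prod_colSq_le_of_reduced fun i w hw => ?_⟩
  -- Multiplying by E replaces column i of the basis by its combination with coefficients w; as w i
  -- = 1, this is unimodular.
  set E : Matrix (Fin 3) (Fin 3) ℤ := (1 : Matrix (Fin 3) (Fin 3) ℤ).updateCol i w with hE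
  have hEdet : E.det = 1 := by
    rw [hE, ← hw]
    fin_cases i <;> simp [Matrix.det_fin_three]
  have hcol : ∀ j ≠ i, colSq (A * (U * E).map (Int.cast : ℤ → ℝ)) j
      = colSq (A * U.map (Int.cast : ℤ → ℝ)) j := by
    intro j hj
    have : ∀ k, (A * (U * E).map (Int.cast : ℤ → ℝ)) k j = (A * U.map (Int.cast : ℤ → ℝ)) k j := by
      intro k
      rw [Matrix.mul_apply, Matrix.mul_apply]
      refine Finset.sum_congr rfl fun l _ => ?_
      rw [Matrix.map_apply, Matrix.map_apply, Matrix.mul_apply]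
      simp [hE, hj, Matrix.one_apply]
    simp only [colSq, this]
  have hcoli : colSq (A * (U * E).map (Int.cast : ℤ → ℝ)) i
      = ∑ k, (∑ j, (A * U.map (Int.cast : ℤ → ℝ)) k j * w j) ^ 2 := by
    have : ∀ k, (A * (U * E).map (Int.cast : ℤ → ℝ)) k i
        = ∑ j, (A * U.map (Int.cast : ℤ → ℝ)) k j * w j := by
      intro k
      have e : (U * E).map (Int.cast : ℤ → ℝ)
          = U.map (Int.cast : ℤ → ℝ) * E.map (Int.cast : ℤ → ℝ) :=
        Matrix.map_mul (f := Int.castRingHom ℝ)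
      rw [e, ← Matrix.mul_assoc, Matrix.mul_apply]
      refine Finset.sum_congr rfl fun j _ => ?_
      simp [hE]
    simp only [colSq, this]
  rw [← hcoli]
  by_contra! hlt
  have hlt' : Φ (U * E) < Φ U := by
    refine Finset.sum_lt_sum (fun j _ => ?_) ⟨i, Finset.mem_univ i, hlt⟩
    by_cases hj : j = i
    · rw [hj]; exact hlt.le
    · exact (hcol j hj).le
  have := hmin (U * E) ⟨by rw [Matrix.det_mul, hEdet, mul_one]; exact hU.1, hlt'.le.trans hU.2⟩
  linarith

/-- The matrices `A` for which the support function of `D` is at least `1` at all nonzero vectors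
of `A ℤ³`. -/
def Admissible (D : Set (Fin 3 → ℝ)) (A : Matrix (Fin 3) (Fin 3) ℝ) : Prop :=
  ∀ z : Fin 3 → ℤ, z ≠ 0 → ∃ d ∈ D, 1 ≤ d ⬝ᵥ A.mulVec (fun i => (z i : ℝ))

/-- For each z the condition is the projection of a closed set along the compact factor D. -/
lemma isClosed_setOf_admissible {D : Set (Fin 3 → ℝ)} (hD : IsCompact D) :
    IsClosed {A | Admissible D A} := by
  have : {A | Admissible D A} = ⋂ z : Fin 3 → ℤ, ⋂ _ : z ≠ 0,
      Prod.snd '' {q : D × Matrix (Fin 3) (Fin 3) ℝ |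
        1 ≤ (q.1 : Fin 3 → ℝ) ⬝ᵥ q.2.mulVec (fun i => (z i : ℝ))} := by
    ext A
    simp [Admissible]
  rw [this]
  have : CompactSpace D := isCompact_iff_compactSpace.1 hD
  refine isClosed_iInter fun z => isClosed_iInter fun _ => isClosedMap_snd_of_compactSpace _ ?_
  refine isClosed_le continuous_const ?_
  simp only [dotProduct, Matrix.mulVec]
  refine continuous_finsetSum _ fun i _ => Continuous.mul ?_ (continuous_finsetSum _ fun j _ => ?_)
  · exact (continuous_apply i).comp (continuous_subtype_val.comp continuous_fst)
  · exact (continuous_snd.matrix_elem i j).mul continuous_const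

lemma Admissible.mul_unimodular {D : Set (Fin 3 → ℝ)} {A : Matrix (Fin 3) (Fin 3) ℝ}
    (hA : Admissible D A) {U : Matrix (Fin 3) (Fin 3) ℤ} (hU : IsUnit U.det) :
    Admissible D (A * U.map (Int.cast : ℤ → ℝ)) := by
  intro z hz
  have h0 : U.mulVec z ≠ 0 := by
    intro h
    apply hz
    have := congrArg (U⁻¹.mulVec ·) h
    simpa [Matrix.mulVec_mulVec, Matrix.nonsing_inv_mul _ hU] using this
  obtain ⟨d, hd, h⟩ := hA _ h0
  refine ⟨d, hd, h.trans_eq ?_⟩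
  rw [← Matrix.mulVec_mulVec]
  congr 2
  ext i
  simp [Matrix.mulVec, dotProduct]

/-- Mahler's compactness argument. By Cauchy–Schwarz, admissibility bounds all columns from below;
for a reduced basis the product of the column lengths is bounded by the determinant, so the columns
are also bounded above. The bound r³/4 ≤ det² keeps the limit nonsingular. -/
theorem exists_admissible_abs_det_le {D : Set (Fin 3 → ℝ)} (hD : IsCompact D)
    {c : ℝ} (hc : 0 < c) (hball : ∀ x : Fin 3 → ℝ, (∀ i, |x i| ≤ c) → x ∈ D) :
    ∃ A, Admissible D A ∧ A.det ≠ 0 ∧ ∀ B, Admissible D B → B.det ≠ 0 → |A.det| ≤ |B.det| := by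
  obtain ⟨R, hR0, hR⟩ : ∃ R : ℝ, 0 < R ∧ ∀ d ∈ D, ∑ k, d k ^ 2 ≤ R := by
    obtain ⟨R, hR⟩ := (hD.image (f := fun d : Fin 3 → ℝ => ∑ k, d k ^ 2) (by fun_prop)).bddAbove
    exact ⟨max R 1, by positivity, fun d hd => (hR ⟨d, hd, rfl⟩).trans (le_max_left _ _)⟩
  obtain ⟨r, hr0, hr⟩ : ∃ r : ℝ, 0 < r ∧ ∀ B, Admissible D B → ∀ i, r ≤ colSq B i := by
    refine ⟨1 / R, by positivity, fun B hB i => ?_⟩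
    obtain ⟨d, hd, h⟩ := hB (Pi.single i 1) (by
      intro h; have := congrFun h i; simp at this)
    have e : B.mulVec (fun j => ((Pi.single i 1 : Fin 3 → ℤ) j : ℝ)) = fun k => B k i := by
      ext k
      have : (fun j => ((Pi.single i 1 : Fin 3 → ℤ) j : ℝ)) = Pi.single i 1 := by
        ext j; simp [Pi.single_apply]
      rw [this]; simp
    rw [e] at h
    have cs := Finset.sum_mul_sq_le_sq_mul_sq Finset.univ d (fun k => B k i)
    have h1 : 1 ≤ (∑ k, d k * B k i) ^ 2 := by
      have : 1 ≤ ∑ k, d k * B k i := h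
      nlinarith
    have h2 := mul_le_mul_of_nonneg_right (hR d hd) (colSq_nonneg B i)
    rw [div_le_iff₀' hR0]
    exact (h1.trans cs).trans h2
  have hred : ∀ B, Admissible D B → B.det ≠ 0 → ∃ B', Admissible D B' ∧ |B'.det| = |B.det| ∧
      (∀ i, colSq B' i ≤ 4 * |B.det| ^ 2 / r ^ 2) ∧ r ^ 3 / 4 ≤ B'.det ^ 2 := by
    intro B hB hdet
    obtain ⟨U, hU, hprod⟩ := exists_unimodular_prod_colSq_le hdet
    have hB' := hB.mul_unimodular hU
    set B' := B * U.map (Int.cast : ℤ → ℝ) with hBB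
    have e : |B'.det| = |B.det| := by
      have h1 : (U.map (Int.cast : ℤ → ℝ)).det = (U.det : ℝ) := (Int.cast_det U).symm
      have h2 : |(U.det : ℝ)| = 1 := by exact_mod_cast Int.isUnit_iff_abs_eq.1 hU
      rw [hBB, Matrix.det_mul, abs_mul, h1, h2, mul_one]
    have r0 := hr B' hB' 0
    have r1 := hr B' hB' 1
    have r2 := hr B' hB' 2
    have n0 := colSq_nonneg B' 0
    have n1 := colSq_nonneg B' 1
    have n2 := colSq_nonneg B' 2
    have p01 := mul_le_mul r0 r1 hr0.le n0
    have p02 := mul_le_mul r0 r2 hr0.le n0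
    have p12 := mul_le_mul r1 r2 hr0.le n1
    rw [← sq_abs, e] at hprod
    refine ⟨B', hB', e, fun i => ?_, ?_⟩
    · rw [le_div_iff₀ (by positivity)]
      fin_cases i
      · have := mul_le_mul_of_nonneg_left p12 n0
        simp only [Fin.zero_eta]
        linarith
      · have := mul_le_mul_of_nonneg_left p02 n1
        simp only [Fin.mk_one]
        linarith
      · have := mul_le_mul_of_nonneg_left p01 n2
        simp only [Fin.reduceFinMk]
        linarith
    · rw [← sq_abs, e]
      have := mul_le_mul p01 r2 hr0.le (mul_nonneg n0 n1)
      linarith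
  -- a first admissible matrix
  have hA1 : Admissible D ((1 / c) • (1 : Matrix (Fin 3) (Fin 3) ℝ)) := by
    intro z hz
    obtain ⟨i, hi⟩ := Function.ne_iff.1 hz
    simp only [Pi.zero_apply] at hi
    have h1 : (1 : ℝ) ≤ |(z i : ℝ)| := by exact_mod_cast Int.one_le_abs hi
    refine ⟨Pi.single i (if 0 ≤ z i then c else -c), hball _ fun j => ?_, ?_⟩
    · rcases eq_or_ne j i with rfl | hj
      · rw [Pi.single_eq_same]; split_ifs <;> simp [abs_of_pos hc]
      · rw [Pi.single_eq_of_ne hj]; simp [hc.le]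
    · rw [single_dotProduct, Matrix.smul_mulVec, Matrix.one_mulVec, Pi.smul_apply, smul_eq_mul]
      refine h1.trans_eq ?_
      split_ifs with h
      · rw [abs_of_nonneg (by exact_mod_cast h)]; field_simp
      · rw [abs_of_neg (by exact_mod_cast not_le.1 h)]; field_simp
  have hdet1 : ((1 / c) • (1 : Matrix (Fin 3) (Fin 3) ℝ)).det ≠ 0 := by
    rw [Matrix.det_smul, Matrix.det_one, mul_one]; positivity
  set M := |((1 / c) • (1 : Matrix (Fin 3) (Fin 3) ℝ)).det| with hM
  set C : Set (Matrix (Fin 3) (Fin 3) ℝ) := {B | Admissible D B} ∩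
    ({B | ∀ i, colSq B i ≤ 4 * M ^ 2 / r ^ 2} ∩ {B | r ^ 3 / 4 ≤ B.det ^ 2}) with hC
  have hCc : IsCompact C := by
    have hclosed : IsClosed C := by
      refine (isClosed_setOf_admissible hD).inter (IsClosed.inter ?_ ?_)
      · simp only [Set.ofPred_forall]
        refine isClosed_iInter fun i => isClosed_le ?_ continuous_const
        simp only [colSq]
        fun_prop
      · exact isClosed_le continuous_const (by fun_prop)
    have hK : IsCompact (Set.Icc (fun _ _ => -(1 + 4 * M ^ 2 / r ^ 2) : Fin 3 → Fin 3 → ℝ)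
      (fun _ _ => 1 + 4 * M ^ 2 / r ^ 2)) := isCompact_Icc
    refine IsCompact.of_isClosed_subset (X := Fin 3 → Fin 3 → ℝ) hK hclosed ?_
    rintro (B : Matrix (Fin 3) (Fin 3) ℝ) ⟨-, hB, -⟩
    have hbd : ∀ i j, |B i j| ≤ 1 + 4 * M ^ 2 / r ^ 2 := by
      intro i j
      have h1 : B i j ^ 2 ≤ colSq B j :=
        Finset.single_le_sum (f := fun k => B k j ^ 2) (fun _ _ => sq_nonneg _) (Finset.mem_univ i)
      have h2 := hB j
      rw [← sq_abs] at h1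
      nlinarith [sq_nonneg (|B i j| - 1)]
    exact ⟨fun i j => (abs_le.1 (hbd i j)).1, fun i j => (abs_le.1 (hbd i j)).2⟩
  have hmemC : ∀ B, Admissible D B → B.det ≠ 0 → |B.det| ≤ M →
      ∃ B' ∈ C, |B'.det| = |B.det| := by
    intro B hB hdet hle
    obtain ⟨B', h1, h2, h3, h4⟩ := hred B hB hdet
    refine ⟨B', ⟨h1, fun i => (h3 i).trans ?_, h4⟩, h2⟩
    gcongr
  obtain ⟨A1, hA1C, hA1d⟩ := hmemC _ hA1 hdet1 le_rfl
  obtain ⟨A0, hA0, hmin⟩ := hCc.exists_isMinOn ⟨A1, hA1C⟩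
    (f := fun B : Matrix (Fin 3) (Fin 3) ℝ => |B.det|) (by fun_prop)
  refine ⟨A0, hA0.1, fun h => ?_, fun B hB hdet => ?_⟩
  · have := hA0.2.2
    simp only [Set.mem_ofPred_eq, h] at this
    have : 0 < r ^ 3 := by positivity
    linarith
  · rcases le_total |B.det| M with h | h
    · obtain ⟨B', hB', e⟩ := hmemC B hB hdet h
      rw [← e]; exact hmin hB'
    · refine le_trans ?_ h
      rw [hM, ← hA1d]; exact hmin hA1C

/-! ### Volume bounds from segments, and the volume of a simplex -/

lemma lintegral_one_sub_pow (n : ℕ) :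
    ∫⁻ t in Set.Icc (0 : ℝ) 1, ENNReal.ofReal ((1 - t) ^ n) = ENNReal.ofReal (1 / (n + 1)) := by
  rw [← ofReal_integral_eq_lintegral_ofReal]
  · rw [integral_Icc_eq_integral_Ioc, ← intervalIntegral.integral_of_le zero_le_one,
      intervalIntegral.integral_comp_sub_left (fun t => t ^ n) 1, integral_pow]
    simp
  · exact Continuous.integrableOn_Icc (by fun_prop)
  · filter_upwards [ae_restrict_mem measurableSet_Icc] with t ht
    exact pow_nonneg (by linarith [ht.2]) n

/-- A compact convex set containing a unit segment in the direction of the first factor has at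
least `1 / (n + 1)` times the volume of its projection to the second factor. -/
lemma volume_snd_image_le {n : ℕ} {K : Set (ℝ × (Fin n → ℝ))} (hK : IsCompact K)
    (hconv : Convex ℝ K) {a : ℝ} {y₀ : Fin n → ℝ} (h0 : (a, y₀) ∈ K) (h1 : (a + 1, y₀) ∈ K) :
    volume (Prod.snd '' K) ≤ (n + 1) * volume K := by
  set S := Prod.snd '' K with hS
  have hSc : IsCompact S := hK.image continuous_snd
  set F : ℝ × (Fin n → ℝ) → ℝ × (Fin n → ℝ) :=
    fun q => (q.1, y₀ + (1 - q.1) • (q.2 - y₀)) with hF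
  have hFc : Continuous F := by fun_prop
  -- The slice of T at height t is S shrunk by 1 - t towards y₀. Over such a shrunken point the
  -- fibre of K has length at least t: combine a point of K, with weight 1 - t, with the unit
  -- segment, with weight t. So each fibre of T lies in an interval from 0 of the length of the
  -- fibre of K.
  set T := F '' (Set.Icc 0 1 ×ˢ S) with hT
  have hTm : MeasurableSet T := ((isCompact_Icc.prod hSc).image hFc).isClosed.measurableSet
  have hTvol : volume T = ENNReal.ofReal (1 / (n + 1)) * volume S := by
    rw [Measure.volume_eq_prod, Measure.prod_apply hTm, ← lintegral_one_sub_pow,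
      ← lintegral_mul_const _ (by fun_prop), ← lintegral_indicator measurableSet_Icc]
    refine lintegral_congr fun t => ?_
    by_cases ht : t ∈ Set.Icc (0 : ℝ) 1
    · rw [Set.indicator_of_mem ht]
      have : Prod.mk t ⁻¹' T = AffineMap.homothety y₀ (1 - t) '' S := by
        ext y
        simp only [hT, hF, Set.mem_preimage, Set.mem_image, Set.mem_prod, Prod.exists,
          Prod.mk.injEq, AffineMap.homothety_apply, vsub_eq_sub, vadd_eq_add]
        constructor
        · rintro ⟨s, z, ⟨hs, hz⟩, rfl, h⟩
          exact ⟨z, hz, by rw [← h, add_comm]⟩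
        · rintro ⟨z, hz, h⟩
          exact ⟨t, z, ⟨ht, hz⟩, rfl, by rw [← h, add_comm]⟩
      rw [this, Measure.addHaar_image_homothety]
      congr 2
      rw [Module.finrank_fin_fun, abs_of_nonneg (pow_nonneg (by linarith [ht.2]) n)]
    · rw [Set.indicator_of_notMem ht]
      have : Prod.mk t ⁻¹' T = ∅ := by
        ext y
        simp only [hT, hF, Set.mem_preimage, Set.mem_image, Set.mem_prod, Prod.exists,
          Prod.mk.injEq, Set.mem_empty_iff_false, iff_false]
        rintro ⟨s, z, ⟨hs, hz⟩, rfl, h⟩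
        exact ht hs
      rw [this, measure_empty]
  have hTK : volume T ≤ volume K := by
    rw [Measure.volume_eq_prod, Measure.prod_apply_symm hTm,
      Measure.prod_apply_symm hK.isClosed.measurableSet]
    refine lintegral_mono fun y => ?_
    have hfib : ∀ t ∈ (fun x => (x, y)) ⁻¹' T, 0 ≤ t ∧
        ENNReal.ofReal t ≤ volume ((fun x : ℝ => (x, y)) ⁻¹' K) := by
      rintro t ⟨⟨s, z⟩, ⟨hs, ⟨b, z'⟩, hz, hzz⟩, h⟩
      simp only at hzz
      subst hzz
      simp only [hF, Prod.mk.injEq] at h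
      obtain ⟨rfl, rfl⟩ := h
      refine ⟨hs.1, ?_⟩
      have hsub : Set.Icc ((1 - s) * b + s * a) ((1 - s) * b + s * a + s) ⊆
          (fun x : ℝ => (x, y₀ + (1 - s) • (z' - y₀))) ⁻¹' K := by
        intro x hx
        rcases hs.1.eq_or_lt with h | h
        · subst h
          have hx' : x = b := by
            have := hx.1; have := hx.2; linarith
          simpa [hx'] using hz
        · have hseg := hconv h0 h1 (a := 1 - (x - ((1 - s) * b + s * a)) / s)
            (b := (x - ((1 - s) * b + s * a)) / s)
            (sub_nonneg.2 ((div_le_one h).2 (by linarith [hx.2])))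
            (div_nonneg (by linarith [hx.1]) h.le) (by ring)
          have := hconv hz hseg (a := 1 - s) (b := s) (by linarith [hs.2]) hs.1 (by ring)
          rw [Set.mem_preimage]
          convert this using 1
          ext i
          · simp; field_simp; ring
          · simp; ring
      refine le_trans ?_ (measure_mono hsub)
      rw [Real.volume_Icc]
      exact ENNReal.ofReal_le_ofReal (by linarith)
    by_cases htop : volume ((fun x : ℝ => (x, y)) ⁻¹' K) = ⊤
    · rw [htop]; exact le_top
    calc volume ((fun x : ℝ => (x, y)) ⁻¹' T)
        ≤ volume (Set.Icc 0 (volume ((fun x : ℝ => (x, y)) ⁻¹' K)).toReal) :=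
          measure_mono fun t ht => ⟨(hfib t ht).1,
            (ENNReal.ofReal_le_iff_le_toReal htop).1 (hfib t ht).2⟩
      _ = volume ((fun x : ℝ => (x, y)) ⁻¹' K) := by
          rw [Real.volume_Icc, sub_zero, ENNReal.ofReal_toReal htop]
  rw [hTvol] at hTK
  calc volume S = (n + 1) * (ENNReal.ofReal (1 / (n + 1)) * volume S) := by
        rw [← mul_assoc]
        have : ((n : ENNReal) + 1) = ENNReal.ofReal (n + 1) := by
          rw [ENNReal.ofReal_add (by positivity) zero_le_one, ENNReal.ofReal_natCast,
            ENNReal.ofReal_one]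
        rw [this, ← ENNReal.ofReal_mul (by positivity), mul_one_div_cancel (by positivity),
          ENNReal.ofReal_one, one_mul]
    _ ≤ _ := by gcongr

lemma piFinSuccAbove_zero_apply {n : ℕ} (x : Fin (n + 1) → ℝ) :
    MeasurableEquiv.piFinSuccAbove (fun _ : Fin (n + 1) => ℝ) 0 x = (x 0, fun i => x i.succ) := by
  ext
  · simp
  · simp; rfl

/-- A compact convex set with unit segments in all coordinate directions has volume at least
`1 / n!`. -/
lemma one_le_factorial_mul_volume {n : ℕ} {K : Set (Fin n → ℝ)} (hK : IsCompact K)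
    (hconv : Convex ℝ K) (hne : K.Nonempty) (h : ∀ i, ∃ x ∈ K, x + Pi.single i 1 ∈ K) :
    1 ≤ (n.factorial : ENNReal) * volume K := by
  induction n with
  | zero =>
    have : K = Set.univ := Subsingleton.eq_univ_of_nonempty hne
    simp [this, volume_pi]
  | succ n ih =>
    have hmp := volume_preserving_piFinSuccAbove (fun _ : Fin (n + 1) => ℝ) 0
    set e := MeasurableEquiv.piFinSuccAbove (fun _ : Fin (n + 1) => ℝ) 0 with he
    have hee : ∀ x, e x = (x 0, fun i => x i.succ) := piFinSuccAbove_zero_apply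
    have hvol : volume (e '' K) = volume K := by
      rw [e.image_eq_preimage_symm]
      exact hmp.symm.measure_preimage_equiv K
    let L : (Fin (n + 1) → ℝ) →ₗ[ℝ] ℝ × (Fin n → ℝ) :=
      { toFun := fun x => (x 0, fun i => x i.succ)
        map_add' := fun _ _ => rfl
        map_smul' := fun _ _ => rfl }
    have hL : e '' K = L '' K := Set.image_congr fun x _ => hee x
    have hLc : Continuous L := L.continuous_of_finiteDimensional
    obtain ⟨x, hx, hx1⟩ := h 0
    have key := volume_snd_image_le (hK.image hLc) (hconv.linear_image L) (a := x 0)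
      (y₀ := fun i => x i.succ) ⟨x, hx, rfl⟩ ⟨_, hx1, by
        ext <;> simp [L]⟩
    have ih' := ih ((hK.image hLc).image continuous_snd)
      ((hconv.linear_image L).linear_image (LinearMap.snd ℝ ℝ (Fin n → ℝ)))
      ((hne.image _).image _) (by
        intro i
        obtain ⟨x, hx, hx1⟩ := h i.succ
        refine ⟨_, ⟨_, ⟨x, hx, rfl⟩, rfl⟩, ⟨_, ⟨_, hx1, rfl⟩, ?_⟩⟩
        ext j
        simp [L, Pi.single_apply])
    rw [← hL, hvol, hL] at key
    calc (1 : ENNReal) ≤ n.factorial * volume (Prod.snd '' (L '' K)) := ih'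
      _ ≤ n.factorial * ((n + 1) * volume K) := by gcongr
      _ = _ := by rw [Nat.factorial_succ]; push_cast; ring

/-- The linear map sending x, y, z to the coordinate vectors reduces this to unit segments in the
coordinate directions. -/
theorem abs_det_le_six_mul_volume {K : Set (Fin 3 → ℝ)} (hK : IsCompact K) (hconv : Convex ℝ K)
    {x y z : Fin 3 → ℝ} (hx : x ∈ K - K) (hy : y ∈ K - K) (hz : z ∈ K - K) :
    ENNReal.ofReal |(Matrix.of ![x, y, z]).det| ≤ 6 * volume K := by
  set M : Matrix (Fin 3) (Fin 3) ℝ := (Matrix.of ![x, y, z]).transpose with hM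
  have hdetM : M.det = (Matrix.of ![x, y, z]).det := Matrix.det_transpose _
  rw [← hdetM]
  by_cases h0 : M.det = 0
  · simp [h0]
  have hu : IsUnit M.det := isUnit_iff_ne_zero.2 h0
  have hcols : ∀ i, ∃ v ∈ K, v + M.mulVec (Pi.single i 1) ∈ K := by
    intro i
    rw [Matrix.mulVec_single_one]
    obtain ⟨v, hv, w, hw, hvw⟩ : (![x, y, z] : Fin 3 → Fin 3 → ℝ) i ∈ K - K := by
      fin_cases i <;> assumption
    refine ⟨w, hw, ?_⟩
    have : M.col i = v - w := by
      simp only at hvw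
      rw [hvw]; rfl
    rw [this]
    simpa using hv
  have hc : Continuous (Matrix.toLin' M⁻¹) :=
    LinearMap.continuous_of_finiteDimensional _
  have key := one_le_factorial_mul_volume (hK.image hc) (hconv.linear_image _)
    (by obtain ⟨v, hv, _⟩ := hcols 0; exact ⟨_, v, hv, rfl⟩) (by
      intro i
      obtain ⟨v, hv, hv1⟩ := hcols i
      refine ⟨_, ⟨v, hv, rfl⟩, ⟨_, hv1, ?_⟩⟩
      rw [map_add]
      congr 1
      rw [Matrix.toLin'_apply, Matrix.mulVec_mulVec, Matrix.nonsing_inv_mul _ hu,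
        Matrix.one_mulVec])
  rw [Measure.addHaar_image_linearMap, LinearMap.det_toLin', Matrix.det_nonsing_inv,
    Ring.inverse_eq_inv', abs_inv] at key
  have hp : 0 < |M.det| := abs_pos.2 h0
  calc ENNReal.ofReal |M.det| = ENNReal.ofReal |M.det| * 1 := (mul_one _).symm
    _ ≤ ENNReal.ofReal |M.det| * ((Nat.factorial 3 : ℕ) *
        (ENNReal.ofReal |M.det|⁻¹ * volume K)) := by gcongr
    _ = 6 * (ENNReal.ofReal |M.det| * ENNReal.ofReal |M.det|⁻¹) * volume K := by
        simp only [Nat.factorial]; push_cast; ring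
    _ = _ := by
        rw [← ENNReal.ofReal_mul hp.le, mul_inv_cancel₀ hp.ne', ENNReal.ofReal_one, mul_one]

/-- The standard simplex with vertices `0` and the coordinate vectors. -/
def cornerSimplex (n : ℕ) : Set (Fin n → ℝ) := {x | (∀ i, 0 ≤ x i) ∧ ∑ i, x i ≤ 1}

lemma isClosed_cornerSimplex (n : ℕ) : IsClosed (cornerSimplex n) := by
  refine IsClosed.inter (s₁ := {x : Fin n → ℝ | ∀ i, 0 ≤ x i})
    (s₂ := {x : Fin n → ℝ | ∑ i, x i ≤ 1}) ?_ ?_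
  · simp only [Set.ofPred_forall]
    exact isClosed_iInter fun i => isClosed_le continuous_const (continuous_apply i)
  · exact isClosed_le (by fun_prop) continuous_const

/-- The slice at height t is contained in the corner simplex of one dimension less scaled by 1 - t.
Only this upper bound matters. -/
lemma factorial_mul_volume_cornerSimplex (n : ℕ) :
    (n.factorial : ENNReal) * volume (cornerSimplex n) ≤ 1 := by
  induction n with
  | zero =>
    have : volume (cornerSimplex 0) ≤ 1 := 
      (measure_mono (Set.subset_univ _)).trans (by simp [volume_pi])
    simpa using this
  | succ n ih =>
    have hmp := volume_preserving_piFinSuccAbove (fun _ : Fin (n + 1) => ℝ) 0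
    set e := MeasurableEquiv.piFinSuccAbove (fun _ : Fin (n + 1) => ℝ) 0 with he
    have hee : ∀ t y, e.symm (t, y) = Fin.cons t y := fun t y => by
      rw [MeasurableEquiv.symm_apply_eq, he, piFinSuccAbove_zero_apply]
      rfl
    have hm : MeasurableSet (e.symm ⁻¹' cornerSimplex (n + 1)) :=
      e.symm.measurable (isClosed_cornerSimplex _).measurableSet
    have hvol : volume (cornerSimplex (n + 1)) = volume (e.symm ⁻¹' cornerSimplex (n + 1)) :=
      (hmp.symm.measure_preimage_equiv _).symm
    have hle : volume (e.symm ⁻¹' cornerSimplex (n + 1))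
        ≤ ENNReal.ofReal (1 / (n + 1)) * volume (cornerSimplex n) := by
      rw [Measure.volume_eq_prod, Measure.prod_apply hm, ← lintegral_one_sub_pow,
        ← lintegral_mul_const _ (by fun_prop), ← lintegral_indicator measurableSet_Icc]
      refine lintegral_mono fun t => ?_
      have hfib : ∀ y, e.symm (t, y) ∈ cornerSimplex (n + 1) →
          0 ≤ t ∧ (∀ i, 0 ≤ y i) ∧ ∑ i, y i ≤ 1 - t := by
        intro y hy
        rw [hee] at hy
        obtain ⟨h1, h2⟩ := hy
        rw [Fin.sum_univ_succ] at h2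
        simp only [Fin.cons_zero, Fin.cons_succ] at h2
        exact ⟨h1 0, fun i => h1 i.succ, by linarith⟩
      by_cases ht : t ∈ Set.Icc (0 : ℝ) 1
      · rw [Set.indicator_of_mem ht]
        have hsub : Prod.mk t ⁻¹' (e.symm ⁻¹' cornerSimplex (n + 1)) ⊆
            AffineMap.homothety (0 : Fin n → ℝ) (1 - t) '' cornerSimplex n := by
          intro y hy
          obtain ⟨-, hy1, hy2⟩ := hfib y hy
          simp only [Set.mem_image, AffineMap.homothety_apply, vsub_eq_sub, vadd_eq_add, sub_zero,
            add_zero]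
          rcases ht.2.eq_or_lt with h | h
          · refine ⟨0, ⟨fun i => le_rfl, by simp⟩, ?_⟩
            rw [h, sub_self] at hy2
            have := (Finset.sum_eq_zero_iff_of_nonneg fun i _ => hy1 i).1
              (le_antisymm hy2 (Finset.sum_nonneg fun i _ => hy1 i))
            ext i
            simp [this i (Finset.mem_univ i)]
          · have h' : 0 < 1 - t := by linarith
            refine ⟨(1 - t)⁻¹ • y, ⟨fun i => ?_, ?_⟩, ?_⟩
            · exact mul_nonneg (inv_nonneg.2 h'.le) (hy1 i)
            · simp only [Pi.smul_apply, smul_eq_mul]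
              rw [← Finset.mul_sum, inv_mul_le_iff₀ h', mul_one]
              exact hy2
            · rw [smul_smul, mul_inv_cancel₀ h'.ne', one_smul]
        refine (measure_mono hsub).trans_eq ?_
        rw [Measure.addHaar_image_homothety, Module.finrank_fin_fun,
          abs_of_nonneg (pow_nonneg (by linarith [ht.2]) n)]
      · rw [Set.indicator_of_notMem ht]
        have : Prod.mk t ⁻¹' (e.symm ⁻¹' cornerSimplex (n + 1)) = ∅ := by
          refine Set.eq_empty_of_forall_notMem fun y hy => ht ?_
          obtain ⟨h0, hy1, hy2⟩ := hfib y hy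
          have := Finset.sum_nonneg fun i (_ : i ∈ Finset.univ) => hy1 i
          exact ⟨h0, by linarith⟩
        rw [this, measure_empty]
    rw [hvol]
    calc ((n + 1).factorial : ENNReal) * volume (e.symm ⁻¹' cornerSimplex (n + 1))
        ≤ (n + 1).factorial * (ENNReal.ofReal (1 / (n + 1)) * volume (cornerSimplex n)) := by
          gcongr
      _ = (ENNReal.ofReal (n + 1) * ENNReal.ofReal (1 / (n + 1))) *
          (n.factorial * volume (cornerSimplex n)) := by
          rw [ENNReal.ofReal_add (by positivity) zero_le_one, ENNReal.ofReal_natCast,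
            ENNReal.ofReal_one, Nat.factorial_succ]
          push_cast
          ring
      _ ≤ 1 := by
          rw [← ENNReal.ofReal_mul (by positivity), mul_one_div_cancel (by positivity),
            ENNReal.ofReal_one, one_mul]
          exact ih

/-! ### The lower bound, first for smooth difference bodies -/

lemma matrix_det_transpose_mulVec (A : Matrix (Fin 3) (Fin 3) ℝ) (x y z : Fin 3 → ℝ) :
    (Matrix.of ![A.transpose.mulVec x, A.transpose.mulVec y, A.transpose.mulVec z]).det
      = A.det * (Matrix.of ![x, y, z]).det := by
  have : Matrix.of ![A.transpose.mulVec x, A.transpose.mulVec y, A.transpose.mulVec z]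
      = Matrix.of ![x, y, z] * A := by
    ext i j
    rw [Matrix.mul_apply]
    fin_cases i <;> simp [Matrix.mulVec, dotProduct, mul_comm]
  rw [this, Matrix.det_mul, mul_comm]

lemma transpose_mulVec_dotProduct (A : Matrix (Fin 3) (Fin 3) ℝ) (d x : Fin 3 → ℝ) :
    A.transpose.mulVec d ⬝ᵥ x = d ⬝ᵥ A.mulVec x := by
  rw [Matrix.mulVec_transpose, ← Matrix.dotProduct_mulVec]

/-- The volume bound for a convex body whose difference body is smooth. -/
lemma one_div_twelve_le_of_smooth {K : Set (Fin 3 → ℝ)} (hK : IsCompact K) (hconv : Convex ℝ K)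
    {c : ℝ} (hc : 0 < c) (hball : ∀ x : Fin 3 → ℝ, (∀ i, |x i| ≤ c) → x ∈ K - K)
    (hsm : ∀ d ∈ K - K, ∀ x y : Fin 3 → ℝ, (∀ d' ∈ K - K, d' ⬝ᵥ x ≤ d ⬝ᵥ x) →
      (∀ d' ∈ K - K, d' ⬝ᵥ y ≤ d ⬝ᵥ y) → SameRay ℝ x y)
    {B : Matrix (Fin 3) (Fin 3) ℝ} (hB : Admissible (K - K) B) (hBdet : B.det ≠ 0) :
    ENNReal.ofReal (1 / 12) ≤ volume K * ENNReal.ofReal |B.det| := by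
  have hDc : IsCompact (K - K) := by
    rw [sub_eq_add_neg]
    exact hK.add hK.neg
  obtain ⟨A, hA, hdet, hmin⟩ := exists_admissible_abs_det_le hDc hc hball
  have hu : IsUnit A.det := isUnit_iff_ne_zero.2 hdet
  have hAc : Continuous (Matrix.toLin' A.transpose) := LinearMap.continuous_of_finiteDimensional _
  -- In the coordinates of a minimal A the admissible lattice becomes ℤ³, and minimality of A
  -- becomes minimality of the identity matrix.
  set D := Matrix.toLin' A.transpose '' (K - K) with hD
  have hdot : ∀ d x, Matrix.toLin' A.transpose d ⬝ᵥ x = d ⬝ᵥ A.mulVec x := fun d x => by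
    rw [Matrix.toLin'_apply, transpose_mulVec_dotProduct]
  have hDs : IsSmoothWide D :=
    { compact := hDc.image hAc
      convex := (hconv.sub hconv).linear_image _
      neg_mem := by
        rintro _ ⟨_, ⟨x, hx, y, hy, rfl⟩, rfl⟩
        exact ⟨y - x, ⟨y, hy, x, hx, rfl⟩, by rw [← map_neg, neg_sub]⟩
      wide := by
        intro z hz
        obtain ⟨d, hd, h⟩ := hA z hz
        exact ⟨_, ⟨d, hd, rfl⟩, by rw [hdot]; exact h⟩
      smooth := by
        rintro _ ⟨d, hd, rfl⟩ x y hx hy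
        have h := hsm d hd (A.mulVec x) (A.mulVec y)
          (fun d' hd' => by rw [← hdot, ← hdot]; exact hx _ ⟨d', hd', rfl⟩)
          (fun d' hd' => by rw [← hdot, ← hdot]; exact hy _ ⟨d', hd', rfl⟩)
        have h' := h.map (Matrix.toLin' A⁻¹)
        simpa [Matrix.mulVec_mulVec, Matrix.nonsing_inv_mul _ hu] using h' }
  obtain ⟨c', hc', hball'⟩ : ∃ c' : ℝ, 0 < c' ∧ ∀ x : Fin 3 → ℝ, (∀ i, |x i| ≤ c') → x ∈ D := by
    obtain ⟨M, hM0, hM⟩ := (LinearMap.toContinuousLinearMap (Matrix.toLin' A.transpose⁻¹)).bound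
    refine ⟨c / M, by positivity, fun x hx => ⟨A.transpose⁻¹.mulVec x, hball _ fun i => ?_, ?_⟩⟩
    · have h1 : ‖x‖ ≤ c / M := (pi_norm_le_iff_of_nonneg (by positivity)).2 hx
      have h2 := hM x
      simp only [LinearMap.coe_toContinuousLinearMap', Matrix.toLin'_apply] at h2
      refine ((norm_le_pi_norm (A.transpose⁻¹.mulVec x) i).trans h2).trans ?_
      calc M * ‖x‖ ≤ M * (c / M) := by gcongr
        _ = c := by field_simp
    · rw [Matrix.toLin'_apply, Matrix.mulVec_mulVec, Matrix.mul_nonsing_inv, Matrix.one_mulVec]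
      rwa [Matrix.det_transpose]
  obtain ⟨_, ⟨x, hx, rfl⟩, _, ⟨y, hy, rfl⟩, _, ⟨z, hz, rfl⟩, h⟩ :=
    hDs.exists_half_le_abs_det hc' hball' (by
      intro X hX hXa
      have h1 := hmin (A * X) (by
        intro z hz
        obtain ⟨_, ⟨d, hd, rfl⟩, h⟩ := hXa z hz
        exact ⟨d, hd, by rw [← Matrix.mulVec_mulVec, ← hdot]; exact h⟩)
        (by rw [Matrix.det_mul]; exact mul_ne_zero hdet hX)
      rw [Matrix.det_mul, abs_mul] at h1
      have := abs_pos.2 hdet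
      by_contra! hlt
      nlinarith)
  simp only [Matrix.toLin'_apply] at h
  rw [matrix_det_transpose_mulVec, abs_mul] at h
  have hvol := abs_det_le_six_mul_volume hK hconv hx hy hz
  have hle := hmin B hB hBdet
  have e : (1 : ℝ) / 12 ≤ |B.det| * |(Matrix.of ![x, y, z]).det| / 6 := by
    have := mul_le_mul_of_nonneg_right hle (abs_nonneg (Matrix.of ![x, y, z]).det)
    linarith
  calc ENNReal.ofReal (1 / 12)
      ≤ ENNReal.ofReal (|B.det| * |(Matrix.of ![x, y, z]).det| / 6) := ENNReal.ofReal_le_ofReal e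
    _ = ENNReal.ofReal |(Matrix.of ![x, y, z]).det| / 6 * ENNReal.ofReal |B.det| := by
        rw [ENNReal.ofReal_div_of_pos (by norm_num), ENNReal.ofReal_mul (abs_nonneg _)]
        rw [ENNReal.ofReal_ofNat]
        rw [ENNReal.div_eq_inv_mul, ENNReal.div_eq_inv_mul]
        ring
    _ ≤ volume K * ENNReal.ofReal |B.det| := by
        gcongr
        exact ENNReal.div_le_of_le_mul' hvol

/-- The closed Euclidean unit ball. -/
def euclideanBall : Set (Fin 3 → ℝ) := {x | x ⬝ᵥ x ≤ 1}

lemma convex_euclideanBall : Convex ℝ euclideanBall := by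
  intro x hx y hy a b ha hb hab
  have h := dotProduct_self_star_nonneg (x - y)
  simp only [star_trivial] at h
  simp only [euclideanBall, Set.mem_ofPred_eq] at hx hy ⊢
  have e : (a • x + b • y) ⬝ᵥ (a • x + b • y)
      = (a + b) * (a * (x ⬝ᵥ x) + b * (y ⬝ᵥ y)) - a * b * ((x - y) ⬝ᵥ (x - y)) := by
    simp only [add_dotProduct, dotProduct_add, sub_dotProduct, dotProduct_sub, smul_dotProduct,
      dotProduct_smul, smul_eq_mul, dotProduct_comm y x]
    ring
  rw [e, hab]
  have := mul_nonneg (mul_nonneg ha hb) h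
  nlinarith

lemma abs_le_one_of_mem_euclideanBall {x : Fin 3 → ℝ} (hx : x ∈ euclideanBall) (i : Fin 3) :
    |x i| ≤ 1 := by
  have h1 : x i * x i ≤ x ⬝ᵥ x :=
    Finset.single_le_sum (f := fun i => x i * x i) (fun i _ => mul_self_nonneg (x i))
      (Finset.mem_univ i)
  have h2 : x ⬝ᵥ x ≤ 1 := hx
  rw [← sq_le_one_iff_abs_le_one]
  nlinarith

lemma isCompact_euclideanBall : IsCompact euclideanBall := by
  have hK : IsCompact (Set.Icc (fun _ => -1 : Fin 3 → ℝ) (fun _ => 1)) := isCompact_Icc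
  refine hK.of_isClosed_subset ?_ fun x hx => ⟨fun i => ?_, fun i => ?_⟩
  · refine isClosed_le ?_ continuous_const
    simp only [dotProduct]
    fun_prop
  · exact (abs_le.1 (abs_le_one_of_mem_euclideanBall hx i)).1
  · exact (abs_le.1 (abs_le_one_of_mem_euclideanBall hx i)).2

/-- The equality case of Cauchy–Schwarz: the normal cone of the ball at b lies on the ray of b. -/
lemma eq_smul_of_forall_dotProduct_le {b x : Fin 3 → ℝ} (hb : b ∈ euclideanBall)
    (h : ∀ b' ∈ euclideanBall, b' ⬝ᵥ x ≤ b ⬝ᵥ x) : ∃ n : ℝ, 0 ≤ n ∧ x = n • b := by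
  have hx0 : 0 ≤ x ⬝ᵥ x := by simpa using dotProduct_self_star_nonneg x
  obtain ⟨n, hn, hnn⟩ : ∃ n : ℝ, 0 ≤ n ∧ n * n = x ⬝ᵥ x :=
    ⟨√(x ⬝ᵥ x), Real.sqrt_nonneg _, Real.mul_self_sqrt hx0⟩
  refine ⟨n, hn, ?_⟩
  rcases hn.eq_or_lt with h0 | h0
  · rw [← h0, mul_zero] at hnn
    rw [← h0, zero_smul]
    exact dotProduct_self_eq_zero.1 hnn.symm
  · have h1 := h (n⁻¹ • x) (by
      simp only [euclideanBall, Set.mem_ofPred_eq, smul_dotProduct, dotProduct_smul, smul_eq_mul]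
      rw [← hnn]; field_simp; exact le_rfl)
    rw [smul_dotProduct, smul_eq_mul, ← hnn, inv_mul_cancel_left₀ h0.ne'] at h1
    have h2 : b ⬝ᵥ b ≤ 1 := hb
    have h3 : (x - n • b) ⬝ᵥ (x - n • b) = n * n - 2 * n * (b ⬝ᵥ x) + n * n * (b ⬝ᵥ b) := by
      simp only [sub_dotProduct, dotProduct_sub, smul_dotProduct, dotProduct_smul, smul_eq_mul,
        dotProduct_comm x b, ← hnn]
      ring
    have h4 : (x - n • b) ⬝ᵥ (x - n • b) ≤ 0 := by
      rw [h3]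
      have := mul_le_mul_of_nonneg_left h1 hn
      have := mul_le_mul_of_nonneg_left h2 (mul_nonneg hn hn)
      linarith
    have h5 : 0 ≤ (x - n • b) ⬝ᵥ (x - n • b) := by
      simpa using dotProduct_self_star_nonneg (x - n • b)
    exact sub_eq_zero.1 (dotProduct_self_eq_zero.1 (le_antisymm h4 h5))

/-- A normal of the difference body of K + εB at k + εb - w is also normal to B at b, hence a
multiple of b; so the body is smooth. It remains admissible, and its volume tends to that of K as ε
→ 0. -/
theorem one_div_twelve_le_volume_mul {K : Set (Fin 3 → ℝ)} (hK : IsCompact K)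
    (hconv : Convex ℝ K) (hne : K.Nonempty)
    {A : Matrix (Fin 3) (Fin 3) ℝ} (hA : Admissible (K - K) A) (hdet : A.det ≠ 0) :
    ENNReal.ofReal (1 / 12) ≤ volume K * ENNReal.ofReal |A.det| := by
  have hzero : (0 : Fin 3 → ℝ) ∈ euclideanBall := by simp [euclideanBall]
  have hε : ∀ ε : ℝ, 0 < ε → ENNReal.ofReal (1 / 12) ≤
      volume (Metric.cthickening ε K) * ENNReal.ofReal |A.det| := by
    intro ε hε
    have hsub : K + ε • euclideanBall ⊆ Metric.cthickening ε K := by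
      rintro _ ⟨k, hk, _, ⟨b, hb, rfl⟩, rfl⟩
      refine Metric.mem_cthickening_of_dist_le _ k ε K hk ?_
      simp only [dist_eq_norm, add_sub_cancel_left, norm_smul, Real.norm_of_nonneg hε.le]
      refine mul_le_of_le_one_right hε.le ((pi_norm_le_iff_of_nonneg zero_le_one).2 fun i => ?_)
      exact abs_le_one_of_mem_euclideanBall hb i
    -- The cube of half-width ε/2 lies in the Euclidean ball of radius ε, as √3/2 < 1.
    have key := one_div_twelve_le_of_smooth (K := K + ε • euclideanBall) (c := ε / 2)
      (hK.add (isCompact_euclideanBall.smul ε)) (hconv.add (convex_euclideanBall.smul ε))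
      (by positivity) ?_ ?_ (B := A) ?_ hdet
    · refine key.trans ?_
      gcongr
    · intro x hx
      obtain ⟨k, hk⟩ := hne
      refine ⟨k + ε • (ε⁻¹ • x), ⟨k, hk, _, ⟨ε⁻¹ • x, ?_, rfl⟩, rfl⟩, k + ε • 0,
        ⟨k, hk, _, ⟨0, hzero, rfl⟩, rfl⟩, ?_⟩
      · simp only [euclideanBall, Set.mem_ofPred_eq, smul_dotProduct, dotProduct_smul, smul_eq_mul]
        have h : ∀ i, x i * x i ≤ ε ^ 2 / 4 := fun i => by
          have := abs_le.1 (hx i); nlinarith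
        have h2 : x ⬝ᵥ x ≤ 3 * (ε ^ 2 / 4) := by
          rw [dotProduct, Fin.sum_univ_three]
          have := h 0; have := h 1; have := h 2; linarith
        rw [← mul_assoc, ← mul_inv, inv_mul_le_iff₀ (by positivity)]
        nlinarith
      · simp [smul_smul, mul_inv_cancel₀ hε.ne']
    · rintro _ ⟨_, ⟨k, hk, _, ⟨b, hb, rfl⟩, rfl⟩, w, hw, rfl⟩ x y hx hy
      have hmax : ∀ x : Fin 3 → ℝ, (∀ d' ∈ K + ε • euclideanBall - (K + ε • euclideanBall),
          d' ⬝ᵥ x ≤ (k + ε • b - w) ⬝ᵥ x) → ∃ n : ℝ, 0 ≤ n ∧ x = n • b := by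
        intro x hx
        refine eq_smul_of_forall_dotProduct_le hb fun b' hb' => ?_
        have := hx (k + ε • b' - w) ⟨_, ⟨k, hk, _, ⟨b', hb', rfl⟩, rfl⟩, w, hw, rfl⟩
        simp only [sub_dotProduct, add_dotProduct, smul_dotProduct, smul_eq_mul] at this
        exact le_of_mul_le_mul_left (by linarith) hε
      obtain ⟨n, hn, rfl⟩ := hmax x hx
      obtain ⟨m, hm, rfl⟩ := hmax y hy
      exact SameRay.nonneg_smul_left (SameRay.nonneg_smul_right (SameRay.refl b) hm) hn
    · intro z hz
      obtain ⟨_, ⟨k, hk, k', hk', rfl⟩, h⟩ := hA z hz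
      exact ⟨_, ⟨k + ε • 0, ⟨k, hk, _, ⟨0, hzero, rfl⟩, rfl⟩, k' + ε • 0,
        ⟨k', hk', _, ⟨0, hzero, rfl⟩, rfl⟩, rfl⟩, by simpa using h⟩
  have hlim := ENNReal.Tendsto.mul_const
    ((tendsto_measure_cthickening_of_isCompact (μ := volume) hK).mono_left
      (nhdsWithin_le_nhds (s := Set.Ioi (0 : ℝ)))) (b := ENNReal.ofReal |A.det|)
    (Or.inr ENNReal.ofReal_ne_top)
  exact ge_of_tendsto hlim (by
    filter_upwards [self_mem_nhdsWithin] with ε h using hε ε h)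

/-! ### Non-separability as a width condition on the dual lattice -/

/-- A matrix computing the coordinates with respect to the basis `b` is the inverse transpose of
the matrix of `b`. -/
lemma abs_det_mul_covolume_span (b : Module.Basis (Fin 3) ℝ (EuclideanSpace ℝ (Fin 3)))
    {A : Matrix (Fin 3) (Fin 3) ℝ} (hA : ∀ x j, b.repr x j = ∑ i, x i * A i j) :
    |A.det| * ZLattice.covolume (Submodule.span ℤ (Set.range b)) volume = 1 := by
  set b₀ := (EuclideanSpace.basisFun (Fin 3) ℝ).toBasis with hb₀
  have h1 : ZLattice.covolume (Submodule.span ℤ (Set.range b)) volume = |b₀.det b| := by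
    rw [ZLattice.covolume_eq_measure_fundamentalDomain _ volume
      (ZSpan.isAddFundamentalDomain b volume), ZSpan.measureReal_fundamentalDomain _ volume b₀,
      measureReal_congr (ZSpan.fundamentalDomain_ae_parallelepiped b₀ volume), measureReal_def,
      hb₀, OrthonormalBasis.coe_toBasis,
      (EuclideanSpace.basisFun (Fin 3) ℝ).volume_parallelepiped]
    simp
  have h2 : A.transpose * b₀.toMatrix b = 1 := by
    ext j k
    rw [Matrix.mul_apply, Matrix.one_apply]
    have := hA (b k) j
    rw [b.repr_self, Finsupp.single_apply] at this
    simp only [hb₀, Matrix.transpose_apply, Module.Basis.toMatrix_apply,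
      OrthonormalBasis.coe_toBasis_repr_apply, EuclideanSpace.basisFun_repr]
    rw [Finset.sum_congr rfl fun i _ => mul_comm (A i j) ((b k) i), ← this]
    simp [eq_comm]
  have h3 := congrArg Matrix.det h2
  rw [Matrix.det_mul, Matrix.det_transpose, Matrix.det_one] at h3
  rw [h1, Module.Basis.det_apply, ← abs_mul, h3, abs_one]

lemma dotProduct_mulVec_eq_sum_repr (b : Module.Basis (Fin 3) ℝ (EuclideanSpace ℝ (Fin 3)))
    {A : Matrix (Fin 3) (Fin 3) ℝ} (hA : ∀ x j, b.repr x j = ∑ i, x i * A i j)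
    (x : EuclideanSpace ℝ (Fin 3)) (z : Fin 3 → ℝ) :
    EuclideanSpace.equiv (Fin 3) ℝ x ⬝ᵥ A.mulVec z = ∑ j, z j * b.repr x j := by
  simp_rw [hA, Finset.mul_sum]
  rw [Finset.sum_comm]
  simp only [dotProduct, Matrix.mulVec, Finset.mul_sum]
  refine Finset.sum_congr rfl fun i _ => Finset.sum_congr rfl fun j _ => ?_
  rw [show EuclideanSpace.equiv (Fin 3) ℝ x i = x i from rfl]
  ring

/-- The columns of A are the dual basis, so φ is integral on the lattice. If K has φ-width below 1,
its translates leave gaps between consecutive levels. -/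
lemma admissible_of_nonSeparable {K : Set (EuclideanSpace ℝ (Fin 3))} (hK : IsCompact K)
    (hne : K.Nonempty) (b : Module.Basis (Fin 3) ℝ (EuclideanSpace ℝ (Fin 3)))
    {A : Matrix (Fin 3) (Fin 3) ℝ} (hA : ∀ x j, b.repr x j = ∑ i, x i * A i j)
    (h : NonSeparable (Submodule.span ℤ (Set.range b)) K) :
    Admissible (EuclideanSpace.equiv (Fin 3) ℝ '' K - EuclideanSpace.equiv (Fin 3) ℝ '' K) A := by
  intro z hz
  set φ : EuclideanSpace ℝ (Fin 3) →ₗ[ℝ] ℝ := ∑ j, (z j : ℝ) • b.coord j with hφ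
  have hφx : ∀ x, φ x = EuclideanSpace.equiv (Fin 3) ℝ x ⬝ᵥ A.mulVec (fun i => (z i : ℝ)) := by
    intro x
    rw [dotProduct_mulVec_eq_sum_repr b hA]
    simp [hφ, LinearMap.sum_apply]
  have hφb : ∀ j, φ (b j) = z j := by
    intro j
    simp [hφ, LinearMap.sum_apply, Finsupp.single_apply]
  have hφ0 : φ ≠ 0 := by
    intro h0
    apply hz
    ext j
    have := hφb j
    rw [h0] at this
    simpa using this.symm
  have hint : ∀ x ∈ Submodule.span ℤ (Set.range b), ∃ n : ℤ, φ x = n := by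
    intro x hx
    induction hx using Submodule.span_induction with
    | mem x hx => obtain ⟨j, rfl⟩ := hx; exact ⟨z j, hφb j⟩
    | zero => exact ⟨0, by simp⟩
    | add x y _ _ hx hy =>
      obtain ⟨n, hn⟩ := hx
      obtain ⟨m, hm⟩ := hy
      exact ⟨n + m, by rw [map_add, hn, hm]; push_cast; ring⟩
    | smul a x _ hx =>
      obtain ⟨n, hn⟩ := hx
      exact ⟨a * n, by rw [map_zsmul, hn]; push_cast; simp⟩
  by_contra! hcon
  have hφc : Continuous φ := φ.continuous_of_finiteDimensional
  obtain ⟨k₁, hk₁, hmin⟩ := hK.exists_isMinOn hne hφc.continuousOn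
  obtain ⟨k₂, hk₂, hmax⟩ := hK.exists_isMaxOn hne hφc.continuousOn
  have hw : φ k₂ - φ k₁ < 1 := by
    have := hcon _ ⟨_, ⟨k₂, hk₂, rfl⟩, _, ⟨k₁, hk₁, rfl⟩, rfl⟩
    simp only [sub_dotProduct] at this
    rw [hφx, hφx]; exact this
  -- The middle of the gap; a translate meeting this plane would have an integer level strictly
  -- between 0 and 1.
  obtain ⟨p, hp⟩ := LinearMap.surjective hφ0 ((φ k₁ + φ k₂) / 2 + 1 / 2)
  obtain ⟨x, hx, y, hy1, hy2⟩ := h (AffineSubspace.mk' p (LinearMap.ker φ))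
    ⟨p, AffineSubspace.self_mem_mk' _ _⟩ (by
      rw [AffineSubspace.direction_mk', Module.Dual.finrank_ker_add_one_of_ne_zero (f := φ) hφ0]
      simp)
  obtain ⟨k, hk, rfl⟩ := hy2
  rw [SetLike.mem_coe, AffineSubspace.mem_mk', LinearMap.mem_ker, vsub_eq_sub, map_sub, hp] at hy1
  simp only [vadd_eq_add, map_add] at hy1
  obtain ⟨n, hn⟩ := hint x hx
  have h1 : φ k₁ ≤ φ k := hmin hk
  have h2 : φ k ≤ φ k₂ := hmax hk
  rw [hn] at hy1
  have h3 : (0 : ℝ) < n := by linarith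
  have h4 : (n : ℝ) < 1 := by linarith
  have h5 : 0 < n := by exact_mod_cast h3
  have h6 : n < 1 := by exact_mod_cast h4
  omega

/-- A plane is a level set of some ψ, and ψ maps the lattice onto a dense or a cyclic subgroup of ℝ.
In the dense case the open image of the interior of K suffices; in the cyclic case ψ is a multiple
of an integral functional, for which K has width at least 1. -/
lemma nonSeparable_of_admissible {K : Set (EuclideanSpace ℝ (Fin 3))} (hconv : Convex ℝ K)
    (hint : (interior K).Nonempty) (b : Module.Basis (Fin 3) ℝ (EuclideanSpace ℝ (Fin 3)))
    {A : Matrix (Fin 3) (Fin 3) ℝ} (hA : ∀ x j, b.repr x j = ∑ i, x i * A i j)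
    (h : Admissible (EuclideanSpace.equiv (Fin 3) ℝ '' K - EuclideanSpace.equiv (Fin 3) ℝ '' K) A) :
    NonSeparable (Submodule.span ℤ (Set.range b)) K := by
  intro H ⟨p, hp⟩ hH
  have hlt : H.direction < ⊤ := by
    refine lt_top_iff_ne_top.2 fun htop => ?_
    rw [htop, finrank_top, finrank_euclideanSpace_fin] at hH
    omega
  obtain ⟨ψ, hψ0, hψ⟩ := Submodule.exists_le_ker_of_lt_top _ hlt
  have hker : H.direction = LinearMap.ker ψ := by
    refine Submodule.eq_of_le_of_finrank_eq hψ ?_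
    have := Module.Dual.finrank_ker_add_one_of_ne_zero (f := ψ) hψ0
    rw [finrank_euclideanSpace_fin] at this
    omega
  have hmem : ∀ q, ψ q = ψ p → q ∈ H := by
    intro q hq
    have : q -ᵥ p ∈ H.direction := by
      rw [hker, LinearMap.mem_ker, vsub_eq_sub, map_sub, hq, sub_self]
    rw [← AffineSubspace.vsub_right_mem_direction_iff_mem hp]
    exact this
  suffices hs : ∃ x ∈ Submodule.span ℤ (Set.range b), ∃ k ∈ K, ψ x + ψ k = ψ p by
    obtain ⟨x, hx, k, hk, hxk⟩ := hs
    exact ⟨x, hx, x + k, hmem _ (by rw [map_add, hxk]), k, hk, rfl⟩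
  set G : AddSubgroup ℝ :=
    (Submodule.span ℤ (Set.range b)).toAddSubgroup.map ψ.toAddMonoidHom with hG
  have hGmem : ∀ g ∈ G, ∃ x ∈ Submodule.span ℤ (Set.range b), ψ x = g := by
    rintro g ⟨x, hx, rfl⟩; exact ⟨x, hx, rfl⟩
  have hbG : ∀ j, ψ (b j) ∈ G := fun j => ⟨b j, Submodule.subset_span ⟨j, rfl⟩, rfl⟩
  rcases G.dense_or_cyclic with hd | ⟨a, ha⟩
  · have hopen : IsOpen (ψ '' interior K) :=
      (ψ.isOpenMap_of_finiteDimensional (LinearMap.surjective hψ0)) _ isOpen_interior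
    have hopen' : IsOpen ((fun t => ψ p - t) ⁻¹' (ψ '' interior K)) :=
      hopen.preimage (by fun_prop)
    obtain ⟨g, hg1, hg2⟩ := hd.exists_mem_open hopen' (by
      obtain ⟨k, hk⟩ := hint
      exact ⟨ψ p - ψ k, k, hk, by ring⟩)
    obtain ⟨x, hx, rfl⟩ := hGmem g hg1
    obtain ⟨k, hk, hkx⟩ := hg2
    exact ⟨x, hx, k, interior_subset hk, by rw [hkx]; ring⟩
  · have hmul : ∀ g ∈ G, ∃ n : ℤ, n * a = g := by
      intro g hg
      rw [ha, AddSubgroup.mem_closure_singleton] at hg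
      obtain ⟨n, hn⟩ := hg
      exact ⟨n, by rw [← hn, zsmul_eq_mul]⟩
    choose z hz using fun j => hmul _ (hbG j)
    have hψz : ∀ x, ψ x = a * ∑ j, (z j : ℝ) * b.repr x j := by
      intro x
      conv_lhs => rw [← b.sum_repr x]
      rw [map_sum, Finset.mul_sum]
      refine Finset.sum_congr rfl fun j _ => ?_
      rw [map_smul, ← hz j, smul_eq_mul]
      ring
    have hz0 : z ≠ 0 := by
      rintro rfl
      apply hψ0
      ext x
      simp [hψz]
    have ha0 : a ≠ 0 := by
      rintro rfl
      apply hψ0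
      ext x
      simp [hψz]
    obtain ⟨_, ⟨_, ⟨k₂, hk₂, rfl⟩, _, ⟨k₁, hk₁, rfl⟩, rfl⟩, hw⟩ := h z hz0
    simp only [sub_dotProduct, dotProduct_mulVec_eq_sum_repr b hA] at hw
    obtain ⟨φ, hφ⟩ : ∃ φ : EuclideanSpace ℝ (Fin 3) → ℝ,
      ∀ x, φ x = ∑ j, (z j : ℝ) * b.repr x j := ⟨_, fun _ => rfl⟩
    simp only [← hφ] at hw hψz
    -- After the shift by n the required level exceeds φ k₁ by less than 1, so it lies between φ k₁
    -- and φ k₂.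
    obtain ⟨n, hn⟩ : ∃ n : ℤ, n = ⌊ψ p / a - φ k₁⌋ := ⟨_, rfl⟩
    have hn1 : (n : ℝ) ≤ ψ p / a - φ k₁ := by rw [hn]; exact Int.floor_le _
    have hn2 : ψ p / a - φ k₁ < n + 1 := by rw [hn]; exact Int.lt_floor_add_one _
    obtain ⟨x, hx, hxn⟩ := hGmem (n * a) (by
      rw [ha, AddSubgroup.mem_closure_singleton]
      exact ⟨n, by rw [zsmul_eq_mul]⟩)
    -- a point of the segment from `k₁` to `k₂`
    have hpos : 0 < φ k₂ - φ k₁ := by linarith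
    obtain ⟨s, hs⟩ : ∃ s, s = (ψ p / a - n - φ k₁) / (φ k₂ - φ k₁) := ⟨_, rfl⟩
    have hs0 : 0 ≤ s := by rw [hs]; exact div_nonneg (by linarith) hpos.le
    have hs1 : s ≤ 1 := by rw [hs, div_le_one hpos]; linarith
    refine ⟨x, hx, (1 - s) • k₁ + s • k₂, hconv hk₁ hk₂ (by linarith) hs0 (by ring), ?_⟩
    rw [hxn, map_add, map_smul, map_smul, hψz k₁, hψz k₂, smul_eq_mul, smul_eq_mul]
    have : s * (φ k₂ - φ k₁) = ψ p / a - n - φ k₁ := by rw [hs]; field_simp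
    have h2 : ψ p = a * (ψ p / a) := by field_simp
    rw [h2]
    linear_combination a * this

lemma exists_matrix_repr (b : Module.Basis (Fin 3) ℝ (EuclideanSpace ℝ (Fin 3))) :
    ∃ A : Matrix (Fin 3) (Fin 3) ℝ, ∀ x j, b.repr x j = ∑ i, x i * A i j := by
  refine ⟨Matrix.of fun i j => b.repr (EuclideanSpace.single i 1) j, fun x j => ?_⟩
  have hx : x = ∑ i, x i • (EuclideanSpace.single i 1 : EuclideanSpace ℝ (Fin 3)) := by
    ext k
    simp [Finset.sum_apply, Pi.single_apply]
  conv_lhs => rw [hx]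
  simp

lemma exists_basis_repr {A : Matrix (Fin 3) (Fin 3) ℝ} (hA : A.det ≠ 0) :
    ∃ b : Module.Basis (Fin 3) ℝ (EuclideanSpace ℝ (Fin 3)),
      ∀ x j, b.repr x j = ∑ i, x i * A i j := by
  have hu : IsUnit A.transpose.det := by
    rw [Matrix.det_transpose]; exact isUnit_iff_ne_zero.2 hA
  refine ⟨Module.Basis.ofEquivFun ((EuclideanSpace.equiv (Fin 3) ℝ).toLinearEquiv.trans
    (Matrix.toLinearEquiv' A.transpose (Matrix.invertibleOfIsUnitDet _ hu))), fun x j => ?_⟩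
  rw [Module.Basis.ofEquivFun_repr_apply]
  change Matrix.toLin' A.transpose (EuclideanSpace.equiv (Fin 3) ℝ x) j = _
  rw [Matrix.toLin'_apply, Matrix.mulVec, dotProduct]
  exact Finset.sum_congr rfl fun i _ => mul_comm (A i j) (x i)

lemma mem_nonSeparableDensities_iff {K : Set (EuclideanSpace ℝ (Fin 3))} (hK : IsCompact K)
    (hconv : Convex ℝ K) (hint : (interior K).Nonempty) {δ : ℝ} :
    δ ∈ nonSeparableDensities K ↔ ∃ A : Matrix (Fin 3) (Fin 3) ℝ,
      Admissible (EuclideanSpace.equiv (Fin 3) ℝ '' K - EuclideanSpace.equiv (Fin 3) ℝ '' K) A ∧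
      A.det ≠ 0 ∧ δ = volume.real K * |A.det| := by
  constructor
  · rintro ⟨L, _, _, hL, rfl⟩
    have hrank : Module.finrank ℤ L = Fintype.card (Fin 3) := by
      rw [ZLattice.rank ℝ L, finrank_euclideanSpace_fin, Fintype.card_fin]
    have : Module.Finite ℤ L := ZLattice.module_finite ℝ L
    have : Module.Free ℤ L := ZLattice.module_free ℝ L
    set b := (Module.finBasisOfFinrankEq ℤ L (by simpa using hrank)).ofZLatticeBasis ℝ L with hb
    have hbL : Submodule.span ℤ (Set.range b) = L := Module.Basis.ofZLatticeBasis_span ℝ L _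
    obtain ⟨A, hA⟩ := exists_matrix_repr b
    have hcov := abs_det_mul_covolume_span b hA
    have hne : K.Nonempty := hint.mono interior_subset
    refine ⟨A, admissible_of_nonSeparable hK hne b hA (by rw [hbL]; exact hL), ?_, ?_⟩
    · intro h0; rw [h0] at hcov; simp at hcov
    · simp only [hbL] at hcov
      have hpos := ZLattice.covolume_pos L volume
      rw [latticeDensity, div_eq_iff hpos.ne', mul_assoc, hcov, mul_one]
  · rintro ⟨A, hA, hdet, rfl⟩
    obtain ⟨b, hb⟩ := exists_basis_repr hdet
    refine ⟨Submodule.span ℤ (Set.range b), inferInstance, inferInstance,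
      nonSeparable_of_admissible hconv hint b hb hA, ?_⟩
    have hcov := abs_det_mul_covolume_span b hb
    have hpos := ZLattice.covolume_pos (Submodule.span ℤ (Set.range b)) volume
    rw [latticeDensity, eq_div_iff hpos.ne', mul_assoc, hcov, mul_one]

lemma volume_image_equiv (K : Set (EuclideanSpace ℝ (Fin 3))) :
    volume (EuclideanSpace.equiv (Fin 3) ℝ '' K) = volume K := by
  have h := (PiLp.volume_preserving_toLp (Fin 3)).measure_preimage_equiv
    (f := (MeasurableEquiv.toLp 2 (Fin 3 → ℝ))) K
  rw [← h]
  congr 1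
  ext x
  constructor
  · rintro ⟨k, hk, rfl⟩; exact hk
  · intro hx; exact ⟨_, hx, rfl⟩

lemma exists_ball_subset_sub {K : Set (Fin 3 → ℝ)} (hK : (interior K).Nonempty) :
    ∃ c : ℝ, 0 < c ∧ ∀ x : Fin 3 → ℝ, (∀ i, |x i| ≤ c) → x ∈ K - K := by
  obtain ⟨k, hk⟩ := hK
  obtain ⟨r, hr, hball⟩ := Metric.isOpen_iff.1 isOpen_interior k hk
  refine ⟨r / 2, by positivity, fun x hx => ⟨k + x, interior_subset (hball ?_), k,
    interior_subset hk, by simp⟩⟩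
  rw [Metric.mem_ball, dist_eq_norm, add_sub_cancel_left]
  exact lt_of_le_of_lt ((pi_norm_le_iff_of_nonneg (by positivity)).2 hx) (by linarith)

/-! ### Simplices attain 1/12 -/

lemma volume_convexHull_simplex_le (v : Fin 4 → Fin 3 → ℝ) {M : Matrix (Fin 3) (Fin 3) ℝ}
    (hM : ∀ i k, M k i = v i.succ k - v 0 k) :
    volume (convexHull ℝ (Set.range v)) ≤ ENNReal.ofReal (|M.det| / 6) := by
  have hsub : convexHull ℝ (Set.range v) ⊆ v 0 +ᵥ (Matrix.toLin' M '' cornerSimplex 3) := by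
    refine convexHull_min ?_ (Convex.vadd (Convex.linear_image ?_ _) _)
    · rintro _ ⟨j, rfl⟩
      refine Fin.cases ?_ (fun i => ?_) j
      · exact ⟨_, ⟨0, ⟨fun i => le_rfl, by simp⟩, rfl⟩, by simp⟩
      · refine ⟨_, ⟨Pi.single i 1, ⟨fun l => ?_, by simp⟩, rfl⟩, ?_⟩
        · rcases eq_or_ne l i with rfl | h
          · simp
          · simp [h]
        · ext k
          simp [hM]
    · intro x hx y hy a b ha hb hab
      refine ⟨fun i => add_nonneg (mul_nonneg ha (hx.1 i)) (mul_nonneg hb (hy.1 i)), ?_⟩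
      have h1 := mul_le_mul_of_nonneg_left hx.2 ha
      have h2 := mul_le_mul_of_nonneg_left hy.2 hb
      simp only [Pi.add_apply, Pi.smul_apply, smul_eq_mul, Finset.sum_add_distrib,
        ← Finset.mul_sum]
      linarith
  have hcorner := factorial_mul_volume_cornerSimplex 3
  have h6 : volume (cornerSimplex 3) ≤ 1 / 6 := by
    rw [ENNReal.le_div_iff_mul_le (by simp) (by simp), mul_comm]
    simpa [Nat.factorial] using hcorner
  refine (measure_mono hsub).trans ?_
  rw [measure_vadd, Measure.addHaar_image_linearMap, LinearMap.det_toLin']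
  calc ENNReal.ofReal |M.det| * volume (cornerSimplex 3) ≤ ENNReal.ofReal |M.det| * (1 / 6) := by
        gcongr
    _ = ENNReal.ofReal (|M.det| / 6) := by
        rw [ENNReal.ofReal_div_of_pos (by norm_num), ENNReal.ofReal_ofNat, mul_one_div]

/-- The width of a simplex with vertices `v` in the direction of the vector with integer
coordinates `z` in this basis is at least `1`. -/
lemma admissible_simplex (v : Fin 4 → Fin 3 → ℝ) {A : Matrix (Fin 3) (Fin 3) ℝ}
    (hA : ∀ i (z : Fin 3 → ℝ), (v i.succ - v 0) ⬝ᵥ A.mulVec z = (z i + ∑ j, z j) / 2) :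
    Admissible (convexHull ℝ (Set.range v) - convexHull ℝ (Set.range v)) A := by
  intro z hz
  -- Extending z to an integer vector of sum zero makes the vertex values `w i / 2` up to a common
  -- constant. A nonzero such vector has an entry at least 1 and one at most -1.
  obtain ⟨w, hw⟩ : ∃ w : Fin 4 → ℤ, w = Fin.cons (-∑ j, z j) z := ⟨_, rfl⟩
  have hsum : ∑ i, w i = 0 := by
    rw [hw, Fin.sum_univ_succ]; simp
  have hv : ∀ i, v i ⬝ᵥ A.mulVec (fun j => (z j : ℝ))
      = v 0 ⬝ᵥ A.mulVec (fun j => (z j : ℝ)) + ((w i : ℝ) - w 0) / 2 := by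
    intro i
    refine Fin.cases (by simp) (fun i => ?_) i
    have := hA i (fun j => (z j : ℝ))
    rw [sub_dotProduct] at this
    have h2 : (w i.succ : ℝ) - w 0 = z i + ∑ j, (z j : ℝ) := by
      rw [hw]; simp
    rw [h2]
    linarith
  have hmem : ∀ i, v i ∈ convexHull ℝ (Set.range v) := fun i => subset_convexHull ℝ _ ⟨i, rfl⟩
  obtain ⟨i, hi⟩ : ∃ i, 0 < w i := by
    by_contra! hcon
    have := (Finset.sum_eq_zero_iff_of_nonpos fun i _ => hcon i).1 hsum
    apply hz
    ext j
    have := this j.succ (Finset.mem_univ _)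
    rw [hw] at this
    simpa using this
  obtain ⟨j, hj⟩ : ∃ j, w j < 0 := by
    by_contra! hcon
    have := (Finset.sum_eq_zero_iff_of_nonneg fun i _ => hcon i).1 hsum i (Finset.mem_univ _)
    omega
  refine ⟨v i - v j, ⟨_, hmem i, _, hmem j, rfl⟩, ?_⟩
  rw [sub_dotProduct, hv i, hv j]
  have h1 : (1 : ℝ) ≤ w i := by exact_mod_cast hi
  have h2 : (w j : ℝ) ≤ -1 := by
    have : w j ≤ -1 := by omega
    exact_mod_cast this
  linarith

lemma exists_admissible_simplex (v : Fin 4 → Fin 3 → ℝ)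
    (hint : (interior (convexHull ℝ (Set.range v))).Nonempty) :
    ∃ A : Matrix (Fin 3) (Fin 3) ℝ, A.det ≠ 0 ∧
      Admissible (convexHull ℝ (Set.range v) - convexHull ℝ (Set.range v)) A ∧
      volume.real (convexHull ℝ (Set.range v)) * |A.det| ≤ 1 / 12 := by
  obtain ⟨M, hM⟩ : ∃ M : Matrix (Fin 3) (Fin 3) ℝ, ∀ i k, M k i = v i.succ k - v 0 k :=
    ⟨Matrix.of fun k i => v i.succ k - v 0 k, fun _ _ => rfl⟩
  have hvol := volume_convexHull_simplex_le v hM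
  have hdet : M.det ≠ 0 := by
    intro h0
    rw [h0] at hvol
    simp only [abs_zero, zero_div, ENNReal.ofReal_zero] at hvol
    exact (Measure.measure_pos_of_nonempty_interior volume hint).not_ge hvol
  have hu : IsUnit M.transpose.det := by
    rw [Matrix.det_transpose]; exact isUnit_iff_ne_zero.2 hdet
  -- C is the matrix of z ↦ (z i + Σ z j)/2. Its determinant 1/2, times the factor 1/6 of the
  -- volume, gives 1/12.
  set C : Matrix (Fin 3) (Fin 3) ℝ := !![1, 1 / 2, 1 / 2; 1 / 2, 1, 1 / 2; 1 / 2, 1 / 2, 1] with hC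
  have hCdet : C.det = 1 / 2 := by
    rw [hC, Matrix.det_fin_three]; simp; norm_num
  have hAdet : (M.transpose⁻¹ * C).det = (M.det)⁻¹ * (1 / 2) := by
    rw [Matrix.det_mul, Matrix.det_nonsing_inv, Matrix.det_transpose, Ring.inverse_eq_inv', hCdet]
  refine ⟨M.transpose⁻¹ * C, ?_, admissible_simplex v fun i z => ?_, ?_⟩
  · rw [hAdet]; positivity
  · have h1 : (v i.succ - v 0) = fun k => M.transpose i k := by
      ext k; simp [hM]
    rw [h1]
    have h2 : M.transpose.mulVec ((M.transpose⁻¹ * C).mulVec z) = C.mulVec z := by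
      rw [Matrix.mulVec_mulVec, ← Matrix.mul_assoc, Matrix.mul_nonsing_inv _ hu, Matrix.one_mul]
    have h3 := congrFun h2 i
    simp only [Matrix.mulVec] at h3 ⊢
    rw [h3]
    fin_cases i <;> simp [hC, dotProduct, Fin.sum_univ_three] <;> ring
  · have h1 : volume.real (convexHull ℝ (Set.range v)) ≤ |M.det| / 6 :=
      ENNReal.toReal_le_of_le_ofReal (by positivity) hvol
    rw [hAdet, abs_mul, abs_inv, abs_of_pos (by norm_num : (0 : ℝ) < 1 / 2)]
    have hp := abs_pos.2 hdet
    calc _ ≤ |M.det| / 6 * (|M.det|⁻¹ * (1 / 2)) := by gcongr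
      _ = 1 / 12 := by field_simp; norm_num

/-! ### The minimal density -/

theorem corollary1 (K : ConvexBody (EuclideanSpace ℝ (Fin 3)))
    (hK : (interior (K : Set (EuclideanSpace ℝ (Fin 3)))).Nonempty) :
    IsLeast (nonSeparableDensities (K : Set (EuclideanSpace ℝ (Fin 3))))
        (minNonSeparableDensity (K : Set (EuclideanSpace ℝ (Fin 3)))) ∧
      1 / 12 ≤ minNonSeparableDensity (K : Set (EuclideanSpace ℝ (Fin 3))) ∧
      ((∃ s : Affine.Simplex ℝ (EuclideanSpace ℝ (Fin 3)) 3,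
          (K : Set (EuclideanSpace ℝ (Fin 3))) = convexHull ℝ (Set.range s.points)) →
        minNonSeparableDensity (K : Set (EuclideanSpace ℝ (Fin 3))) = 1 / 12) := by
  have hKc := K.isCompact
  have hKx := K.convex
  have hmem := fun δ => mem_nonSeparableDensities_iff (δ := δ) hKc hKx hK
  set e := EuclideanSpace.equiv (Fin 3) ℝ with he
  have hKc' : IsCompact (e '' (K : Set (EuclideanSpace ℝ (Fin 3)))) := hKc.image e.continuous
  have hKx' : Convex ℝ (e '' (K : Set (EuclideanSpace ℝ (Fin 3)))) :=
    hKx.linear_image e.toLinearEquiv.toLinearMap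
  have hint' : (interior (e '' (K : Set (EuclideanSpace ℝ (Fin 3))))).Nonempty := by
    have := e.toHomeomorph.image_interior (K : Set (EuclideanSpace ℝ (Fin 3)))
    have h2 : interior (e '' (K : Set (EuclideanSpace ℝ (Fin 3))))
      = e '' interior (K : Set (EuclideanSpace ℝ (Fin 3))) := this.symm
    rw [h2]
    exact hK.image _
  have hvol : volume.real (e '' (K : Set (EuclideanSpace ℝ (Fin 3))))
      = volume.real (K : Set (EuclideanSpace ℝ (Fin 3))) := by
    rw [measureReal_def, measureReal_def, volume_image_equiv]
  obtain ⟨c, hc, hball⟩ := exists_ball_subset_sub hint'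
  have hDc : IsCompact (e '' (K : Set (EuclideanSpace ℝ (Fin 3))) -
      e '' (K : Set (EuclideanSpace ℝ (Fin 3)))) := by
    rw [sub_eq_add_neg]
    exact hKc'.add hKc'.neg
  obtain ⟨A, hA, hdet, hmin⟩ := exists_admissible_abs_det_le hDc hc hball
  have hleast : IsLeast (nonSeparableDensities (K : Set (EuclideanSpace ℝ (Fin 3))))
      (volume.real (K : Set (EuclideanSpace ℝ (Fin 3))) * |A.det|) := by
    refine ⟨(hmem _).2 ⟨A, hA, hdet, rfl⟩, ?_⟩
    intro δ hδ
    obtain ⟨B, hB, hBdet, rfl⟩ := (hmem δ).1 hδ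
    exact mul_le_mul_of_nonneg_left (hmin B hB hBdet) measureReal_nonneg
  have hmineq : minNonSeparableDensity (K : Set (EuclideanSpace ℝ (Fin 3)))
      = volume.real (K : Set (EuclideanSpace ℝ (Fin 3))) * |A.det| := hleast.csInf_eq
  have hlower : 1 / 12 ≤ minNonSeparableDensity (K : Set (EuclideanSpace ℝ (Fin 3))) := by
    rw [hmineq, ← hvol]
    have key := one_div_twelve_le_volume_mul hKc' hKx' (hint'.mono interior_subset) hA hdet
    rw [← ENNReal.ofReal_toReal hKc'.measure_ne_top,
      ← ENNReal.ofReal_mul ENNReal.toReal_nonneg] at key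
    exact (ENNReal.ofReal_le_ofReal_iff (mul_nonneg ENNReal.toReal_nonneg (abs_nonneg _))).1 key
  refine ⟨by rw [hmineq]; exact hleast, hlower, ?_⟩
  rintro ⟨s, hs⟩
  refine le_antisymm ?_ hlower
  have himage : e '' (K : Set (EuclideanSpace ℝ (Fin 3)))
      = convexHull ℝ (Set.range fun i => e (s.points i)) := by
    rw [hs]
    have := e.toLinearEquiv.toLinearMap.image_convexHull (Set.range s.points)
    rw [← Set.range_comp] at this
    exact this
  rw [himage] at hint' hvol hmem
  obtain ⟨B, hBdet, hB, hle⟩ := exists_admissible_simplex _ hint'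
  rw [hmineq]
  refine (hleast.2 ((hmem _).2 ⟨B, hB, hBdet, rfl⟩)).trans ?_
  rw [← hvol]
  exact hle
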